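/- **Model.** Let $K:\mathbb R\to[0,\infty)$ be a $C^\infty$ kernel with support in $[-1,1]$ and $\int K=1$, put $K_h(t)=h^{-1}K(t/h)$, and let $L>0$. Let $p_n=2m_n$ with $m_n\ge 1$ and $p_n^2/n\to0$. Let $X\sim N(0,n^{-1}I_{p_n})$, let $\Pi_2:\mathbb R^{p_n}\to\mathbb R^{m_n}$ be the projection on the first $m_n$ coordinates, and consider the contrast $$\mathcal L(\upsilon)=nX^\top\upsilon-\tfrac n2\|\upsilon\|^2+f(\upsilon)\,\tfrac n3\|\upsilon\|^3,\qquad f(\upsilon)=\varphi_h(\|\Pi_2\upsilon\|)\,\mathbf 1\{\|\upsilon\|\le 2\sqrt{p_n/n}\},$$ $$\varphi_h(s)=\int_{\mathbb R}\mathbf 1\{|u|\ge h\}\,K_h(s-u)\,du,\qquad h=\tfrac1L\sqrt{p_n/n}.$$ The target is $\theta=\Pi_2\upsilon$, the nuisance $\eta$ is the vector of the last $m_n$ coordinates, and $\upsilon^*=0$, $\theta^*=0$. Write $\breve L(\theta)=\max_{\Pi_2\upsilon=\theta}\mathcal L(\upsilon)$, let $\tilde\theta$ be a maximizer of $\breve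 L$, $\tilde\upsilon$ a maximizer of $\mathcal L$ and $\tilde\upsilon_{\theta^*}$ a maximizer of $\mathcal L$ under $\Pi_2\upsilon=\theta^*$. Let $\zeta=\mathcal L-\mathbb E\mathcal L$, let $\mathcal D^2=-\nabla^2\mathbb E\mathcal L(\upsilon^*)$ have the blocks $D^2,A,A^\top,H^2$, and let $\mathcal V^2=\operatorname{Cov}\nabla\mathcal L(\upsilon^*)$, $\breve D^2=D^2-AH^{-2}A^\top$, $\breve\xi=\breve D^{-1}(\nabla_\theta-AH^{-2}\nabla_\eta)\zeta(\upsilon^*)$, $\Upsilon(r)=\{\upsilon:\|\mathcal D\upsilon\|\le r\}$. Hessians on a ball are taken within the ball (one-sided at its boundary), and matrix norms are operator norms. **Theorem.** There are constants $\tilde L,C>0$ depending only on $K$ and $L$ such that the following holds. 1. $0\le f\le1$, $f(\upsilon)=0$ if $\Pi_2\upsilon=0$, and $f(\upsilon)=1$ if $\|\Pi_2\upsilon\|\ge\frac2L\sqrt{p_n/n}$ and $\|\upsilon\|\le2\sqrt{p_n/n}$. 2. For all large $n$, $\mathbb E\mathcal L$ is $C^2$ on the ball $\{\|\upsilon\|\le2\sqrt{p_n/n}\}$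 and $\|\nabla^2\mathbb E\mathcal L(\upsilon)-\nabla^2\mathbb E\mathcal L(\upsilon')\|\le n\tilde L\|\upsilon-\upsilon'\|$ there. 3. For all large $n$ and every $r_0\in(0,2\sqrt{p_n}]$: $\mathcal L(\upsilon)$ is integrable for each $\upsilon$, $\zeta$ is differentiable and $\mathcal L$ is differentiable at $\upsilon^*$; $\upsilon^*=0$ is the unique maximizer of $\mathbb E\mathcal L$; $\mathcal D=\mathcal V=\sqrt n\,I_{p_n}$, $A=0$, $D=H=\breve D=\sqrt n\,I_{m_n}$; the maximizers $\tilde\upsilon,\tilde\upsilon_{\theta^*},\tilde\theta$ exist; and, with $\delta(r)=\tilde Lr/\sqrt n$, $\omega=1/\sqrt n\le\frac12$, $g=\sqrt n$, - ($\mathcal I$) $\|H^{-1}A^\top D^{-1}\|\le\nu:=0$; - ($\mathcal L_0$) $\|\mathcal D^{-1}(-\nabla^2\mathbb E\mathcal L(\upsilon))\mathcal D^{-1}-I\|\le\delta(r)$ for $\upsilon\in\Upsilon(r)$, $0<r\le r_0$, and the same bound $\delta(r)$ for $\|D^{-1}D^2(\upsilon)D^{-1}-I\|$, $\|D^{-1}(A(\upsilon)-A)H^{-1}\|$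 and $\|D^{-1}AH^{-1}(I-H^{-1}H^2(\upsilon)H^{-1})\|$, where $D^2(\upsilon),A(\upsilon),H^2(\upsilon)$ are the blocks of $-\nabla^2\mathbb E\mathcal L(\upsilon)$; - ($\mathcal{ED}_0$) $\log\mathbb E\exp\{\mu\langle\nabla\zeta(\upsilon^*),\gamma\rangle/\|\mathcal V\gamma\|\}\le\mu^2/2$ for $|\mu|\le g$, $\gamma\ne0$; - ($\mathcal{ED}_1$) $\log\mathbb E\exp\{\mu\gamma^\top\mathcal D^{-1}(\nabla\zeta(\upsilon)-\nabla\zeta(\upsilon'))/(\omega\|\mathcal D(\upsilon-\upsilon')\|)\}\le\mu^2/2$ for $|\mu|\le g$, $\|\gamma\|=1$, $\upsilon\ne\upsilon'$ in $\Upsilon(r)$, $0<r<r_0$; - ($\mathcal Lr$) $-\mathbb E[\mathcal L(\upsilon)-\mathcal L(\upsilon^*)]/\|\mathcal D(\upsilon-\upsilon^*)\|^2\ge\frac14$ for $\upsilon\in\Upsilon(r)\setminus\{\upsilon^*\}$, $r>r_0$; - ($\mathcal Er$) $\log\mathbb E\exp\{\mu\langle\nabla\zeta(\upsilon),\gamma\rangle/\|\mathcal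 D\gamma\|\}\le\mu^2/2$ for $\upsilon\in\Upsilon(r)$, $r\ge r_0$, $\mu\le g$, $\gamma\ne0$. 4. Let $r_0(x)=\inf\{r>0:\mathbb P(\text{all }\tilde\upsilon,\tilde\upsilon_{\theta^*}\text{ lie in }\Upsilon(r))\ge1-e^{-x}\}$ and $$\Diamond(r,x)=\Big(\tfrac{8}{(1-\nu^2)^2}\delta(r)+6\nu_1\omega\,z(x,2p_n+2m_n)\Big)r,\quad \nu=0,\ \nu_1=1,$$ where $z(x,Q)=\sqrt{2(x+Q)}$ if this is at most $g$, and $z(x,Q)=g^{-1}(x+Q)+g/2$ otherwise. For all large $n$ and all $0<x\le p_n/2$: $\mathbb P(\text{all }\tilde\upsilon,\tilde\upsilon_{\theta^*}\text{ lie in }\Upsilon(2\sqrt{p_n}))\ge1-e^{-x}$, $0<r_0(x)\le2\sqrt{p_n}$, and $\Diamond(r_0(x),x)\le Cp_n/\sqrt n$. 5. $\breve\xi\sim N(0,I_{m_n})$, so $\|\breve\xi\|^2\sim\chi^2_{m_n}$, for every $n\ge1$. 6. (Fisher expansion) With probability tending to one, all $\tilde\theta$ satisfy $\|\breve D(\tilde\theta-\theta^*)-\breve\xi\|\le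 Cp_n/\sqrt n$; in particular $\breve D(\tilde\theta-\theta^*)-\breve\xi\to0$ in probability. 7. (Wilks phenomenon) If $p_n^3/n\to0$, then $2\{\breve L(\tilde\theta)-\breve L(\theta^*)\}-\|\breve\xi\|^2\to0$ in probability. Conversely, if the support of $K$ is exactly $[-1,1]$, or if $L\ge2\sqrt2$, then this convergence implies $p_n^3/n\to0$. -/

import Mathlib

open MeasureTheory ProbabilityTheory Filter Topology Set
open scoped Matrix.Norms.L2Operator

noncomputable section

namespace ProfileEst

/-! ### Semiparametric profile M-estimation -/

/-- Full parameters `υ = (θ, η)` with target `θ ∈ ℝ^p` (the first `p` coordinates) and nuisance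
`η ∈ ℝ^q`, with the Euclidean norm. -/
abbrev Par (p q : ℕ) : Type := EuclideanSpace ℝ (Fin p ⊕ Fin q)

/-- Orthogonal projection on the target component. -/
def target {p q : ℕ} (υ : Par p q) : EuclideanSpace ℝ (Fin p) :=
  WithLp.toLp 2 fun i => υ (Sum.inl i)

/-- Orthogonal projection on the nuisance component. -/
def nuisance {p q : ℕ} (υ : Par p q) : EuclideanSpace ℝ (Fin q) :=
  WithLp.toLp 2 fun j => υ (Sum.inr j)

/-- The set of full maximizers `υ̃` of a contrast. -/
def maximizers {p q : ℕ} (ℓ : Par p q → ℝ) : Set (Par p q) := {υ | ∀ w, ℓ w ≤ ℓ υ}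

/-- The set of maximizers `υ̃_θ` of a contrast subject to the target being equal to `θ`. -/
def maximizersAt {p q : ℕ} (ℓ : Par p q → ℝ) (θ : EuclideanSpace ℝ (Fin p)) : Set (Par p q) :=
  {υ | target υ = θ ∧ ∀ w, target w = θ → ℓ w ≤ ℓ υ}

/-- The profile contrast `L̆(θ) = max { ℓ(υ) : target of υ is θ }`. -/
def profile {p q : ℕ} (ℓ : Par p q → ℝ) (θ : EuclideanSpace ℝ (Fin p)) : ℝ :=
  ⨆ υ : {υ : Par p q // target υ = θ}, ℓ υ

/-- The set of profile estimators `θ̃`, the maximizers of the profile contrast. -/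
def profileEstimators {p q : ℕ} (ℓ : Par p q → ℝ) : Set (EuclideanSpace ℝ (Fin p)) :=
  {θ | ∀ θ', profile ℓ θ' ≤ profile ℓ θ}

/-- The semiparametric excess `L̆(θ̃) - L̆(θ₀)`. -/
def excess {p q : ℕ} (ℓ : Par p q → ℝ) (θ₀ : EuclideanSpace ℝ (Fin p)) : ℝ :=
  (⨆ θ, profile ℓ θ) - profile ℓ θ₀

/-! ### Expectation, stochastic component, information matrices -/

/-- The expected contrast `υ ↦ E ℒ(υ)`. -/
def meanContrast {Ω : Type*} [MeasurableSpace Ω] {p q : ℕ} (P : Measure Ω)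
    (ℒ : Ω → Par p q → ℝ) (υ : Par p q) : ℝ := ∫ ω, ℒ ω υ ∂P

/-- The stochastic component `ζ(υ) = ℒ(υ) - E ℒ(υ)`. -/
def stoch {Ω : Type*} [MeasurableSpace Ω] {p q : ℕ} (P : Measure Ω)
    (ℒ : Ω → Par p q → ℝ) (ω : Ω) (υ : Par p q) : ℝ := ℒ ω υ - meanContrast P ℒ υ

/-- The matrix of second partial derivatives of `g` at `x`, computed within the set `S`
(one-sided at boundary points of `S`; the ordinary Hessian at interior points). -/
def hessian {p q : ℕ} (g : Par p q → ℝ) (S : Set (Par p q)) (x : Par p q) :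
    Matrix (Fin p ⊕ Fin q) (Fin p ⊕ Fin q) ℝ :=
  Matrix.of fun i j => fderivWithin ℝ (fderivWithin ℝ g S) S x
    (EuclideanSpace.single i 1) (EuclideanSpace.single j 1)

/-- `𝒟²(υ) = -∇²Eℒ(υ)`, with derivatives within `S`. -/
def info {Ω : Type*} [MeasurableSpace Ω] {p q : ℕ} (P : Measure Ω)
    (ℒ : Ω → Par p q → ℝ) (S : Set (Par p q)) (υ : Par p q) :
    Matrix (Fin p ⊕ Fin q) (Fin p ⊕ Fin q) ℝ := -hessian (meanContrast P ℒ) S υ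

/-- The covariance matrix of the gradient of the contrast at `υ`. -/
def gradCov {Ω : Type*} [MeasurableSpace Ω] {p q : ℕ} (P : Measure Ω)
    (ℒ : Ω → Par p q → ℝ) (υ : Par p q) : Matrix (Fin p ⊕ Fin q) (Fin p ⊕ Fin q) ℝ :=
  Matrix.of fun i j => covariance (fun ω => gradient (ℒ ω) υ i) (fun ω => gradient (ℒ ω) υ j) P

/-- The matrices `𝒟`, `𝒱`, the blocks `D`, `A`, `H` in `𝒟² = (D², A; Aᵀ, H²)`, and `D̆`. -/
structure Matrices (p q : ℕ) where
  DD : Matrix (Fin p ⊕ Fin q) (Fin p ⊕ Fin q) ℝ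
  VV : Matrix (Fin p ⊕ Fin q) (Fin p ⊕ Fin q) ℝ
  D : Matrix (Fin p) (Fin p) ℝ
  A : Matrix (Fin p) (Fin q) ℝ
  H : Matrix (Fin q) (Fin q) ℝ
  Dbr : Matrix (Fin p) (Fin p) ℝ

/-- `M` consists of the matrices of the model at the central point `υ₀`:
`𝒟² = -∇²Eℒ(υ₀)`, `𝒱² = Cov ∇ℒ(υ₀)`, `𝒟² = (D², A; Aᵀ, H²)`, `D̆² = D² - A H⁻² Aᵀ`, all square
roots being the positive definite ones. -/
structure Matrices.IsOf {Ω : Type*} [MeasurableSpace Ω] {p q : ℕ} (M : Matrices p q)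
    (P : Measure Ω) (ℒ : Ω → Par p q → ℝ) (υ₀ : Par p q) : Prop where
  DD_pos : M.DD.PosDef
  DD_sq : M.DD * M.DD = info P ℒ univ υ₀
  VV_pos : M.VV.PosDef
  VV_sq : M.VV * M.VV = gradCov P ℒ υ₀
  D_pos : M.D.PosDef
  D_sq : M.D * M.D = (M.DD * M.DD).toBlocks₁₁
  A_eq : M.A = (M.DD * M.DD).toBlocks₁₂
  H_pos : M.H.PosDef
  H_sq : M.H * M.H = (M.DD * M.DD).toBlocks₂₂
  Dbr_pos : M.Dbr.PosDef
  Dbr_sq : M.Dbr * M.Dbr = M.D * M.D - M.A * (M.H * M.H)⁻¹ * M.A.transpose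

/-- The normalized efficient score `ξ̆ = D̆⁻¹ (∇_θ - A H⁻² ∇_η)`, where `∇ = ∇ζ(υ₀)`. -/
def effScore {Ω : Type*} [MeasurableSpace Ω] {p q : ℕ} (M : Matrices p q)
    (P : Measure Ω) (ℒ : Ω → Par p q → ℝ) (υ₀ : Par p q) (ω : Ω) : EuclideanSpace ℝ (Fin p) :=
  Matrix.toEuclideanLin M.Dbr⁻¹
    (target (gradient (stoch P ℒ ω) υ₀) -
      Matrix.toEuclideanLin (M.A * (M.H * M.H)⁻¹) (nuisance (gradient (stoch P ℒ ω) υ₀)))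

/-- The local set `Υ(r) = { υ : ‖𝒟 (υ - υ₀)‖ ≤ r }`. -/
def localSet {p q : ℕ} (M : Matrices p q) (υ₀ : Par p q) (r : ℝ) : Set (Par p q) :=
  {υ | ‖Matrix.toEuclideanLin M.DD (υ - υ₀)‖ ≤ r}

/-! ### The conditions -/

/-- `E exp(μ Y)` is finite and `log E exp(μ Y) ≤ ν² μ² / 2`. -/
def ExpBound {Ω : Type*} [MeasurableSpace Ω] (P : Measure Ω) (Y : Ω → ℝ) (μ ν : ℝ) : Prop :=
  Integrable (fun ω => Real.exp (μ * Y ω)) P ∧ cgf Y P μ ≤ ν ^ 2 * μ ^ 2 / 2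

/-- Identifiability `(ℐ)`. -/
def CondI {p q : ℕ} (M : Matrices p q) (ν : ℝ) : Prop :=
  ν < 1 ∧ ‖M.H⁻¹ * M.A.transpose * M.D⁻¹‖ ≤ ν

/-- Local smoothness `(ℒ₀)`: `‖𝒟⁻¹ 𝒟²(υ) 𝒟⁻¹ - I‖ ≤ δ(r)` on `Υ(r)`, `r ≤ r₀`, where
`𝒟²(υ) = -∇²Eℒ(υ)`. -/
def CondL0 {Ω : Type*} [MeasurableSpace Ω] {p q : ℕ} (M : Matrices p q) (P : Measure Ω)
    (ℒ : Ω → Par p q → ℝ) (υ₀ : Par p q) (r₀ : ℝ) (δ : ℝ → ℝ) : Prop :=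
  ContDiffOn ℝ 2 (meanContrast P ℒ) (localSet M υ₀ r₀) ∧
  ∀ r, 0 < r → r ≤ r₀ → ∀ υ ∈ localSet M υ₀ r,
    ‖M.DD⁻¹ * info P ℒ (localSet M υ₀ r₀) υ * M.DD⁻¹ - 1‖ ≤ δ r

/-- The block version `(ℒ̆₀)` of local smoothness, with the blocks `D²(υ)`, `A(υ)`, `H²(υ)` of
`𝒟²(υ) = -∇²Eℒ(υ)`. -/
def CondL0Block {Ω : Type*} [MeasurableSpace Ω] {p q : ℕ} (M : Matrices p q) (P : Measure Ω)
    (ℒ : Ω → Par p q → ℝ) (υ₀ : Par p q) (r₀ : ℝ) (δ : ℝ → ℝ) : Prop :=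
  ContDiffOn ℝ 2 (meanContrast P ℒ) (localSet M υ₀ r₀) ∧
  ∀ r, 0 < r → r ≤ r₀ → ∀ υ ∈ localSet M υ₀ r,
    ‖M.D⁻¹ * (info P ℒ (localSet M υ₀ r₀) υ).toBlocks₁₁ * M.D⁻¹ - 1‖ ≤ δ r ∧
    ‖M.D⁻¹ * ((info P ℒ (localSet M υ₀ r₀) υ).toBlocks₁₂ - M.A) * M.H⁻¹‖ ≤ δ r ∧
    ‖M.D⁻¹ * M.A * M.H⁻¹ *
      (1 - M.H⁻¹ * (info P ℒ (localSet M υ₀ r₀) υ).toBlocks₂₂ * M.H⁻¹)‖ ≤ δ r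

/-- `(ℰ𝒟₀)`: exponential moments of the score at the central point. -/
def CondED0 {Ω : Type*} [MeasurableSpace Ω] {p q : ℕ} (M : Matrices p q) (P : Measure Ω)
    (ℒ : Ω → Par p q → ℝ) (υ₀ : Par p q) (ν₀ g : ℝ) : Prop :=
  0 < ν₀ ∧ 0 < g ∧ ∀ μ : ℝ, |μ| ≤ g → ∀ γ : Par p q, γ ≠ 0 →
    ExpBound P (fun ω => inner ℝ (gradient (stoch P ℒ ω) υ₀) γ /
      ‖Matrix.toEuclideanLin M.VV γ‖) μ ν₀

/-- `(ℰ𝒟₁)`: exponential moments of the increments of the score. -/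
def CondED1 {Ω : Type*} [MeasurableSpace Ω] {p q : ℕ} (M : Matrices p q) (P : Measure Ω)
    (ℒ : Ω → Par p q → ℝ) (υ₀ : Par p q) (r₀ ν₁ g ω₀ : ℝ) : Prop :=
  0 < g ∧ 0 < ω₀ ∧ ω₀ ≤ 1 / 2 ∧ ∀ μ : ℝ, |μ| ≤ g → ∀ r, 0 < r → r < r₀ →
    ∀ υ ∈ localSet M υ₀ r, ∀ υ' ∈ localSet M υ₀ r, υ ≠ υ' → ∀ γ : Par p q, ‖γ‖ = 1 →
      ExpBound P (fun ω => inner ℝ γ (Matrix.toEuclideanLin M.DD⁻¹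
          (gradient (stoch P ℒ ω) υ - gradient (stoch P ℒ ω) υ')) /
        (ω₀ * ‖Matrix.toEuclideanLin M.DD (υ - υ')‖)) μ ν₁

/-- `(ℒr)`: the global drift condition. -/
def CondLr {Ω : Type*} [MeasurableSpace Ω] {p q : ℕ} (M : Matrices p q) (P : Measure Ω)
    (ℒ : Ω → Par p q → ℝ) (υ₀ : Par p q) (r₀ : ℝ) (b : ℝ → ℝ) : Prop :=
  ∀ r, r₀ < r → 0 < b r ∧ ∀ υ ∈ localSet M υ₀ r, υ ≠ υ₀ →
    b r ≤ -(meanContrast P ℒ υ - meanContrast P ℒ υ₀) / ‖Matrix.toEuclideanLin M.DD (υ - υ₀)‖ ^ 2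

/-- `(ℰr)`: the global exponential moment condition. -/
def CondEr {Ω : Type*} [MeasurableSpace Ω] {p q : ℕ} (M : Matrices p q) (P : Measure Ω)
    (ℒ : Ω → Par p q → ℝ) (υ₀ : Par p q) (r₀ : ℝ) (νr gr : ℝ → ℝ) : Prop :=
  ∀ r, r₀ ≤ r → 0 < gr r ∧ ∀ υ ∈ localSet M υ₀ r, ∀ μ : ℝ, μ ≤ gr r → ∀ γ : Par p q, γ ≠ 0 →
    ExpBound P (fun ω => inner ℝ (gradient (stoch P ℒ ω) υ) γ /
      ‖Matrix.toEuclideanLin M.DD γ‖) μ (νr r)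

/-- All conditions at once, at local radius `r₀` and central point `υ₀`, which is the unique
maximizer of the expected contrast. -/
structure Conditions {Ω : Type*} [MeasurableSpace Ω] {p q : ℕ} (M : Matrices p q) (P : Measure Ω)
    (ℒ : Ω → Par p q → ℝ) (υ₀ : Par p q) (r₀ ν ν₀ ν₁ g ω₀ : ℝ) (δ b νr gr : ℝ → ℝ) : Prop where
  integrable : ∀ υ, Integrable (fun ω => ℒ ω υ) P
  differentiable : ∀ ω, Differentiable ℝ (stoch P ℒ ω)
  differentiableAt : ∀ ω, DifferentiableAt ℝ (ℒ ω) υ₀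
  central : maximizers (meanContrast P ℒ) = {υ₀}
  matrices : M.IsOf P ℒ υ₀
  exists_max : ∀ ω, (maximizers (ℒ ω)).Nonempty
  exists_maxAt : ∀ ω, (maximizersAt (ℒ ω) (target υ₀)).Nonempty
  exists_profile : ∀ ω, (profileEstimators (ℒ ω)).Nonempty
  condI : CondI M ν
  condL0 : CondL0 M P ℒ υ₀ r₀ δ
  condL0Block : CondL0Block M P ℒ υ₀ r₀ δ
  condED0 : CondED0 M P ℒ υ₀ ν₀ g
  condED1 : CondED1 M P ℒ υ₀ r₀ ν₁ g ω₀
  condLr : CondLr M P ℒ υ₀ r₀ b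
  condEr : CondEr M P ℒ υ₀ r₀ νr gr

/-! ### Radius and semiparametric spread -/

/-- The set of radii `r > 0` such that, with probability at least `1 - e⁻ˣ`, all full maximizers
and all maximizers under `θ = θ*` lie in `Υ(r)`. -/
def goodRadii {Ω : Type*} [MeasurableSpace Ω] {p q : ℕ} (M : Matrices p q) (P : Measure Ω)
    (ℒ : Ω → Par p q → ℝ) (υ₀ : Par p q) (x : ℝ) : Set ℝ :=
  {r | 0 < r ∧ ENNReal.ofReal (1 - Real.exp (-x)) ≤
    P {ω | maximizers (ℒ ω) ⊆ localSet M υ₀ r ∧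
      maximizersAt (ℒ ω) (target υ₀) ⊆ localSet M υ₀ r}}

/-- The radius `r₀(x)`. -/
def radius {Ω : Type*} [MeasurableSpace Ω] {p q : ℕ} (M : Matrices p q) (P : Measure Ω)
    (ℒ : Ω → Par p q → ℝ) (υ₀ : Par p q) (x : ℝ) : ℝ := sInf (goodRadii M P ℒ υ₀ x)

/-- The entropy term `z(x, Q)` with exponential moment range `g`. -/
def zfun (g x Q : ℝ) : ℝ :=
  if √(2 * (x + Q)) ≤ g then √(2 * (x + Q)) else g⁻¹ * (x + Q) + g / 2

/-- The semiparametric spread `◊(r, x)` for full dimension `pfull` and target dimension `p`. -/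
def spread (ν ν₁ g ω₀ : ℝ) (δ : ℝ → ℝ) (pfull p r x : ℝ) : ℝ :=
  (8 / (1 - ν ^ 2) ^ 2 * δ r + 6 * ν₁ * ω₀ * zfun g x (2 * pfull + 2 * p)) * r

/-! ### The model -/

/-- `K` is a smooth (nonnegative, normalized) kernel with support in `[-1, 1]`. -/
structure IsSmoothKernel (K : ℝ → ℝ) : Prop where
  smooth : ContDiff ℝ ((⊤ : ℕ∞) : WithTop ℕ∞) K
  nonneg : ∀ t, 0 ≤ K t
  support_subset : tsupport K ⊆ Icc (-1) 1
  integral_eq_one : ∫ t, K t = 1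

/-- The rescaled kernel `K_h(t) = K(t / h) / h`. -/
def scaledKernel (K : ℝ → ℝ) (h t : ℝ) : ℝ := 1 / h * K (t / h)

/-- The smoothed step `s ↦ ∫ 1{|u| ≥ h} K_h(s - u) du`. -/
def smoothStep (K : ℝ → ℝ) (h s : ℝ) : ℝ :=
  ∫ u, indicator {u : ℝ | h ≤ |u|} (fun u => scaledKernel K h (s - u)) u

/-- The closed ball of radius `2 √(p_n / n)`, `p_n = 2 m`, around `0`. -/
def modelBall (n m : ℕ) : Set (Par m m) := Metric.closedBall 0 (2 * √((2 * m : ℝ) / n))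

/-- The cutoff `f`: the step at scale `h = L⁻¹ √(p_n / n)`, `p_n = 2 m`, evaluated at the norm of
the target component, times the indicator of the ball of radius `2 √(p_n / n)`. -/
def cutoff (K : ℝ → ℝ) (L : ℝ) (n m : ℕ) (υ : Par m m) : ℝ :=
  smoothStep K (1 / L * √((2 * m : ℝ) / n)) ‖target υ‖ *
    indicator (modelBall n m) (fun _ => (1 : ℝ)) υ

/-- The contrast `n xᵀυ - n ‖υ‖² / 2 + f(υ) n ‖υ‖³ / 3` at the observation `x`. -/
def contrast (K : ℝ → ℝ) (L : ℝ) (n m : ℕ) (x υ : Par m m) : ℝ :=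
  n * inner ℝ x υ - n * ‖υ‖ ^ 2 / 2 + cutoff K L n m υ * (n * ‖υ‖ ^ 3 / 3)

/-- The random contrasts of the sequence of models with observations `X n` and `p_n = 2 m_n`. -/
def modelContrast (K : ℝ → ℝ) (L : ℝ) (m : ℕ → ℕ) {Ω : ℕ → Type*}
    (X : ∀ n, Ω n → Par (m n) (m n)) (n : ℕ) (ω : Ω n) (υ : Par (m n) (m n)) : ℝ :=
  contrast K L n (m n) (X n ω) υ

/-- The matrices of the model: `𝒟 = 𝒱 = √n I`, `D = H = D̆ = √n I`, `A = 0`. -/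
def modelMatrices (n m : ℕ) : Matrices m m where
  DD := √(n : ℝ) • 1
  VV := √(n : ℝ) • 1
  D := √(n : ℝ) • 1
  A := 0
  H := √(n : ℝ) • 1
  Dbr := √(n : ℝ) • 1

/-- The model: `X` is a random vector with law `N(0, n⁻¹ I)` on `ℝ^(2m)`. -/
def IsModel {Ω : Type*} [MeasurableSpace Ω] (P : Measure Ω) (n m : ℕ) (X : Ω → Par m m) : Prop :=
  HasLaw X (multivariateGaussian 0 ((n : ℝ)⁻¹ • 1)) P

/-- The Wilks phenomenon for a sequence of contrasts: `2 (L̆(θ̃) - L̆(θ*)) - ‖ξ̆‖² → 0` in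
probability. -/
def WilksPhenomenon (m : ℕ → ℕ) {Ω : ℕ → Type*} [∀ n, MeasurableSpace (Ω n)]
    (P : ∀ n, Measure (Ω n)) (M : ∀ n, Matrices (m n) (m n))
    (ℒ : ∀ n, Ω n → Par (m n) (m n) → ℝ) : Prop :=
  ∀ ε : ℝ, 0 < ε → Tendsto (fun n => P n {ω |
    ε ≤ |2 * excess (ℒ n ω) 0 - ‖effScore (M n) (P n) (ℒ n) 0 ω‖ ^ 2|}) atTop (𝓝 0)

/-- The Fisher expansion for a sequence of contrasts: `D̆ (θ̃ - θ*) - ξ̆ → 0` in probability,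
uniformly over all profile estimators `θ̃`. -/
def FisherExpansion (m : ℕ → ℕ) {Ω : ℕ → Type*} [∀ n, MeasurableSpace (Ω n)]
    (P : ∀ n, Measure (Ω n)) (M : ∀ n, Matrices (m n) (m n))
    (ℒ : ∀ n, Ω n → Par (m n) (m n) → ℝ) : Prop :=
  ∀ ε : ℝ, 0 < ε → Tendsto (fun n => P n {ω | ∃ θ ∈ profileEstimators (ℒ n ω),
    ε ≤ ‖Matrix.toEuclideanLin (M n).Dbr (θ - 0) - effScore (M n) (P n) (ℒ n) 0 ω‖})
    atTop (𝓝 0)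

/-- The Fisher expansion with error rate `C p_n / √n`, `p_n = 2 m`: with probability tending to
one, every profile estimator satisfies `‖D̆ (θ̃ - θ*) - ξ̆‖ ≤ C p_n / √n`. -/
def FisherRate (C : ℝ) (m : ℕ → ℕ) {Ω : ℕ → Type*} [∀ n, MeasurableSpace (Ω n)]
    (P : ∀ n, Measure (Ω n)) (M : ∀ n, Matrices (m n) (m n))
    (ℒ : ∀ n, Ω n → Par (m n) (m n) → ℝ) : Prop :=
  Tendsto (fun n => P n {ω | ∃ θ ∈ profileEstimators (ℒ n ω),
    C * (2 * m n : ℝ) / √(n : ℝ) <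
      ‖Matrix.toEuclideanLin (M n).Dbr (θ - 0) - effScore (M n) (P n) (ℒ n) 0 ω‖})
    atTop (𝓝 0)

end ProfileEst

end

open ProfileEst

set_option maxSynthPendingDepth 3

noncomputable section

namespace ProfileEst

/-! ### Flat functions composed with the square root -/

/-! Write `ρ = √(p/n)` for the scale `modelScale`. The contrast is the quadratic `n/2 ‖X‖² - n/2 ‖υ
- X‖²` plus a nonnegative cubic perturbation that lives on the ball of radius `2ρ`, vanishes where
the target is zero, and is at most `8nρ³/3`. Only the term `n⟨X, υ⟩` is random (`IsModel.stoch_eq`).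
Hence `∇ζ = nX` does not depend on `υ`: its normalized projections are exactly standard normal, its
increments are zero, and the stochastic conditions follow at once.

The analytic conditions need a Hessian of the cubic term that is Lipschitz with a constant free of
`n` and of the dimension. Homogeneity reduces this to bandwidth one (`exists_cubicTerm_bounds`).
There the term is `g(‖θ‖²) ‖υ‖³` with `g(t) = stepProfile K (√t)`, and `g` is smooth because the
step is flat at `0` (`contDiff_comp_sqrt`). The constants depend on the dimension nowhere, since
only norms and a contraction enter.

Wilks: on `θ = 0` the perturbation vanishes, so the profile there is explicit, and `gap_bounds`
encloses the Wilks error between `(2n/3) f(X) ‖X‖³` and `(16/3) nρ³ = (16/3) √(p³/n)`. The upper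
bound gives the direct claim. For the converse, `n ‖ΠX‖²`, with `Π` the target projection, is
chi-squared with `m = p/2` degrees of freedom. When `m` is large, the target therefore exceeds with
high probability a level `σh`, `σ < L/√2`, at which the step is positive, and the lower bound is of
order `√(p³/n)`.

Fisher: if `X` lies in the ball, so does every maximizer, and comparing values at `υ` and `X` gives
`‖υ - X‖ = O(ρ²)` (`norm_sub_le_of_mem_maximizers`); here `√n ρ² = p/√n`. If `X` is beyond the ball
by more than `3ρ√ρ`, entering the ball costs more than the perturbation returns, and `υ = X`
(`eq_of_mem_maximizers_of_lt_norm`). What remains is a thin shell whose Gaussian mass is small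
uniformly in the dimension (`exists_stdGaussian_shell_le`). The case outside the ball cannot be
neglected, because for bounded `p` its probability does not tend to zero. -/

lemma iteratedDeriv_eq_zero_of_nonpos {f : ℝ → ℝ} (hf : ContDiff ℝ ((⊤ : ℕ∞) : WithTop ℕ∞) f)
    (h0 : ∀ t ≤ 0, f t = 0) (k : ℕ) {t : ℝ} (ht : t ≤ 0) : iteratedDeriv k f t = 0 := by
  have hcont : Continuous (iteratedDeriv k f) :=
    hf.continuous_iteratedDeriv k (by exact_mod_cast le_top)
  have hneg : EqOn (iteratedDeriv k f) 0 (Iio 0) := by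
    intro s hs
    have h : f =ᶠ[𝓝 s] fun _ => (0 : ℝ) := by
      filter_upwards [Iio_mem_nhds hs] with u hu using h0 u (le_of_lt hu)
    rw [h.iteratedDeriv_eq k]
    simp
  have := hneg.closure hcont continuous_zero
  rw [closure_Iio] at this
  exact this ht

/-- All derivatives vanish at `0`, so integrating the order-`N` bound for the next derivative gains
one power of `s`. The induction on `N` therefore has to run over all `k` at once. -/
lemma iteratedDeriv_flat_bound {f : ℝ → ℝ} (hf : ContDiff ℝ ((⊤ : ℕ∞) : WithTop ℕ∞) f)
    (h0 : ∀ t ≤ 0, f t = 0) (N : ℕ) : ∀ k : ℕ, ∃ C : ℝ, 0 ≤ C ∧ ∀ s ∈ Icc (0 : ℝ) 1,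
      |iteratedDeriv k f s| ≤ C * s ^ N := by
  induction N with
  | zero =>
    intro k
    have hcont : Continuous (iteratedDeriv k f) :=
      hf.continuous_iteratedDeriv k (by exact_mod_cast le_top)
    obtain ⟨C, hC⟩ := isCompact_Icc.exists_bound_of_continuousOn (s := Icc (0 : ℝ) 1)
      hcont.continuousOn
    refine ⟨C, (norm_nonneg _).trans (hC 0 (by simp)), fun s hs => ?_⟩
    simpa using hC s hs
  | succ N ih =>
    intro k
    obtain ⟨C, hC0, hC⟩ := ih (k + 1)
    refine ⟨C, hC0, fun s hs => ?_⟩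
    have hd : Differentiable ℝ (iteratedDeriv k f) :=
      hf.differentiable_iteratedDeriv k (by exact_mod_cast WithTop.coe_lt_top _)
    have := (convex_Icc (0 : ℝ) s).norm_image_sub_le_of_norm_deriv_le (f := iteratedDeriv k f)
      (C := C * s ^ N) (x := 0) (y := s) (fun x _ => hd x) (fun x hx => by
        rw [← iteratedDeriv_succ]
        refine (hC x ⟨hx.1, hx.2.trans hs.2⟩).trans ?_
        gcongr
        · exact hx.1
        · exact hx.2) ⟨le_rfl, hs.1⟩ ⟨hs.1, le_rfl⟩
    rw [iteratedDeriv_eq_zero_of_nonpos hf h0 k le_rfl, sub_zero, sub_zero, Real.norm_eq_abs,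
      Real.norm_eq_abs, abs_of_nonneg hs.1] at this
    calc _ ≤ _ := this
      _ = _ := by ring

/-- The functions `t ↦ f⁽ᵏ⁾(√t) / (√t)^j`, a family closed under differentiation if `f` is
flat at `0`. -/
def sqrtQuot (f : ℝ → ℝ) (j k : ℕ) (t : ℝ) : ℝ := iteratedDeriv k f (√t) / √t ^ j

/-- For `t > 0` this is the quotient rule. For `t ≤ 0` the convention `√t = 0` together with
flatness makes every member of the family vanish, so the same formula holds on the whole line and
can be iterated. -/
lemma hasDerivAt_sqrtQuot {f : ℝ → ℝ} (hf : ContDiff ℝ ((⊤ : ℕ∞) : WithTop ℕ∞) f)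
    (h0 : ∀ t ≤ 0, f t = 0) (j k : ℕ) (t : ℝ) :
    HasDerivAt (sqrtQuot f j k)
      (1 / 2 * sqrtQuot f (j + 1) (k + 1) t - j / 2 * sqrtQuot f (j + 2) k t) t := by
  have hzero : ∀ j k, ∀ s ≤ 0, sqrtQuot f j k s = 0 := fun j k s hs => by
    rw [sqrtQuot, Real.sqrt_eq_zero_of_nonpos hs, iteratedDeriv_eq_zero_of_nonpos hf h0 k le_rfl,
      zero_div]
  rcases lt_trichotomy t 0 with ht | rfl | ht
  · rw [hzero _ _ _ ht.le, hzero _ _ _ ht.le]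
    have h : sqrtQuot f j k =ᶠ[𝓝 t] fun _ => (0 : ℝ) := by
      filter_upwards [Iio_mem_nhds ht] with u hu using hzero _ _ _ (le_of_lt hu)
    simpa using (hasDerivAt_const t (0 : ℝ)).congr_of_eventuallyEq h
  · rw [hzero _ _ _ le_rfl, hzero _ _ _ le_rfl]
    -- Flatness of order `j + 4` leaves `(√u)^4 = u²` after division by `(√u)^j`, which is `o(u)`.
    obtain ⟨C, hC0, hC⟩ := iteratedDeriv_flat_bound hf h0 (j + 4) k
    rw [hasDerivAt_iff_isLittleO_nhds_zero]
    simp only [zero_add, hzero _ _ _ le_rfl, mul_zero, sub_zero, smul_zero]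
    have hO : (fun u => sqrtQuot f j k u) =O[𝓝 0] fun u : ℝ => u ^ 2 := by
      refine Asymptotics.IsBigO.of_bound C ?_
      filter_upwards [Iio_mem_nhds (zero_lt_one' ℝ)] with u hu
      rcases le_or_gt u 0 with hu0 | hu0
      · rw [hzero _ _ _ hu0, norm_zero]; positivity
      · have hs : 0 < √u := Real.sqrt_pos.2 hu0
        have hs1 : √u ≤ 1 := Real.sqrt_le_one.2 (le_of_lt hu)
        have := hC (√u) ⟨hs.le, hs1⟩
        rw [sqrtQuot, norm_div, Real.norm_eq_abs, Real.norm_of_nonneg (by positivity : 0 ≤ √u ^ j),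
          div_le_iff₀ (by positivity), Real.norm_of_nonneg (by positivity)]
        calc _ ≤ _ := this
          _ = C * (√u ^ 2) ^ 2 * √u ^ j := by ring
          _ = _ := by rw [Real.sq_sqrt hu0.le]
    refine hO.trans_isLittleO ?_
    simpa using (Asymptotics.isLittleO_pow_id (𝕜 := ℝ) (n := 2) (by norm_num))
  · have hs : 0 < √t := Real.sqrt_pos.2 ht
    have hd : HasDerivAt (iteratedDeriv k f) (iteratedDeriv (k + 1) f (√t)) (√t) := by
      rw [iteratedDeriv_succ]
      exact (hf.differentiable_iteratedDeriv k
        (by exact_mod_cast WithTop.coe_lt_top _) _).hasDerivAt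
    have h1 := Real.hasDerivAt_sqrt ht.ne'
    have h2 := (hd.comp t h1).div (h1.pow j) (by simp only [Pi.pow_apply]; positivity)
    refine h2.congr_deriv ?_
    simp only [sqrtQuot, Function.comp, Pi.pow_apply]
    rcases j with _ | j
    · simp; field_simp
    · simp only [Nat.add_sub_cancel]; push_cast; field_simp
      ring

lemma contDiff_sqrtQuot {f : ℝ → ℝ} (hf : ContDiff ℝ ((⊤ : ℕ∞) : WithTop ℕ∞) f)
    (h0 : ∀ t ≤ 0, f t = 0) (n : ℕ) : ∀ j k : ℕ, ContDiff ℝ n (sqrtQuot f j k) := by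
  induction n with
  | zero =>
    intro j k
    exact contDiff_zero.2 (continuous_iff_continuousAt.2 fun t =>
      (hasDerivAt_sqrtQuot hf h0 j k t).continuousAt)
  | succ n ih =>
    intro j k
    push_cast
    rw [contDiff_succ_iff_deriv]
    refine ⟨fun t => (hasDerivAt_sqrtQuot hf h0 j k t).differentiableAt, by simp, ?_⟩
    rw [funext fun t => (hasDerivAt_sqrtQuot hf h0 j k t).deriv]
    exact (contDiff_const.mul (ih _ _)).sub (contDiff_const.mul (ih _ _))

lemma contDiff_comp_sqrt {f : ℝ → ℝ} (hf : ContDiff ℝ ((⊤ : ℕ∞) : WithTop ℕ∞) f)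
    (h0 : ∀ t ≤ 0, f t = 0) (n : ℕ) : ContDiff ℝ n fun t => f (√t) := by
  have h : (fun t => f (√t)) = sqrtQuot f 0 0 := by ext t; simp [sqrtQuot]
  rw [h]
  exact contDiff_sqrtQuot hf h0 n 0 0

/-! ### The smoothed step -/

section Kernel

variable {K : ℝ → ℝ}

/-- The endpoints `±1` are included: the set where a continuous `K` is nonzero is open, hence
contained in the interior of `[-1, 1]`. -/
lemma IsSmoothKernel.eq_zero (hK : IsSmoothKernel K) {t : ℝ} (ht : 1 ≤ |t|) : K t = 0 := by
  by_contra h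
  have h1 : Function.support K ⊆ interior (Icc (-1) 1) :=
    interior_maximal ((subset_tsupport K).trans hK.support_subset)
      (hK.smooth.continuous.isOpen_support)
  have h2 := h1 (Function.mem_support.2 h)
  rw [interior_Icc] at h2
  exact absurd (abs_lt.2 ⟨h2.1, h2.2⟩) (not_lt.2 ht)

lemma IsSmoothKernel.integrable (hK : IsSmoothKernel K) : Integrable K :=
  hK.smooth.continuous.integrable_of_hasCompactSupport
    (HasCompactSupport.of_support_subset_isCompact isCompact_Icc
      ((subset_tsupport K).trans hK.support_subset))

/-- The profile `σ ↦ ∫_{-1}^{σ-1} K` of the smoothed step. -/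
def stepProfile (K : ℝ → ℝ) (σ : ℝ) : ℝ := ∫ t in (-1)..(σ - 1), K t

lemma stepProfile_eq (hK : IsSmoothKernel K) (σ : ℝ) :
    stepProfile K σ = ∫ t in Iic (σ - 1), K t := by
  have h := intervalIntegral.integral_Iic_sub_Iic (f := K) (a := -1) (b := σ - 1) (μ := volume)
    hK.integrable.integrableOn hK.integrable.integrableOn
  have h1 : ∫ t in Iic (-1 : ℝ), K t = 0 := by
    refine setIntegral_eq_zero_of_forall_eq_zero fun t ht => hK.eq_zero ?_
    rw [le_abs]; right; simp only [mem_Iic] at ht; linarith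
  rw [stepProfile, ← h, h1, sub_zero]

lemma stepProfile_mono (hK : IsSmoothKernel K) : Monotone (stepProfile K) := by
  intro a b hab
  rw [stepProfile_eq hK, stepProfile_eq hK]
  exact setIntegral_mono_set hK.integrable.integrableOn
    (ae_of_all _ fun t => hK.nonneg t) (Iic_subset_Iic.2 (by linarith)).eventuallyLE

lemma stepProfile_of_nonpos (hK : IsSmoothKernel K) {σ : ℝ} (hσ : σ ≤ 0) :
    stepProfile K σ = 0 := by
  rw [stepProfile_eq hK]
  refine setIntegral_eq_zero_of_forall_eq_zero fun t ht => hK.eq_zero ?_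
  rw [le_abs]; right; simp only [mem_Iic] at ht; linarith

lemma stepProfile_nonneg (hK : IsSmoothKernel K) (σ : ℝ) : 0 ≤ stepProfile K σ := by
  rw [stepProfile_eq hK]
  exact setIntegral_nonneg measurableSet_Iic fun t _ => hK.nonneg t

lemma stepProfile_le_one (hK : IsSmoothKernel K) (σ : ℝ) : stepProfile K σ ≤ 1 := by
  rw [stepProfile_eq hK, ← hK.integral_eq_one]
  exact setIntegral_le_integral hK.integrable (ae_of_all _ hK.nonneg)

lemma stepProfile_of_two_le (hK : IsSmoothKernel K) {σ : ℝ} (hσ : 2 ≤ σ) :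
    stepProfile K σ = 1 := by
  rw [stepProfile_eq hK]
  refine Eq.trans ?_ hK.integral_eq_one
  refine setIntegral_eq_integral_of_forall_compl_eq_zero fun t ht => hK.eq_zero ?_
  rw [le_abs]; left; simp only [mem_Iic, not_le] at ht; linarith

lemma contDiff_stepProfile (hK : IsSmoothKernel K) :
    ContDiff ℝ ((⊤ : ℕ∞) : WithTop ℕ∞) (stepProfile K) := by
  have hd : ∀ σ, HasDerivAt (stepProfile K) (K (σ - 1)) σ := fun σ => by
    have h := intervalIntegral.integral_hasDerivAt_right (f := K) (a := -1) (b := σ - 1)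
      hK.integrable.intervalIntegrable
      (hK.smooth.continuous.stronglyMeasurableAtFilter _ _) hK.smooth.continuous.continuousAt
    exact h.comp_sub_const σ 1
  rw [contDiff_infty_iff_deriv]
  refine ⟨fun σ => (hd σ).differentiableAt, ?_⟩
  rw [funext fun σ => (hd σ).deriv]
  exact hK.smooth.comp (contDiff_id.sub contDiff_const)

/-- Substitute `u = s - h t`. The kernel only sees `|t| < 1`, and for `s ≥ 0` the branch `u ≤ -h`
would need `t ≥ 1`. What survives is `t ≤ s/h - 1`, a primitive of `K` evaluated at `s/h`. -/
lemma smoothStep_eq (hK : IsSmoothKernel K) {h s : ℝ} (hh : 0 < h) (hs : 0 ≤ s) :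
    smoothStep K h s = stepProfile K (s / h) := by
  rw [stepProfile_eq hK, ← integral_indicator measurableSet_Iic, smoothStep]
  have h1 := integral_sub_left_eq_self
    (fun u => indicator {u : ℝ | h ≤ |u|} (fun u => scaledKernel K h (s - u)) u) volume s
  rw [← h1]
  have h2 := Measure.integral_comp_mul_left (fun t : ℝ =>
    indicator {u : ℝ | h ≤ |u|} (fun u => scaledKernel K h (s - u)) (s - t)) h
  have h3 : ∫ t : ℝ, indicator {u : ℝ | h ≤ |u|} (fun u => scaledKernel K h (s - u)) (s - t) =
      h * ∫ t : ℝ, indicator {u : ℝ | h ≤ |u|}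
        (fun u => scaledKernel K h (s - u)) (s - h * t) := by
    rw [h2, abs_of_pos (inv_pos.2 hh), smul_eq_mul]
    field_simp
  rw [h3, ← integral_const_mul]
  congr 1
  ext t
  by_cases hK0 : K t = 0
  · simp only [indicator, scaledKernel, mem_ofPred_eq, sub_sub_cancel, mem_Iic, hK0,
      mul_div_cancel_left₀ _ hh.ne', mul_zero, ite_self]
  have ht : |t| < 1 := by
    by_contra h; exact hK0 (hK.eq_zero (not_lt.1 h))
  rw [abs_lt] at ht
  have hiff : h ≤ |s - h * t| ↔ t ≤ s / h - 1 := by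
    rw [le_abs, le_sub_iff_add_le (c := s / h), le_div_iff₀ hh]
    constructor
    · rintro (h' | h') <;> nlinarith
    · intro h'; left; linarith
  simp only [indicator, scaledKernel, mem_ofPred_eq, sub_sub_cancel, mem_Iic, hiff,
    mul_div_cancel_left₀ _ hh.ne']
  split_ifs
  · field_simp
  · simp

lemma stepProfile_pos_of_pos (hK : IsSmoothKernel K) {t₀ σ : ℝ} (ht : K t₀ ≠ 0)
    (hσ : t₀ + 1 < σ) : 0 < stepProfile K σ := by
  rw [stepProfile_eq hK, setIntegral_pos_iff_support_of_nonneg_ae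
    (ae_of_all _ hK.nonneg) hK.integrable.integrableOn]
  refine IsOpen.measure_pos volume (U := Function.support K ∩ Iio (σ - 1))
    (hK.smooth.continuous.isOpen_support.inter isOpen_Iio) ⟨t₀, ht, ?_⟩ |>.trans_le
    (measure_mono (inter_subset_inter_right _ Iio_subset_Iic_self))
  simp only [mem_Iio]; linarith

/-- The smoothed step is positive at some point below `L / √2` if the support of the kernel is
exactly `[-1, 1]`, or if `L ≥ 2 √2`. -/
lemma exists_stepProfile_pos (hK : IsSmoothKernel K) {L : ℝ} (hL : 0 < L)
    (h : tsupport K = Icc (-1) 1 ∨ 2 * √2 ≤ L) :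
    ∃ σ, 0 < σ ∧ σ < L / √2 ∧ 0 < stepProfile K σ := by
  have h2 : 0 < √(2 : ℝ) := by positivity
  -- The step becomes positive just above `t₀ + 1` for any `t₀` with `K t₀ ≠ 0`. Full support
  -- provides such `t₀` arbitrarily close to `-1`; if `L / √2 ≥ 2`, every `t₀` qualifies because `t₀
  -- < 1`.
  obtain ⟨t₀, ht₀, hlt⟩ : ∃ t₀, K t₀ ≠ 0 ∧ t₀ + 1 < L / √2 := by
    rcases h with h | h
    · have hmem : (-1 : ℝ) ∈ closure (Function.support K) := by
        change _ ∈ tsupport K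
        rw [h]; simp
      obtain ⟨t, ht, hK⟩ := mem_closure_iff_nhds.1 hmem (Iio (L / √2 - 1))
        (Iio_mem_nhds (by have : 0 < L / √2 := by positivity
                          linarith))
      exact ⟨t, hK, by simp only [mem_Iio] at ht; linarith⟩
    · obtain ⟨t, ht⟩ : ∃ t, K t ≠ 0 := by
        by_contra! hc
        have := hK.integral_eq_one
        simp [hc] at this
      refine ⟨t, ht, ?_⟩
      have h1 : |t| < 1 := by
        by_contra h; exact ht (hK.eq_zero (not_lt.1 h))
      have h3 : 2 ≤ L / √2 := by rwa [le_div_iff₀ h2]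
      linarith [(abs_lt.1 h1).2]
  have h1 : 0 < t₀ + 1 := by
    have h1 : |t₀| < 1 := by
      by_contra h; exact ht₀ (hK.eq_zero (not_lt.1 h))
    linarith [(abs_lt.1 h1).1]
  exact ⟨(t₀ + 1 + L / √2) / 2, by linarith, by linarith,
    stepProfile_pos_of_pos hK ht₀ (by linarith)⟩

end Kernel


/-! ### Functions with bounded and Lipschitz second derivative -/

section SecondDerivative

variable {E F : Type*} [NormedAddCommGroup E] [InnerProductSpace ℝ E]
  [NormedAddCommGroup F] [InnerProductSpace ℝ F]

/-- `f` is `C²`, and on the centred ball of radius `R` it is bounded by `B` together with its first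
two derivatives, the second one being Lipschitz with constant `B`. -/
structure BoundedC21 (f : E → ℝ) (R B : ℝ) : Prop where
  contDiff : ContDiff ℝ 2 f
  bound : ∀ x, ‖x‖ ≤ R → |f x| ≤ B
  bound_fderiv : ∀ x, ‖x‖ ≤ R → ‖fderiv ℝ f x‖ ≤ B
  bound_fderiv₂ : ∀ x, ‖x‖ ≤ R → ‖fderiv ℝ (fderiv ℝ f) x‖ ≤ B
  lipschitz : ∀ x y, ‖x‖ ≤ R → ‖y‖ ≤ R →
    ‖fderiv ℝ (fderiv ℝ f) x - fderiv ℝ (fderiv ℝ f) y‖ ≤ B * ‖x - y‖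

lemma contDiff_fderiv {f : E → ℝ} (hf : ContDiff ℝ 2 f) : ContDiff ℝ 1 (fderiv ℝ f) :=
  hf.fderiv_right (by norm_num [one_add_one_eq_two])

lemma norm_sub_le_of_fderiv_le {G : Type*} [NormedAddCommGroup G] [NormedSpace ℝ G] {f : E → G}
    (hf : Differentiable ℝ f) {R B : ℝ} (hB : ∀ x, ‖x‖ ≤ R → ‖fderiv ℝ f x‖ ≤ B) {x y : E}
    (hx : ‖x‖ ≤ R) (hy : ‖y‖ ≤ R) : ‖f x - f y‖ ≤ B * ‖x - y‖ :=
  (convex_closedBall (0 : E) R).norm_image_sub_le_of_norm_fderiv_le (fun z _ => hf z)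
    (fun z hz => hB z (by simpa using hz)) (by simpa using hy) (by simpa using hx)

lemma norm_add_le_bilin (a b : E →L[ℝ] E →L[ℝ] ℝ) : ‖a + b‖ ≤ ‖a‖ + ‖b‖ := norm_add_le a b

lemma norm_add₄_le_bilin (a b c d : E →L[ℝ] E →L[ℝ] ℝ) :
    ‖(a + b) + (c + d)‖ ≤ ‖a‖ + ‖b‖ + (‖c‖ + ‖d‖) :=
  (norm_add_le_bilin _ _).trans (add_le_add (norm_add_le_bilin _ _) (norm_add_le_bilin _ _))

lemma norm_bilin_nonneg (a : E →L[ℝ] E →L[ℝ] ℝ) : 0 ≤ ‖a‖ := norm_nonneg a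

lemma norm_smul_bilin (c : ℝ) (a : E →L[ℝ] E →L[ℝ] ℝ) : ‖c • a‖ = |c| * ‖a‖ := norm_smul c a

lemma norm_smul_sub_smul_le {G : Type*} [NormedAddCommGroup G] [NormedSpace ℝ G] (a b : ℝ)
    (u v : G) : ‖a • u - b • v‖ ≤ |a - b| * ‖u‖ + |b| * ‖u - v‖ := by
  have h : a • u - b • v = (a - b) • u + b • (u - v) := by module
  rw [h]
  refine (norm_add_le _ _).trans_eq ?_
  rw [norm_smul, norm_smul, Real.norm_eq_abs, Real.norm_eq_abs]

lemma norm_smulRight_sub_smulRight_le (a b u v : E →L[ℝ] ℝ) :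
    ‖a.smulRight u - b.smulRight v‖ ≤ ‖a - b‖ * ‖u‖ + ‖b‖ * ‖u - v‖ := by
  have h : a.smulRight u - b.smulRight v = (a - b).smulRight u + b.smulRight (u - v) := by
    ext z w; simp; ring
  rw [h]
  refine (norm_add_le_bilin _ _).trans_eq ?_
  rw [ContinuousLinearMap.norm_smulRight_apply, ContinuousLinearMap.norm_smulRight_apply]

lemma fderiv_fderiv_mul {f g : E → ℝ} (hf : ContDiff ℝ 2 f) (hg : ContDiff ℝ 2 g) (x : E) :
    fderiv ℝ (fderiv ℝ fun y => f y * g y) x =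
      (f x • fderiv ℝ (fderiv ℝ g) x + (fderiv ℝ f x).smulRight (fderiv ℝ g x)) +
      (g x • fderiv ℝ (fderiv ℝ f) x + (fderiv ℝ g x).smulRight (fderiv ℝ f x)) := by
  have hf1 : Differentiable ℝ f := hf.differentiable (by norm_num)
  have hg1 : Differentiable ℝ g := hg.differentiable (by norm_num)
  have hf2 : Differentiable ℝ (fderiv ℝ f) := (contDiff_fderiv hf).differentiable (by norm_num)
  have hg2 : Differentiable ℝ (fderiv ℝ g) := (contDiff_fderiv hg).differentiable (by norm_num)
  have h : (fderiv ℝ fun y => f y * g y) = fun y => f y • fderiv ℝ g y + g y • fderiv ℝ f y := by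
    ext1 y
    exact fderiv_fun_mul (hf1 y) (hg1 y)
  rw [h]
  exact ((((hf1 x).hasFDerivAt).smul ((hg2 x).hasFDerivAt)).add
    (((hg1 x).hasFDerivAt).smul ((hf2 x).hasFDerivAt))).fderiv

/-- Leibniz rule. The factor `8` comes from the Lipschitz estimate: the second derivative of a
product has four terms, and the increment of each splits into two pieces of size `B * C * ‖x - y‖`.
-/
lemma BoundedC21.mul {f g : E → ℝ} {R B C : ℝ} (hB : 0 ≤ B) (hC : 0 ≤ C)
    (hf : BoundedC21 f R B) (hg : BoundedC21 g R C) :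
    BoundedC21 (fun x => f x * g x) R (8 * (B * C)) := by
  have hBC : 0 ≤ B * C := by positivity
  have hf1 : Differentiable ℝ f := hf.contDiff.differentiable (by norm_num)
  have hg1 : Differentiable ℝ g := hg.contDiff.differentiable (by norm_num)
  have hf2 : Differentiable ℝ (fderiv ℝ f) :=
    (contDiff_fderiv hf.contDiff).differentiable (by norm_num)
  have hg2 : Differentiable ℝ (fderiv ℝ g) :=
    (contDiff_fderiv hg.contDiff).differentiable (by norm_num)
  refine ⟨hf.contDiff.mul hg.contDiff, fun x hx => ?_, fun x hx => ?_, fun x hx => ?_,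
    fun x y hx hy => ?_⟩
  · rw [abs_mul]
    have := mul_le_mul (hf.bound x hx) (hg.bound x hx) (abs_nonneg _) hB
    linarith
  · rw [fderiv_fun_mul (hf1 x) (hg1 x)]
    refine (norm_add_le _ _).trans ?_
    rw [norm_smul, norm_smul]
    have h1 := mul_le_mul (hf.bound x hx) (hg.bound_fderiv x hx) (norm_nonneg _) hB
    have h2 := mul_le_mul (hg.bound x hx) (hf.bound_fderiv x hx) (norm_nonneg _) hC
    simp only [Real.norm_eq_abs]
    linarith
  · rw [fderiv_fderiv_mul hf.contDiff hg.contDiff]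
    refine (norm_add₄_le_bilin _ _ _ _).trans ?_
    rw [norm_smul_bilin, norm_smul_bilin, ContinuousLinearMap.norm_smulRight_apply,
      ContinuousLinearMap.norm_smulRight_apply]
    have h1 := mul_le_mul (hf.bound x hx) (hg.bound_fderiv₂ x hx) (norm_bilin_nonneg _) hB
    have h2 := mul_le_mul (hg.bound x hx) (hf.bound_fderiv₂ x hx) (norm_bilin_nonneg _) hC
    have h3 := mul_le_mul (hf.bound_fderiv x hx) (hg.bound_fderiv x hx) (norm_nonneg _) hB
    linarith
  · rw [fderiv_fderiv_mul hf.contDiff hg.contDiff, fderiv_fderiv_mul hf.contDiff hg.contDiff,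
      add_sub_add_comm, add_sub_add_comm (f x • _), add_sub_add_comm (g x • _)]
    refine (norm_add₄_le_bilin _ _ _ _).trans ?_
    have lf := norm_sub_le_of_fderiv_le hf1 hf.bound_fderiv hx hy
    have lg := norm_sub_le_of_fderiv_le hg1 hg.bound_fderiv hx hy
    have lf' := norm_sub_le_of_fderiv_le hf2 hf.bound_fderiv₂ hx hy
    have lg' := norm_sub_le_of_fderiv_le hg2 hg.bound_fderiv₂ hx hy
    rw [Real.norm_eq_abs] at lf lg
    have nB : 0 ≤ B * ‖x - y‖ := by positivity
    have nC : 0 ≤ C * ‖x - y‖ := by positivity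
    have h1 := (norm_smul_sub_smul_le (f x) (f y) (fderiv ℝ (fderiv ℝ g) x)
      (fderiv ℝ (fderiv ℝ g) y)).trans (add_le_add
        (mul_le_mul lf (hg.bound_fderiv₂ x hx) (norm_bilin_nonneg _) nB)
        (mul_le_mul (hf.bound y hy) (hg.lipschitz x y hx hy) (norm_bilin_nonneg _) hB))
    have h2 := (norm_smul_sub_smul_le (g x) (g y) (fderiv ℝ (fderiv ℝ f) x)
      (fderiv ℝ (fderiv ℝ f) y)).trans (add_le_add
        (mul_le_mul lg (hf.bound_fderiv₂ x hx) (norm_bilin_nonneg _) nC)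
        (mul_le_mul (hg.bound y hy) (hf.lipschitz x y hx hy) (norm_bilin_nonneg _) hC))
    have h3 := (norm_smulRight_sub_smulRight_le (fderiv ℝ f x) (fderiv ℝ f y) (fderiv ℝ g x)
      (fderiv ℝ g y)).trans (add_le_add
        (mul_le_mul lf' (hg.bound_fderiv x hx) (norm_nonneg _) nB)
        (mul_le_mul (hf.bound_fderiv y hy) lg' (norm_nonneg _) hB))
    have h4 := (norm_smulRight_sub_smulRight_le (fderiv ℝ g x) (fderiv ℝ g y) (fderiv ℝ f x)
      (fderiv ℝ f y)).trans (add_le_add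
        (mul_le_mul lg' (hf.bound_fderiv x hx) (norm_nonneg _) nC)
        (mul_le_mul (hg.bound_fderiv y hy) lf' (norm_nonneg _) hC))
    linarith

/-! #### The cube of the norm -/

/-- The inner product as a linear map into the linear forms. -/
def innerBilin (E : Type*) [NormedAddCommGroup E] [InnerProductSpace ℝ E] :
    E →L[ℝ] E →L[ℝ] ℝ := innerSL ℝ

lemma innerBilin_apply (x y : E) : innerBilin E x y = inner ℝ x y := rfl

lemma norm_innerBilin_apply (x : E) : ‖innerBilin E x‖ = ‖x‖ := innerSL_apply_norm ℝ x

/-- Up to the factor `3` this differentiates the gradient of `‖y‖³`. At the origin the map is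
`O(‖y‖²)`, and the convention `0⁻¹ = 0` makes the displayed derivative vanish there, so no
exceptional case is needed. -/
lemma hasFDerivAt_norm_smul_inner (x : E) :
    HasFDerivAt (fun y : E => ‖y‖ • innerBilin E y)
      (‖x‖ • innerBilin E + (‖x‖⁻¹ • innerBilin E x).smulRight (innerBilin E x)) x := by
  rcases eq_or_ne x 0 with rfl | hx
  · simp only [norm_zero, zero_smul, map_zero, inv_zero]
    rw [hasFDerivAt_iff_isLittleO_nhds_zero]
    simp only [zero_add, norm_zero, zero_smul, map_zero, sub_zero]
    have hO : (fun y : E => ‖y‖ • innerBilin E y -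
        ((0 : E →L[ℝ] ℝ).smulRight (0 : E →L[ℝ] ℝ) : E →L[ℝ] E →L[ℝ] ℝ) y) =O[𝓝 0] fun y : E => ‖y‖ ^ 2 := by
      refine Asymptotics.IsBigO.of_bound 1 (Eventually.of_forall fun y => ?_)
      simp [norm_smul, pow_two, norm_innerBilin_apply]
    exact hO.trans_isLittleO (Asymptotics.isLittleO_norm_pow_id one_lt_two)
  · have h1 : HasFDerivAt (fun y : E => ‖y‖) (‖x‖⁻¹ • innerBilin E x) x := by
      have h := ((hasStrictFDerivAt_norm_sq x).hasFDerivAt).sqrt (by positivity)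
      simp only [Real.sqrt_sq (norm_nonneg _)] at h
      refine h.congr_fderiv ?_
      ext z
      simp [innerBilin_apply]
      field_simp
    exact h1.smul (innerBilin E).hasFDerivAt

lemma hasFDerivAt_norm_pow_three (x : E) :
    HasFDerivAt (fun y : E => ‖y‖ ^ 3) ((3 : ℝ) • (‖x‖ • innerBilin E x)) x := by
  have h := hasFDerivAt_norm_rpow x (p := 3) (by norm_num)
  refine HasFDerivAt.congr_fderiv (f := fun y : E => ‖y‖ ^ (3 : ℝ)) h ?_ |>.congr_of_eventuallyEq
    (Eventually.of_forall fun y => by norm_cast)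
  rw [show (3 : ℝ) - 2 = 1 by norm_num, Real.rpow_one, smul_smul]
  rfl

/-- The direction `x / ‖x‖` is Lipschitz only away from `0`; the weight `‖y‖` absorbs the
singularity. This is what makes `x ⊗ x / ‖x‖`, and with it the Hessian of `‖x‖³`, globally
Lipschitz. -/
lemma norm_smul_inv_sub_le (x y : E) : ‖y‖ * ‖‖x‖⁻¹ • x - ‖y‖⁻¹ • y‖ ≤ 2 * ‖x - y‖ := by
  rcases eq_or_ne y 0 with rfl | hy
  · simp
  have hy' : 0 < ‖y‖ := norm_pos_iff.2 hy
  have h : ‖y‖ * ‖‖x‖⁻¹ • x - ‖y‖⁻¹ • y‖ = ‖(‖y‖ * ‖x‖⁻¹) • x - y‖ := by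
    have h' : (‖y‖ * ‖x‖⁻¹) • x - y = ‖y‖ • (‖x‖⁻¹ • x - ‖y‖⁻¹ • y) := by
      rw [smul_sub, smul_smul, smul_smul, mul_inv_cancel₀ hy'.ne', one_smul]
    rw [h', norm_smul, norm_norm]
  rw [h]
  rcases eq_or_ne x 0 with rfl | hx
  · simp; linarith
  have hx' : 0 < ‖x‖ := norm_pos_iff.2 hx
  have h2 : (‖y‖ * ‖x‖⁻¹) • x - y = (‖y‖ * ‖x‖⁻¹ - 1) • x + (x - y) := by module
  rw [h2]
  refine (norm_add_le _ _).trans ?_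
  have h3 : ‖(‖y‖ * ‖x‖⁻¹ - 1) • x‖ = |‖y‖ - ‖x‖| := by
    rw [norm_smul, Real.norm_eq_abs]
    conv_lhs => rw [← abs_of_pos hx', ← abs_mul, abs_of_pos hx']
    congr 1
    field_simp
  have h4 : |‖y‖ - ‖x‖| ≤ ‖x - y‖ := by
    rw [norm_sub_rev]; exact abs_norm_sub_norm_le y x
  rw [h3]; linarith

lemma norm_inner_smulRight_sub_le (x y : E) :
    ‖(‖x‖⁻¹ • innerBilin E x).smulRight (innerBilin E x) -
      (‖y‖⁻¹ • innerBilin E y).smulRight (innerBilin E y)‖ ≤ 3 * ‖x - y‖ := by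
  have hn : ∀ z : E, ‖innerBilin E z‖ = ‖z‖ := fun z => norm_innerBilin_apply z
  rw [norm_sub_rev x y]
  rw [show ∀ a b : E →L[ℝ] E →L[ℝ] ℝ, ‖a - b‖ = ‖b - a‖ from fun a b => norm_sub_rev a b]
  refine (norm_smulRight_sub_smulRight_le _ _ _ _).trans ?_
  rw [← map_sub, hn, hn, ← map_smul, ← map_smul, ← map_sub, hn, hn]
  have h1 := norm_smul_inv_sub_le x y
  rw [mul_comm, norm_sub_rev, norm_sub_rev x y] at h1
  have h2 : ‖‖x‖⁻¹ • x‖ ≤ 1 := by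
    rw [norm_smul, norm_inv, norm_norm]
    exact inv_mul_le_one
  have h3 := mul_le_of_le_one_left (norm_nonneg (y - x)) h2
  linarith

lemma fderiv_norm_pow_three :
    (fderiv ℝ fun y : E => ‖y‖ ^ 3) = fun x => (3 : ℝ) • (‖x‖ • innerBilin E x) :=
  funext fun x => (hasFDerivAt_norm_pow_three x).fderiv

lemma fderiv_fderiv_norm_pow_three (x : E) :
    fderiv ℝ (fderiv ℝ fun y : E => ‖y‖ ^ 3) x =
      (3 : ℝ) • (‖x‖ • innerBilin E + (‖x‖⁻¹ • innerBilin E x).smulRight (innerBilin E x)) := by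
  rw [fderiv_norm_pow_three]
  exact ((hasFDerivAt_norm_smul_inner x).const_smul (3 : ℝ)).fderiv

lemma norm_innerBilin_le : ‖innerBilin E‖ ≤ 1 :=
  ContinuousLinearMap.opNorm_le_bound _ zero_le_one fun x => by
    rw [norm_innerBilin_apply, one_mul]

/-- The constant is `3 * (1 + 3)`: one from `‖x‖` times the inner product, three from the rank-one
part. -/
lemma norm_fderiv_fderiv_norm_pow_three_sub_le (x y : E) :
    ‖fderiv ℝ (fderiv ℝ fun y : E => ‖y‖ ^ 3) x - fderiv ℝ (fderiv ℝ fun y : E => ‖y‖ ^ 3) y‖ ≤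
      12 * ‖x - y‖ := by
  rw [fderiv_fderiv_norm_pow_three, fderiv_fderiv_norm_pow_three, ← smul_sub, norm_smul_bilin,
    add_sub_add_comm, ← sub_smul]
  have h1 : ‖(‖x‖ - ‖y‖) • innerBilin E‖ ≤ ‖x - y‖ := by
    rw [norm_smul_bilin]
    calc _ ≤ ‖x - y‖ * 1 := mul_le_mul (abs_norm_sub_norm_le x y) norm_innerBilin_le
            (norm_bilin_nonneg _) (norm_nonneg _)
      _ = _ := mul_one _
  have h2 := norm_inner_smulRight_sub_le x y
  have h3 := norm_add_le_bilin ((‖x‖ - ‖y‖) • innerBilin E)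
    ((‖x‖⁻¹ • innerBilin E x).smulRight (innerBilin E x) -
      (‖y‖⁻¹ • innerBilin E y).smulRight (innerBilin E y))
  norm_num
  linarith

lemma boundedC21_norm_pow_three {R : ℝ} (hR : 0 ≤ R) :
    BoundedC21 (fun x : E => ‖x‖ ^ 3) R (R ^ 3 + 3 * R ^ 2 + 12 * R + 12) := by
  have h0 : fderiv ℝ (fderiv ℝ fun y : E => ‖y‖ ^ 3) 0 = 0 := by
    rw [fderiv_fderiv_norm_pow_three]; ext; simp
  refine ⟨?_, fun x hx => ?_, fun x hx => ?_, fun x hx => ?_, fun x y hx hy => ?_⟩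
  · rw [show (2 : WithTop ℕ∞) = 1 + 1 by norm_num, contDiff_succ_iff_fderiv]
    refine ⟨fun x => (hasFDerivAt_norm_pow_three x).differentiableAt, by simp, ?_⟩
    rw [contDiff_one_iff_fderiv]
    refine ⟨?_, ?_⟩
    · rw [fderiv_norm_pow_three]
      exact fun x => ((hasFDerivAt_norm_smul_inner x).const_smul (3 : ℝ)).differentiableAt
    · exact (LipschitzWith.of_dist_le_mul (K := 12) fun x y => by
        rw [dist_eq_norm, dist_eq_norm]
        exact norm_fderiv_fderiv_norm_pow_three_sub_le x y).continuous
  · rw [abs_of_nonneg (by positivity)]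
    have : ‖x‖ ^ 3 ≤ R ^ 3 := by gcongr
    nlinarith [sq_nonneg R]
  · rw [fderiv_norm_pow_three, norm_smul, norm_smul, norm_innerBilin_apply]
    have : ‖x‖ * ‖x‖ ≤ R * R := by gcongr
    have : 0 ≤ R ^ 3 := by positivity
    norm_num
    nlinarith
  · have h := norm_fderiv_fderiv_norm_pow_three_sub_le x 0
    rw [h0, sub_zero, sub_zero] at h
    have : 0 ≤ R ^ 3 := by positivity
    nlinarith [sq_nonneg R]
  · refine (norm_fderiv_fderiv_norm_pow_three_sub_le x y).trans ?_
    gcongr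
    have : 0 ≤ R ^ 3 := by positivity
    nlinarith [sq_nonneg R]

/-! #### Functions of the squared norm of a projection -/

lemma boundedC21_norm_sq_comp {R : ℝ} (hR : 0 ≤ R) (T : E →L[ℝ] F) (hT : ‖T‖ ≤ 1) :
    BoundedC21 (fun x : E => ‖T x‖ ^ 2) R (R ^ 2 + 2 * R + 2) := by
  set β : E →L[ℝ] E →L[ℝ] ℝ := (2 : ℝ) • (innerBilin F).bilinearComp T T with hβ
  have hTx : ∀ x, ‖T x‖ ≤ ‖x‖ := fun x => by
    simpa using T.le_of_opNorm_le hT x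
  have hβn : ∀ x, ‖β x‖ ≤ 2 * ‖x‖ := fun x => by
    refine ContinuousLinearMap.opNorm_le_bound _ (by positivity) fun y => ?_
    simp only [hβ, smul_apply, ContinuousLinearMap.bilinearComp_apply,
      innerBilin_apply, norm_smul]
    calc _ ≤ ‖(2 : ℝ)‖ * (‖T x‖ * ‖T y‖) := by gcongr; exact norm_inner_le_norm _ _
      _ ≤ 2 * (‖x‖ * ‖y‖) := by
        rw [Real.norm_of_nonneg (by norm_num)]; gcongr <;> exact hTx _
      _ = _ := by ring
  have hβ1 : ‖β‖ ≤ 2 := ContinuousLinearMap.opNorm_le_bound _ (by norm_num) hβn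
  have hd : ∀ x, HasFDerivAt (fun x : E => ‖T x‖ ^ 2) (β x) x := fun x => by
    have h := T.hasFDerivAt (x := x).norm_sq
    refine h.congr_fderiv ?_
    ext z; simp [hβ, innerBilin_apply]
  have hf : (fderiv ℝ fun x : E => ‖T x‖ ^ 2) = fun x => β x := funext fun x => (hd x).fderiv
  have hf2 : ∀ x, fderiv ℝ (fderiv ℝ fun x : E => ‖T x‖ ^ 2) x = β := fun x => by
    rw [hf]; exact β.fderiv
  refine ⟨T.contDiff.norm_sq ℝ, fun x hx => ?_, fun x hx => ?_, fun x hx => ?_,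
    fun x y hx hy => ?_⟩
  · rw [abs_of_nonneg (by positivity)]
    have : ‖T x‖ ^ 2 ≤ R ^ 2 := by gcongr; exact (hTx x).trans hx
    linarith
  · rw [hf]
    have := hβn x
    nlinarith [sq_nonneg R]
  · rw [hf2]; nlinarith [sq_nonneg R]
  · rw [hf2, hf2]
    rw [sub_self, ContinuousLinearMap.opNorm_zero]
    positivity

/-- Chain rule for the second derivative, `g'(q) D²q + g''(q) Dq ⊗ Dq`. Bounds on `g` are needed
only on `[-B, B]`, where `q` takes its values; the polynomial in `B` is a common majorant of the
four estimates. -/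
lemma BoundedC21.comp {q : E → ℝ} {g : ℝ → ℝ} {R B M : ℝ} (hB : 0 ≤ B) (hM : 0 ≤ M)
    (hq : BoundedC21 q R B) (hg : ContDiff ℝ 2 g)
    (h0 : ∀ t, |t| ≤ B → |g t| ≤ M) (h1 : ∀ t, |t| ≤ B → |deriv g t| ≤ M)
    (h2 : ∀ t, |t| ≤ B → |deriv (deriv g) t| ≤ M)
    (h3 : ∀ s t, |s| ≤ B → |t| ≤ B → |deriv (deriv g) s - deriv (deriv g) t| ≤ M * |s - t|) :
    BoundedC21 (fun x => g (q x)) R (M * (1 + 3 * B + 5 * B ^ 2 + B ^ 3)) := by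
  have hg1 : Differentiable ℝ g := hg.differentiable (by norm_num)
  have hg2 : Differentiable ℝ (deriv g) := by
    rw [show (2 : WithTop ℕ∞) = 1 + 1 by norm_num, contDiff_succ_iff_deriv] at hg
    exact hg.2.2.differentiable (by norm_num)
  have hq1 : Differentiable ℝ q := hq.contDiff.differentiable (by norm_num)
  have hq2 : Differentiable ℝ (fderiv ℝ q) :=
    (contDiff_fderiv hq.contDiff).differentiable (by norm_num)
  have hf : (fderiv ℝ fun x => g (q x)) = fun x => deriv g (q x) • fderiv ℝ q x :=
    funext fun x => ((hg1 (q x)).hasDerivAt.comp_hasFDerivAt x (hq1 x).hasFDerivAt).fderiv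
  have hf2 : ∀ x, fderiv ℝ (fderiv ℝ fun x => g (q x)) x =
      deriv g (q x) • fderiv ℝ (fderiv ℝ q) x +
        (deriv (deriv g) (q x) • fderiv ℝ q x).smulRight (fderiv ℝ q x) := fun x => by
    rw [hf]
    exact (((hg2 (q x)).hasDerivAt.comp_hasFDerivAt x (hq1 x).hasFDerivAt).smul
      (hq2 x).hasFDerivAt).fderiv
  have hp : 0 ≤ M * B := by positivity
  have hp2 : 0 ≤ M * B ^ 2 := by positivity
  have hp3 : 0 ≤ M * B ^ 3 := by positivity
  refine ⟨hg.comp hq.contDiff, fun x hx => ?_, fun x hx => ?_, fun x hx => ?_,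
    fun x y hx hy => ?_⟩
  · have := h0 _ (hq.bound x hx)
    linarith
  · rw [hf, norm_smul]
    have := mul_le_mul (h1 _ (hq.bound x hx)) (hq.bound_fderiv x hx) (norm_nonneg _) hM
    rw [Real.norm_eq_abs]
    linarith
  · rw [hf2]
    refine (norm_add_le_bilin _ _).trans ?_
    rw [norm_smul_bilin, ContinuousLinearMap.norm_smulRight_apply, norm_smul]
    have e1 := mul_le_mul (h1 _ (hq.bound x hx)) (hq.bound_fderiv₂ x hx) (norm_bilin_nonneg _) hM
    have e2 := mul_le_mul (mul_le_mul (h2 _ (hq.bound x hx)) (hq.bound_fderiv x hx)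
      (norm_nonneg _) hM) (hq.bound_fderiv x hx) (norm_nonneg _) hp
    simp only [Real.norm_eq_abs]
    linarith
  · rw [hf2, hf2, add_sub_add_comm]
    refine (norm_add_le_bilin _ _).trans ?_
    have lq := norm_sub_le_of_fderiv_le hq1 hq.bound_fderiv hx hy
    have lq' := norm_sub_le_of_fderiv_le hq2 hq.bound_fderiv₂ hx hy
    rw [Real.norm_eq_abs] at lq
    have lg' : |deriv g (q x) - deriv g (q y)| ≤ M * |q x - q y| := by
      have := (convex_Icc (-B) B).norm_image_sub_le_of_norm_deriv_le (f := deriv g)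
        (C := M) (x := q y) (y := q x) (fun t _ => hg2 t) (fun t ht => h2 t (abs_le.2 ht))
        (abs_le.1 (hq.bound y hy)) (abs_le.1 (hq.bound x hx))
      simpa using this
    have lg'' := h3 _ _ (hq.bound x hx) (hq.bound y hy)
    have n0 : 0 ≤ M * (B * ‖x - y‖) := by positivity
    have lgx' := lg'.trans (mul_le_mul_of_nonneg_left lq hM)
    have lgx'' := lg''.trans (mul_le_mul_of_nonneg_left lq hM)
    have e1 := (norm_smul_sub_smul_le (deriv g (q x)) (deriv g (q y)) (fderiv ℝ (fderiv ℝ q) x)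
      (fderiv ℝ (fderiv ℝ q) y)).trans (add_le_add
        (mul_le_mul lgx' (hq.bound_fderiv₂ x hx) (norm_bilin_nonneg _) n0)
        (mul_le_mul (h1 _ (hq.bound y hy)) (hq.lipschitz x y hx hy) (norm_bilin_nonneg _) hM))
    have e2 := (norm_smul_sub_smul_le (deriv (deriv g) (q x)) (deriv (deriv g) (q y))
      (fderiv ℝ q x) (fderiv ℝ q y)).trans (add_le_add
        (mul_le_mul lgx'' (hq.bound_fderiv x hx) (norm_nonneg _) n0)
        (mul_le_mul (h2 _ (hq.bound y hy)) lq' (norm_nonneg _) hM))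
    have n1 : ‖deriv (deriv g) (q y) • fderiv ℝ q y‖ ≤ M * B := by
      rw [norm_smul]
      exact mul_le_mul (h2 _ (hq.bound y hy)) (hq.bound_fderiv y hy) (norm_nonneg _) hM
    have e3 := (norm_smulRight_sub_smulRight_le (deriv (deriv g) (q x) • fderiv ℝ q x)
      (deriv (deriv g) (q y) • fderiv ℝ q y) (fderiv ℝ q x) (fderiv ℝ q y)).trans (add_le_add
        (mul_le_mul e2 (hq.bound_fderiv x hx) (norm_nonneg _) (by positivity))
        (mul_le_mul n1 lq' (norm_nonneg _) hp))
    have n3 : 0 ≤ M * ‖x - y‖ := by positivity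
    have n4 : 0 ≤ M * B * ‖x - y‖ := by positivity
    have n5 : 0 ≤ M * B ^ 2 * ‖x - y‖ := by positivity
    nlinarith

end SecondDerivative


/-! ### Projections -/

section Projections

variable {p q : ℕ}

/-- The target projection as a continuous linear map. -/
def targetL (p q : ℕ) : Par p q →L[ℝ] EuclideanSpace ℝ (Fin p) :=
  LinearMap.toContinuousLinearMap
    { toFun := target
      map_add' := fun _ _ => by ext; simp [target]
      map_smul' := fun _ _ => by ext; simp [target] }

/-- The nuisance projection as a continuous linear map. -/
def nuisanceL (p q : ℕ) : Par p q →L[ℝ] EuclideanSpace ℝ (Fin q) :=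
  LinearMap.toContinuousLinearMap
    { toFun := nuisance
      map_add' := fun _ _ => by ext; simp [nuisance]
      map_smul' := fun _ _ => by ext; simp [nuisance] }

lemma targetL_apply (υ : Par p q) : targetL p q υ = target υ := rfl

lemma nuisanceL_apply (υ : Par p q) : nuisanceL p q υ = nuisance υ := rfl

lemma target_smul (c : ℝ) (υ : Par p q) : target (c • υ) = c • target υ := map_smul (targetL p q) c υ

lemma target_sub (υ w : Par p q) : target (υ - w) = target υ - target w := map_sub (targetL p q) υ w

lemma target_zero : target (0 : Par p q) = 0 := map_zero (targetL p q)

lemma continuous_target : Continuous (target : Par p q → _) := (targetL p q).continuous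

lemma norm_sq_eq_target_add_nuisance (υ : Par p q) :
    ‖υ‖ ^ 2 = ‖target υ‖ ^ 2 + ‖nuisance υ‖ ^ 2 := by
  simp [EuclideanSpace.real_norm_sq_eq, target, nuisance]

lemma norm_target_le (υ : Par p q) : ‖target υ‖ ≤ ‖υ‖ :=
  le_of_sq_le_sq (by rw [norm_sq_eq_target_add_nuisance υ]; nlinarith [sq_nonneg ‖nuisance υ‖])
    (norm_nonneg _)

lemma norm_nuisance_le (υ : Par p q) : ‖nuisance υ‖ ≤ ‖υ‖ :=
  le_of_sq_le_sq (by rw [norm_sq_eq_target_add_nuisance υ]; nlinarith [sq_nonneg ‖target υ‖])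
    (norm_nonneg _)

lemma norm_targetL_le : ‖targetL p q‖ ≤ 1 :=
  ContinuousLinearMap.opNorm_le_bound _ zero_le_one fun υ => by
    rw [one_mul]; exact norm_target_le υ

/-- The parameter with the given target and nuisance components. -/
def pair (θ : EuclideanSpace ℝ (Fin p)) (η : EuclideanSpace ℝ (Fin q)) : Par p q :=
  WithLp.toLp 2 (Sum.elim θ η)

@[simp] lemma target_pair (θ : EuclideanSpace ℝ (Fin p)) (η : EuclideanSpace ℝ (Fin q)) :
    target (pair θ η) = θ := rfl

@[simp] lemma nuisance_pair (θ : EuclideanSpace ℝ (Fin p)) (η : EuclideanSpace ℝ (Fin q)) :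
    nuisance (pair θ η) = η := rfl

lemma inner_eq_target_add_nuisance (υ w : Par p q) :
    inner ℝ υ w = inner ℝ (target υ) (target w) + inner ℝ (nuisance υ) (nuisance w) := by
  simp [PiLp.inner_apply, target, nuisance]

end Projections

/-! ### Matrices of bilinear forms -/

section BilinMatrix

variable {p q : ℕ}

/-- The matrix of a bilinear form in the standard basis. -/
def bilinMatrix (β : Par p q →L[ℝ] Par p q →L[ℝ] ℝ) : Matrix (Fin p ⊕ Fin q) (Fin p ⊕ Fin q) ℝ :=
  Matrix.of fun i j => β (EuclideanSpace.single i 1) (EuclideanSpace.single j 1)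

lemma bilinMatrix_add (β γ : Par p q →L[ℝ] Par p q →L[ℝ] ℝ) :
    bilinMatrix (β + γ) = bilinMatrix β + bilinMatrix γ := by ext; simp [bilinMatrix]

lemma bilinMatrix_sub (β γ : Par p q →L[ℝ] Par p q →L[ℝ] ℝ) :
    bilinMatrix (β - γ) = bilinMatrix β - bilinMatrix γ := by ext; simp [bilinMatrix]

lemma bilinMatrix_smul (c : ℝ) (β : Par p q →L[ℝ] Par p q →L[ℝ] ℝ) :
    bilinMatrix (c • β) = c • bilinMatrix β := by ext; simp [bilinMatrix]

lemma bilinMatrix_innerBilin : bilinMatrix (innerBilin (Par p q)) = 1 := by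
  ext i j
  simp [bilinMatrix, innerBilin_apply, EuclideanSpace.inner_single_left, Matrix.one_apply]

lemma inner_toEuclideanLin_bilinMatrix (β : Par p q →L[ℝ] Par p q →L[ℝ] ℝ) (x y : Par p q) :
    inner ℝ y (Matrix.toEuclideanLin (bilinMatrix β) x) = β y x := by
  have hx := (EuclideanSpace.basisFun (Fin p ⊕ Fin q) ℝ).sum_repr x
  have hy := (EuclideanSpace.basisFun (Fin p ⊕ Fin q) ℝ).sum_repr y
  simp only [EuclideanSpace.basisFun_repr, EuclideanSpace.basisFun_apply] at hx hy
  conv_rhs => rw [← hx, ← hy]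
  simp only [map_sum, sum_apply, map_smul, smul_apply, smul_eq_mul,
    Matrix.toLpLin_apply, PiLp.inner_apply, Matrix.mulVec, dotProduct,
    bilinMatrix, Matrix.of_apply, RCLike.inner_apply, conj_trivial, Finset.sum_mul, Finset.mul_sum]
  rw [Finset.sum_comm]
  refine Finset.sum_congr rfl fun i _ => Finset.sum_congr rfl fun j _ => by ring

/-- Pair `y = M x` with itself: `‖y‖² = β(y, x)`. Passing to matrices thus loses no factor depending
on the dimension. -/
lemma norm_bilinMatrix_le (β : Par p q →L[ℝ] Par p q →L[ℝ] ℝ) : ‖bilinMatrix β‖ ≤ ‖β‖ := by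
  rw [Matrix.l2_opNorm_def]
  refine ContinuousLinearMap.opNorm_le_bound _ (norm_nonneg β) fun x => ?_
  set y := Matrix.toEuclideanLin (bilinMatrix β) x with hy
  change ‖y‖ ≤ _
  have h1 : ‖y‖ * ‖y‖ ≤ ‖β‖ * ‖x‖ * ‖y‖ := by
    rw [← real_inner_self_eq_norm_mul_norm]
    conv_lhs => rw [hy, ← hy]
    have h := inner_toEuclideanLin_bilinMatrix β x y
    rw [← hy] at h
    rw [h]
    calc β y x ≤ ‖β y x‖ := le_abs_self _
      _ ≤ ‖β‖ * ‖y‖ * ‖x‖ := β.le_opNorm₂ y x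
      _ = _ := by ring
  rcases (norm_nonneg y).eq_or_lt with h | h
  · rw [← h]; positivity
  · exact le_of_mul_le_mul_right h1 h

/-- The expected contrast may jump at the edge of the ball, but derivatives within a set with unique
derivatives see only the values there. They can be read off from any global `C²` function that
agrees with it on the set. -/
lemma hessian_eq_bilinMatrix {f g : Par p q → ℝ} {S : Set (Par p q)} (hg : ContDiff ℝ 2 g)
    (hfg : EqOn f g S) (hS : UniqueDiffOn ℝ S) {x : Par p q} (hx : x ∈ S) :
    hessian f S x = bilinMatrix (fderiv ℝ (fderiv ℝ g) x) := by
  have hg1 : Differentiable ℝ g := hg.differentiable (by norm_num)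
  have hg2 : Differentiable ℝ (fderiv ℝ g) := (contDiff_fderiv hg).differentiable (by norm_num)
  have h1 : EqOn (fderivWithin ℝ f S) (fderiv ℝ g) S := fun y hy => by
    rw [fderivWithin_congr hfg (hfg hy), (hg1 y).fderivWithin (hS y hy)]
  rw [hessian, fderivWithin_congr h1 (h1 hx), (hg2 x).fderivWithin (hS x hx)]
  rfl

lemma hessian_univ_eq_bilinMatrix {f g : Par p q → ℝ} {x : Par p q} (hfg : f =ᶠ[𝓝 x] g) :
    hessian f univ x = bilinMatrix (fderiv ℝ (fderiv ℝ g) x) := by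
  rw [hessian, fderivWithin_univ, fderivWithin_univ, (hfg.fderiv).fderiv_eq]
  rfl

end BilinMatrix

section Blocks

variable {k l : Type*} [Fintype k] [Fintype l]

lemma l2_opNorm_one_le [DecidableEq k] : ‖(1 : Matrix k k ℝ)‖ ≤ 1 := by
  rw [← Matrix.diagonal_one, Matrix.l2_opNorm_diagonal]
  exact (pi_norm_le_iff_of_nonneg zero_le_one).2 fun _ => by simp

lemma l2_opNorm_fromRows_one_zero_le [DecidableEq k] :
    ‖(Matrix.fromRows 1 0 : Matrix (k ⊕ l) k ℝ)‖ ≤ 1 := by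
  have h := Matrix.l2_opNorm_conjTranspose_mul_self (Matrix.fromRows 1 0 : Matrix (k ⊕ l) k ℝ)
  rw [Matrix.conjTranspose_fromRows_eq_fromCols_conjTranspose, Matrix.fromCols_mul_fromRows] at h
  simp only [Matrix.conjTranspose_one, mul_one, Matrix.mul_zero, add_zero] at h
  have h1 := l2_opNorm_one_le (k := k)
  nlinarith [norm_nonneg (Matrix.fromRows 1 0 : Matrix (k ⊕ l) k ℝ)]

lemma l2_opNorm_fromRows_zero_one_le [DecidableEq l] :
    ‖(Matrix.fromRows 0 1 : Matrix (k ⊕ l) l ℝ)‖ ≤ 1 := by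
  have h := Matrix.l2_opNorm_conjTranspose_mul_self (Matrix.fromRows 0 1 : Matrix (k ⊕ l) l ℝ)
  rw [Matrix.conjTranspose_fromRows_eq_fromCols_conjTranspose, Matrix.fromCols_mul_fromRows] at h
  simp only [Matrix.conjTranspose_one, mul_one, Matrix.mul_zero, zero_add] at h
  have h1 := l2_opNorm_one_le (k := l)
  nlinarith [norm_nonneg (Matrix.fromRows 0 1 : Matrix (k ⊕ l) l ℝ)]

lemma norm_mul_mul_le_of_le_one [DecidableEq k] [DecidableEq l] {k' l' : Type*} [Fintype k']
    [Fintype l'] [DecidableEq l'] {P : Matrix k' k ℝ} {A : Matrix k l ℝ} {Q : Matrix l l' ℝ}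
    (hP : ‖P‖ ≤ 1) (hQ : ‖Q‖ ≤ 1) : ‖P * A * Q‖ ≤ ‖A‖ := by
  calc ‖P * A * Q‖ ≤ ‖P * A‖ * ‖Q‖ := Matrix.l2_opNorm_mul _ _
    _ ≤ ‖P‖ * ‖A‖ * ‖Q‖ := by gcongr; exact Matrix.l2_opNorm_mul _ _
    _ ≤ 1 * ‖A‖ * 1 := by gcongr
    _ = _ := by ring

/-- A block is a compression `Jᵀ A J` by a coordinate embedding `J`, whose norm is at most one
because `Jᵀ J = 1`. -/
lemma l2_opNorm_toBlocks₁₁_le [DecidableEq k] [DecidableEq l]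
    (A : Matrix (k ⊕ l) (k ⊕ l) ℝ) : ‖A.toBlocks₁₁‖ ≤ ‖A‖ := by
  have h : A.toBlocks₁₁ = (Matrix.fromRows 1 0 : Matrix (k ⊕ l) k ℝ).conjTranspose * A *
      (Matrix.fromRows 1 0 : Matrix (k ⊕ l) k ℝ) := by
    conv_rhs => rw [← Matrix.fromBlocks_toBlocks A]
    rw [Matrix.conjTranspose_fromRows_eq_fromCols_conjTranspose, Matrix.fromCols_mul_fromBlocks,
      Matrix.fromCols_mul_fromRows]
    simp
  rw [h]
  exact norm_mul_mul_le_of_le_one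
    (by rw [Matrix.l2_opNorm_conjTranspose]; exact l2_opNorm_fromRows_one_zero_le)
    l2_opNorm_fromRows_one_zero_le

lemma l2_opNorm_toBlocks₁₂_le [DecidableEq k] [DecidableEq l]
    (A : Matrix (k ⊕ l) (k ⊕ l) ℝ) : ‖A.toBlocks₁₂‖ ≤ ‖A‖ := by
  have h : A.toBlocks₁₂ = (Matrix.fromRows 1 0 : Matrix (k ⊕ l) k ℝ).conjTranspose * A *
      (Matrix.fromRows 0 1 : Matrix (k ⊕ l) l ℝ) := by
    conv_rhs => rw [← Matrix.fromBlocks_toBlocks A]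
    rw [Matrix.conjTranspose_fromRows_eq_fromCols_conjTranspose, Matrix.fromCols_mul_fromBlocks,
      Matrix.fromCols_mul_fromRows]
    simp
  rw [h]
  exact norm_mul_mul_le_of_le_one
    (by rw [Matrix.l2_opNorm_conjTranspose]; exact l2_opNorm_fromRows_one_zero_le)
    l2_opNorm_fromRows_zero_one_le

end Blocks

/-! ### The cubic term -/

section CubicTerm

variable {K : ℝ → ℝ}

/-- The cubic perturbation `υ ↦ φ_h(‖θ‖) ‖υ‖³`, without the cutoff to a ball. -/
def cubicTerm (K : ℝ → ℝ) (h : ℝ) {m : ℕ} (υ : Par m m) : ℝ :=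
  stepProfile K (‖target υ‖ / h) * ‖υ‖ ^ 3

/-- Writing the step as a smooth function of `‖θ‖²` removes the singularity of `‖θ‖` at `θ = 0`. The
bound is chosen before `m`, so it is uniform in the dimension. The Hessian at `0` vanishes since
`‖υ‖³` and its first two derivatives do. -/
lemma exists_boundedC21_cubicTerm_one (hK : IsSmoothKernel K) {R : ℝ} (hR : 0 ≤ R) :
    ∃ B, 0 < B ∧ ∀ m : ℕ, BoundedC21 (fun υ : Par m m => cubicTerm K 1 υ) R B ∧
      fderiv ℝ (fderiv ℝ fun υ : Par m m => cubicTerm K 1 υ) 0 = 0 := by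
  set g : ℝ → ℝ := fun t => stepProfile K (√t) with hg
  -- Three derivatives of `g` are used: the third, bounded on a compact interval, is the Lipschitz
  -- constant of the second.
  have hg3 : ContDiff ℝ 3 g := contDiff_comp_sqrt (contDiff_stepProfile hK)
    (fun t ht => stepProfile_of_nonpos hK ht) 3
  have hg3' := hg3
  rw [show (3 : WithTop ℕ∞) = 2 + 1 by norm_num, contDiff_succ_iff_deriv] at hg3
  have hd1 : ContDiff ℝ 2 (deriv g) := hg3.2.2
  have hd1' := hd1
  rw [show (2 : WithTop ℕ∞) = 1 + 1 by norm_num, contDiff_succ_iff_deriv] at hd1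
  have hd2 : ContDiff ℝ 1 (deriv (deriv g)) := hd1.2.2
  have hd2' := hd2
  rw [contDiff_one_iff_deriv] at hd2
  set B := R ^ 2 + 2 * R + 2
  have hB : 0 ≤ B := by positivity
  obtain ⟨M0, h0⟩ := isCompact_Icc.exists_bound_of_continuousOn (s := Icc (-B) B)
    hg3'.continuous.continuousOn
  obtain ⟨M1, h1⟩ := isCompact_Icc.exists_bound_of_continuousOn (s := Icc (-B) B)
    hd1'.continuous.continuousOn
  obtain ⟨M2, h2⟩ := isCompact_Icc.exists_bound_of_continuousOn (s := Icc (-B) B)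
    hd2'.continuous.continuousOn
  obtain ⟨M3, h3⟩ := isCompact_Icc.exists_bound_of_continuousOn (s := Icc (-B) B)
    hd2.2.continuousOn
  set M := max 0 (max (max M0 M1) (max M2 M3))
  have hM : 0 ≤ M := le_max_left _ _
  have hM0 : M0 ≤ M := by simp [M]
  have hM1 : M1 ≤ M := by simp [M]
  have hM2 : M2 ≤ M := by simp [M]
  have hM3 : M3 ≤ M := by simp [M]
  set B₁ := M * (1 + 3 * B + 5 * B ^ 2 + B ^ 3)
  set B₂ := R ^ 3 + 3 * R ^ 2 + 12 * R + 12
  have hB₁ : 0 ≤ B₁ := by positivity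
  have hB₂ : 0 ≤ B₂ := by positivity
  refine ⟨8 * (B₁ * B₂) + 1, by positivity, fun m => ?_⟩
  have hq := boundedC21_norm_sq_comp hR (targetL m m) norm_targetL_le
  have hgq : BoundedC21 (fun υ : Par m m => g (‖targetL m m υ‖ ^ 2)) R B₁ :=
    hq.comp hB hM (hg3'.of_le (by norm_num))
      (fun t ht => (h0 t (abs_le.1 ht)).trans hM0) (fun t ht => (h1 t (abs_le.1 ht)).trans hM1)
      (fun t ht => (h2 t (abs_le.1 ht)).trans hM2) (fun s t hs ht => by
        have := (convex_Icc (-B) B).norm_image_sub_le_of_norm_deriv_le (f := deriv (deriv g))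
          (C := M) (x := t) (y := s) (fun t _ => hd2.1 t)
          (fun t ht => (h3 t ht).trans hM3) (abs_le.1 ht) (abs_le.1 hs)
        simpa using this)
  have hc : BoundedC21 (fun υ : Par m m => ‖υ‖ ^ 3) R B₂ := boundedC21_norm_pow_three hR
  have heq : (fun υ : Par m m => cubicTerm K 1 υ) =
      fun υ => g (‖targetL m m υ‖ ^ 2) * ‖υ‖ ^ 3 := by
    ext υ
    simp only [cubicTerm, hg, div_one, Real.sqrt_sq (norm_nonneg _), targetL_apply]
  rw [heq]
  have hmul := hgq.mul hB₁ hB₂ hc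
  refine ⟨⟨hmul.contDiff, fun x hx => ?_, fun x hx => ?_, fun x hx => ?_, fun x y hx hy => ?_⟩, ?_⟩
  · linarith [hmul.bound x hx]
  · linarith [hmul.bound_fderiv x hx]
  · linarith [hmul.bound_fderiv₂ x hx]
  · refine (hmul.lipschitz x y hx hy).trans ?_
    gcongr
    linarith
  · rw [fderiv_fderiv_mul hgq.contDiff hc.contDiff, fderiv_fderiv_norm_pow_three,
      fderiv_norm_pow_three]
    ext; simp

lemma fderiv_smul_comp_smul {E G : Type*} [NormedAddCommGroup E] [NormedSpace ℝ E]
    [NormedAddCommGroup G] [NormedSpace ℝ G] {f : E → G} (hf : Differentiable ℝ f) (a c : ℝ)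
    (x : E) : fderiv ℝ (fun y => c • f (a • y)) x = (c * a) • fderiv ℝ f (a • x) := by
  have h : DifferentiableAt ℝ (fun y => f (a • y)) x :=
    (hf _).comp x (differentiableAt_id.const_smul a)
  rw [fderiv_fun_const_smul h, fderiv_comp_smul, smul_smul]

/-- Regularity of the cubic term, uniform in the dimension and the bandwidth. -/
lemma exists_cubicTerm_bounds (hK : IsSmoothKernel K) {R : ℝ} (hR : 0 ≤ R) :
    ∃ B, 0 < B ∧ ∀ (m : ℕ) (h : ℝ), 0 < h →
      ContDiff ℝ 2 (fun υ : Par m m => cubicTerm K h υ) ∧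
      (∀ x : Par m m, ‖x‖ ≤ R * h →
        ‖fderiv ℝ (fun υ : Par m m => cubicTerm K h υ) x‖ ≤ B * h ^ 2) ∧
      (∀ x y : Par m m, ‖x‖ ≤ R * h → ‖y‖ ≤ R * h →
        ‖fderiv ℝ (fderiv ℝ fun υ : Par m m => cubicTerm K h υ) x -
          fderiv ℝ (fderiv ℝ fun υ : Par m m => cubicTerm K h υ) y‖ ≤ B * ‖x - y‖) ∧
      fderiv ℝ (fderiv ℝ fun υ : Par m m => cubicTerm K h υ) 0 = 0 := by
  obtain ⟨B, hB, H⟩ := exists_boundedC21_cubicTerm_one hK hR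
  refine ⟨B, hB, fun m h hh => ?_⟩
  obtain ⟨hF, hF0⟩ := H m
  set F : Par m m → ℝ := fun υ => cubicTerm K 1 υ
  -- By this scaling the gradient carries a factor `h²` and the Hessian a factor `h` with argument
  -- `υ / h`, so the Lipschitz constant of the Hessian does not depend on `h`.
  have heq : (fun υ : Par m m => cubicTerm K h υ) = fun υ => h ^ 3 • F (h⁻¹ • υ) := by
    ext υ
    simp only [F, cubicTerm, target_smul, norm_smul, norm_inv, Real.norm_of_nonneg hh.le, div_one,
      smul_eq_mul]
    rw [inv_mul_eq_div]
    field_simp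
  have hF1 : Differentiable ℝ F := hF.contDiff.differentiable (by norm_num)
  have hF2 : Differentiable ℝ (fderiv ℝ F) :=
    (contDiff_fderiv hF.contDiff).differentiable (by norm_num)
  have hd : (fderiv ℝ fun υ => h ^ 3 • F (h⁻¹ • υ)) = fun υ => h ^ 2 • fderiv ℝ F (h⁻¹ • υ) := by
    ext1 υ
    rw [fderiv_smul_comp_smul hF1]
    congr 1
    field_simp
  have hd2 : ∀ υ, fderiv ℝ (fderiv ℝ fun υ => h ^ 3 • F (h⁻¹ • υ)) υ =
      h • fderiv ℝ (fderiv ℝ F) (h⁻¹ • υ) := fun υ => by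
    rw [hd, fderiv_smul_comp_smul hF2]
    congr 1
    field_simp
  have hball : ∀ x : Par m m, ‖x‖ ≤ R * h → ‖h⁻¹ • x‖ ≤ R := fun x hx => by
    rw [norm_smul, norm_inv, Real.norm_of_nonneg hh.le, inv_mul_le_iff₀ hh]
    linarith
  rw [heq]
  refine ⟨ContDiff.const_smul (h ^ 3) (f := fun υ => F (h⁻¹ • υ)) (hF.contDiff.comp (contDiff_id.const_smul h⁻¹)),
    fun x hx => ?_, fun x y hx hy => ?_, ?_⟩
  · rw [hd, norm_smul, Real.norm_of_nonneg (by positivity), mul_comm]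
    gcongr
    exact hF.bound_fderiv _ (hball x hx)
  · rw [hd2, hd2, ← smul_sub, norm_smul, Real.norm_of_nonneg hh.le]
    have := hF.lipschitz _ _ (hball x hx) (hball y hy)
    rw [← smul_sub, norm_smul, norm_inv, Real.norm_of_nonneg hh.le] at this
    calc _ ≤ h * (B * (h⁻¹ * ‖x - y‖)) := by gcongr
      _ = _ := by field_simp
  · rw [hd2, smul_zero, hF0, smul_zero]

end CubicTerm


/-! ### Gaussian vectors -/

section GaussianLaw

variable {ι : Type*} [Fintype ι]

/-- The characteristic function of `T X` at `t` is that of `X` at the adjoint `S t`. The hypothesis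
on `‖S t‖²` says `T T* = n I`, which cancels the covariance `n⁻¹ I`. It serves for the score, for
the whole vector and for both projections. -/
lemma hasLaw_stdGaussian_of_adjoint [DecidableEq ι] {Ω : Type*} [MeasurableSpace Ω] {P : Measure Ω}
    {n : ℕ} (hn : 0 < n) {X : Ω → EuclideanSpace ℝ ι}
    (hX : HasLaw X (multivariateGaussian 0 ((n : ℝ)⁻¹ • 1)) P)
    {F : Type*} [NormedAddCommGroup F] [InnerProductSpace ℝ F] [FiniteDimensional ℝ F]
    [MeasurableSpace F] [BorelSpace F] (T : EuclideanSpace ℝ ι →L[ℝ] F)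
    (S : F → EuclideanSpace ℝ ι) (hTS : ∀ x t, inner ℝ (T x) t = inner ℝ x (S t))
    (hS : ∀ t, ‖S t‖ ^ 2 = n * ‖t‖ ^ 2) :
    HasLaw (fun ω => T (X ω)) (stdGaussian F) P := by
  have hn' : (0 : ℝ) < n := by exact_mod_cast hn
  have hpsd : ((n : ℝ)⁻¹ • (1 : Matrix ι ι ℝ)).PosSemidef :=
    Matrix.PosSemidef.one.smul (by positivity)
  have hmap : (multivariateGaussian (0 : EuclideanSpace ℝ ι) ((n : ℝ)⁻¹ • 1)).map T =
      stdGaussian F := by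
    refine Measure.ext_of_charFun ?_
    ext t
    rw [charFun_apply, integral_map (by fun_prop) (by fun_prop), charFun_stdGaussian]
    simp_rw [hTS]
    rw [← charFun_apply, charFun_multivariateGaussian hpsd]
    congr 1
    have h1 : (S t).ofLp ⬝ᵥ ((n : ℝ)⁻¹ • (1 : Matrix ι ι ℝ)).mulVec (S t).ofLp = ‖t‖ ^ 2 := by
      rw [Matrix.smul_mulVec, Matrix.one_mulVec, dotProduct_smul]
      have h2 : (S t).ofLp ⬝ᵥ (S t).ofLp = ‖S t‖ ^ 2 := by
        rw [EuclideanSpace.real_norm_sq_eq]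
        simp [dotProduct, pow_two]
      rw [h2, hS, smul_eq_mul]
      field_simp
    rw [h1]
    simp
    ring
  exact ⟨T.continuous.measurable.comp_aemeasurable hX.aemeasurable, by
    change P.map (T ∘ X) = _
    rw [← AEMeasurable.map_map_of_aemeasurable T.continuous.measurable.aemeasurable hX.aemeasurable,
      hX.map_eq, hmap]⟩

lemma gaussianReal_eq_stdGaussian : gaussianReal 0 1 = stdGaussian ℝ := by
  refine Measure.ext_of_charFun ?_
  ext t
  rw [charFun_gaussianReal, charFun_stdGaussian]
  simp [← Complex.ofReal_pow, neg_div]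

lemma integral_exp_mul_sq_gaussianReal {t : ℝ} (ht : t < 1 / 2) :
    Integrable (fun x : ℝ => Real.exp (t * x ^ 2)) (gaussianReal 0 1) ∧
      ∫ x, Real.exp (t * x ^ 2) ∂(gaussianReal 0 1) = (√(1 - 2 * t))⁻¹ := by
  have hb : 0 < 1 / 2 - t := by linarith
  have heq : ∀ x : ℝ, gaussianPDFReal 0 1 x * Real.exp (t * x ^ 2) =
      (√(2 * Real.pi))⁻¹ * Real.exp (-(1 / 2 - t) * x ^ 2) := fun x => by
    rw [gaussianPDFReal_def, mul_assoc, ← Real.exp_add]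
    simp only [NNReal.coe_one, mul_one, sub_zero]
    congr 2
    ring
  refine ⟨?_, ?_⟩
  · rw [gaussianReal_of_var_ne_zero _ one_ne_zero]
    rw [integrable_withDensity_iff (measurable_gaussianPDF 0 1)
      (ae_of_all _ fun x => gaussianPDF_lt_top)]
    simp_rw [toReal_gaussianPDF, mul_comm (Real.exp _), heq]
    exact (integrable_exp_neg_mul_sq hb).const_mul _
  · rw [integral_gaussianReal_eq_integral_smul one_ne_zero]
    simp_rw [smul_eq_mul, heq]
    rw [integral_const_mul, integral_gaussian, ← Real.sqrt_inv, ← Real.sqrt_mul (by positivity),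
      ← Real.sqrt_inv]
    congr 1
    have := Real.pi_pos
    have h2 : 1 - 2 * t ≠ 0 := by linarith
    field_simp

lemma integral_exp_mul_norm_sq_stdGaussian {t : ℝ} (ht : t < 1 / 2) :
    Integrable (fun z : EuclideanSpace ℝ ι => Real.exp (t * ‖z‖ ^ 2))
        (stdGaussian (EuclideanSpace ℝ ι)) ∧
      ∫ z, Real.exp (t * ‖z‖ ^ 2) ∂(stdGaussian (EuclideanSpace ℝ ι)) =
        (√(1 - 2 * t))⁻¹ ^ Fintype.card ι := by
  obtain ⟨h1, h2⟩ := integral_exp_mul_sq_gaussianReal ht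
  have heq : ∀ x : ι → ℝ, Real.exp (t * ‖(WithLp.toLp 2 x : EuclideanSpace ℝ ι)‖ ^ 2) =
      ∏ i, Real.exp (t * x i ^ 2) := fun x => by
    rw [EuclideanSpace.real_norm_sq_eq, Finset.mul_sum, Real.exp_sum]
  rw [← map_pi_eq_stdGaussian]
  constructor
  · rw [integrable_map_measure (by fun_prop) (by fun_prop)]
    simp only [Function.comp_def, heq]
    exact Integrable.fintype_prod (f := fun _ : ι => fun y : ℝ => Real.exp (t * y ^ 2))
      (μ := fun _ => gaussianReal 0 1) (fun _ => h1)
  · rw [integral_map (by fun_prop) (by fun_prop)]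
    simp only [heq]
    rw [integral_fintype_prod_eq_prod (f := fun _ : ι => fun y : ℝ => Real.exp (t * y ^ 2))]
    simp [h2]

/-- Chernoff's bound at `t = 1/4` gives `exp(-d) * (√2)^d`, and `√2 ≤ exp(1/2)`. -/
lemma stdGaussian_norm_sq_ge_le (d : ℕ) (hd : Fintype.card ι = d) :
    (stdGaussian (EuclideanSpace ℝ ι)).real {z | 4 * (d : ℝ) ≤ ‖z‖ ^ 2} ≤
      Real.exp (-(d / 2 : ℝ)) := by
  obtain ⟨h1, h2⟩ := integral_exp_mul_norm_sq_stdGaussian (ι := ι) (t := 1 / 4) (by norm_num)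
  refine (measure_ge_le_exp_mul_mgf (X := fun z : EuclideanSpace ℝ ι => ‖z‖ ^ 2) (4 * (d : ℝ))
    (by norm_num : (0 : ℝ) ≤ 1 / 4) h1).trans ?_
  rw [mgf, h2, hd]
  have h3 : (√(1 - 2 * (1 / 4) : ℝ))⁻¹ ≤ Real.exp (1 / 2) := by
    rw [← Real.sqrt_inv, Real.sqrt_le_left (Real.exp_pos _).le, ← Real.exp_nat_mul]
    have := Real.add_one_le_exp (1 : ℝ)
    norm_num
    linarith
  calc _ ≤ Real.exp (-(1 / 4) * (4 * d)) * Real.exp (1 / 2) ^ d := by gcongr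
    _ = _ := by
      rw [← Real.exp_nat_mul, ← Real.exp_add]
      congr 1
      ring

/-- Chernoff's bound for the lower tail, with parameter `-s`, has base `exp(sκ) / √(1 + 2s)`. This
is below one for small `s` because `κ < 1`; `s = (1 - κ)/4` is small enough. -/
lemma exists_stdGaussian_norm_sq_le_le {κ : ℝ} (h0 : 0 < κ) (h1 : κ < 1) :
    ∃ τ, 0 ≤ τ ∧ τ < 1 ∧ ∀ m : ℕ,
      (stdGaussian (EuclideanSpace ℝ (Fin m))).real {z | ‖z‖ ^ 2 ≤ κ * m} ≤ τ ^ m := by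
  set s := (1 - κ) / 4 with hs
  have hs0 : 0 < s := by simp only [hs]; linarith
  refine ⟨Real.exp (s * κ) * (√(1 - 2 * (-s)))⁻¹, by positivity, ?_, fun m => ?_⟩
  · rw [← div_eq_mul_inv, div_lt_one (by apply Real.sqrt_pos.2; linarith), Real.lt_sqrt (by positivity),
      ← Real.exp_nat_mul]
    have hlt : 0 < 1 - 2 * (s * κ) := by simp only [hs]; nlinarith
    have h2 : Real.exp (2 * (s * κ)) ≤ (1 - 2 * (s * κ))⁻¹ := by
      have := Real.add_one_le_exp (-(2 * (s * κ)))
      rw [← inv_inv (Real.exp _), ← Real.exp_neg]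
      exact inv_anti₀ hlt (by linarith)
    have h3 : (1 - 2 * (s * κ))⁻¹ < 1 - 2 * (-s) := by
      rw [inv_lt_iff_one_lt_mul₀ hlt]
      have : 0 < s * ((1 - κ) - 2 * s * κ) := by
        apply mul_pos hs0
        simp only [hs]; nlinarith
      nlinarith
    push_cast
    linarith
  · obtain ⟨h2, h3⟩ := integral_exp_mul_norm_sq_stdGaussian (ι := Fin m) (t := -s) (by linarith)
    refine (measure_le_le_exp_mul_mgf (X := fun z : EuclideanSpace ℝ (Fin m) => ‖z‖ ^ 2)
      (κ * m) (by linarith : -s ≤ 0) h2).trans ?_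
    rw [mgf, h3, mul_pow, ← Real.exp_nat_mul, Fintype.card_fin]
    apply le_of_eq
    congr 2
    ring

/-- The inner sphere is excluded, so the shrinking shells have empty intersection, and continuity
from above applies. -/
lemma exists_stdGaussian_shell_le_single (m : ℕ) (hm : 0 < m) {η : ENNReal} (hη : 0 < η) :
    ∃ ε : ℝ, 0 < ε ∧ stdGaussian (Par m m)
      {z | 2 * √(2 * m : ℝ) < ‖z‖ ∧ ‖z‖ ≤ 2 * √(2 * m : ℝ) + ε * √(2 * m : ℝ)} ≤ η := by
  set r := √(2 * m : ℝ) with hr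
  have hr0 : 0 < r := Real.sqrt_pos.2 (by positivity)
  set A : ℕ → Set (Par m m) := fun k => {z | 2 * r < ‖z‖ ∧ ‖z‖ ≤ 2 * r + 1 / ((k : ℝ) + 1) * r}
  have hmeas : ∀ k, MeasurableSet (A k) := fun k =>
    (measurableSet_lt measurable_const measurable_norm).inter
      (measurableSet_le measurable_norm measurable_const)
  have hanti : Antitone A := fun j k hjk z hz => ⟨hz.1, hz.2.trans (by
    have : 1 / ((k : ℝ) + 1) ≤ 1 / ((j : ℝ) + 1) :=
      one_div_le_one_div_of_le (by positivity) (by exact_mod_cast Nat.succ_le_succ hjk)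
    gcongr)⟩
  have hempty : ⋂ k, A k = ∅ := by
    refine eq_empty_iff_forall_notMem.2 fun z hz => ?_
    rw [mem_iInter] at hz
    obtain ⟨k, hk⟩ := exists_nat_one_div_lt (div_pos (sub_pos.2 (hz 0).1) hr0)
    rw [lt_div_iff₀ hr0] at hk
    linarith [(hz k).2]
  have ht := tendsto_measure_iInter_atTop (μ := stdGaussian (Par m m))
    (fun k => (hmeas k).nullMeasurableSet) hanti ⟨0, measure_ne_top _ _⟩
  rw [hempty, measure_empty] at ht
  obtain ⟨k, hk⟩ := (ht.eventually (eventually_le_nhds hη)).exists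
  exact ⟨1 / ((k : ℝ) + 1), by positivity, hk⟩

/-- A thin shell just outside the radius `2 √d` carries little Gaussian mass, uniformly in the
dimension `d = 2m`. -/
lemma exists_stdGaussian_shell_le {η : ENNReal} (hη : 0 < η) :
    ∃ ε : ℝ, 0 < ε ∧ ∀ m : ℕ, 0 < m → stdGaussian (Par m m)
      {z | 2 * √(2 * m : ℝ) < ‖z‖ ∧ ‖z‖ ≤ 2 * √(2 * m : ℝ) + ε * √(2 * m : ℝ)} ≤ η := by
  -- From dimension `2M` on, the whole exterior of the ball already has mass at most `η`; below it,
  -- finitely many dimensions remain and the smallest width serves them all.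
  obtain ⟨M, hM⟩ : ∃ M : ℕ, ∀ m ≥ M, ENNReal.ofReal (Real.exp (-(m : ℝ))) ≤ η := by
    have h : Tendsto (fun m : ℕ => ENNReal.ofReal (Real.exp (-(m : ℝ)))) atTop (𝓝 0) := by
      have := ENNReal.tendsto_ofReal
        (Real.tendsto_exp_neg_atTop_nhds_zero.comp (tendsto_natCast_atTop_atTop (R := ℝ)))
      simpa using this
    exact eventually_atTop.1 (h.eventually (eventually_le_nhds hη))
  have hfin : ∀ N : ℕ, ∃ ε : ℝ, 0 < ε ∧ ∀ m : ℕ, m < N → 0 < m → stdGaussian (Par m m)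
      {z | 2 * √(2 * m : ℝ) < ‖z‖ ∧ ‖z‖ ≤ 2 * √(2 * m : ℝ) + ε * √(2 * m : ℝ)} ≤ η := by
    intro N
    induction N with
    | zero => exact ⟨1, one_pos, fun m hm => absurd hm (by omega)⟩
    | succ N ih =>
      obtain ⟨ε, hε, h⟩ := ih
      rcases Nat.eq_zero_or_pos N with rfl | hN
      · exact ⟨1, one_pos, fun m hm h0 => absurd hm (by omega)⟩
      obtain ⟨ε', hε', h'⟩ := exists_stdGaussian_shell_le_single N hN hη
      refine ⟨min ε ε', lt_min hε hε', fun m hm h0 => ?_⟩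
      rcases Nat.lt_succ_iff_lt_or_eq.1 hm with hlt | rfl
      · refine (measure_mono ?_).trans (h m hlt h0)
        exact fun z hz => ⟨hz.1, hz.2.trans (by gcongr; exact min_le_left _ _)⟩
      · refine (measure_mono ?_).trans h'
        exact fun z hz => ⟨hz.1, hz.2.trans (by gcongr; exact min_le_right _ _)⟩
  obtain ⟨ε, hε, h⟩ := hfin M
  refine ⟨ε, hε, fun m hm => ?_⟩
  rcases lt_or_ge m M with hlt | hge
  · exact h m hlt hm
  · refine le_trans ?_ (hM m hge)
    have h1 := stdGaussian_norm_sq_ge_le (ι := Fin m ⊕ Fin m) (2 * m) (by simp; ring)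
    rw [← ENNReal.ofReal_toReal (measure_ne_top _ _)]
    refine ENNReal.ofReal_le_ofReal ((measureReal_mono fun z hz => ?_).trans (h1.trans_eq ?_))
    · simp only [mem_ofPred_eq] at hz ⊢
      have h2 : (2 * √(2 * m : ℝ)) ^ 2 ≤ ‖z‖ ^ 2 := by gcongr; exact hz.1.le
      rw [mul_pow, Real.sq_sqrt (by positivity)] at h2
      push_cast
      linarith
    · push_cast
      congr 1
      ring

end GaussianLaw


/-! ### The contrast at a fixed observation -/

section Deterministic

variable {K : ℝ → ℝ} {L : ℝ} {n m : ℕ}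

/-- The scale `√(p / n)`, `p = 2m`, of the model. -/
def modelScale (n m : ℕ) : ℝ := √((2 * m : ℝ) / n)

lemma modelScale_pos (hn : 0 < n) (hm : 0 < m) : 0 < modelScale n m :=
  Real.sqrt_pos.2 (by positivity)

lemma modelScale_sq : modelScale n m ^ 2 = (2 * m : ℝ) / n :=
  Real.sq_sqrt (by positivity)

lemma mem_modelBall {υ : Par m m} : υ ∈ modelBall n m ↔ ‖υ‖ ≤ 2 * modelScale n m := by
  simp [modelBall, modelScale]

lemma zero_mem_modelBall : (0 : Par m m) ∈ modelBall n m :=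
  mem_modelBall.2 (by rw [norm_zero]; exact mul_nonneg zero_le_two (Real.sqrt_nonneg _))

/-- The bandwidth `h = L⁻¹ √(p / n)`. -/
def bandwidth (L : ℝ) (n m : ℕ) : ℝ := 1 / L * modelScale n m

lemma bandwidth_pos (hL : 0 < L) (hn : 0 < n) (hm : 0 < m) : 0 < bandwidth L n m :=
  mul_pos (by positivity) (modelScale_pos hn hm)

lemma cutoff_of_mem (hK : IsSmoothKernel K) (hL : 0 < L) (hn : 0 < n) (hm : 0 < m) {υ : Par m m}
    (hυ : υ ∈ modelBall n m) :
    cutoff K L n m υ = stepProfile K (‖target υ‖ / bandwidth L n m) := by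
  rw [cutoff, indicator_of_mem hυ, mul_one]
  exact smoothStep_eq hK (bandwidth_pos hL hn hm) (norm_nonneg _)

lemma cutoff_of_notMem {υ : Par m m} (hυ : υ ∉ modelBall n m) : cutoff K L n m υ = 0 := by
  rw [cutoff, indicator_of_notMem hυ, mul_zero]

lemma cutoff_nonneg (hK : IsSmoothKernel K) (hL : 0 < L) (hn : 0 < n) (hm : 0 < m) (υ : Par m m) :
    0 ≤ cutoff K L n m υ := by
  by_cases hυ : υ ∈ modelBall n m
  · rw [cutoff_of_mem hK hL hn hm hυ]; exact stepProfile_nonneg hK _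
  · rw [cutoff_of_notMem hυ]

lemma cutoff_le_one (hK : IsSmoothKernel K) (hL : 0 < L) (hn : 0 < n) (hm : 0 < m) (υ : Par m m) :
    cutoff K L n m υ ≤ 1 := by
  by_cases hυ : υ ∈ modelBall n m
  · rw [cutoff_of_mem hK hL hn hm hυ]; exact stepProfile_le_one hK _
  · rw [cutoff_of_notMem hυ]; exact zero_le_one

lemma cutoff_of_target_eq_zero (hK : IsSmoothKernel K) (hL : 0 < L) (hn : 0 < n) (hm : 0 < m)
    {υ : Par m m} (hυ : target υ = 0) : cutoff K L n m υ = 0 := by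
  by_cases h : υ ∈ modelBall n m
  · rw [cutoff_of_mem hK hL hn hm h, hυ, norm_zero, zero_div, stepProfile_of_nonpos hK le_rfl]
  · rw [cutoff_of_notMem h]

lemma cutoff_eq_one (hK : IsSmoothKernel K) (hL : 0 < L) (hn : 0 < n) (hm : 0 < m)
    {υ : Par m m} (h1 : 2 / L * modelScale n m ≤ ‖target υ‖) (h2 : υ ∈ modelBall n m) :
    cutoff K L n m υ = 1 := by
  rw [cutoff_of_mem hK hL hn hm h2, stepProfile_of_two_le hK]
  rw [le_div_iff₀ (bandwidth_pos hL hn hm), bandwidth]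
  calc _ = 2 / L * modelScale n m := by ring
    _ ≤ _ := h1

lemma cutoff_mul_norm_pow_three_le (hK : IsSmoothKernel K) (hL : 0 < L) (hn : 0 < n) (hm : 0 < m)
    (υ : Par m m) : cutoff K L n m υ * ‖υ‖ ^ 3 ≤ 8 * modelScale n m ^ 3 := by
  have h0 := (modelScale_pos hn hm).le
  by_cases hυ : υ ∈ modelBall n m
  · calc _ ≤ 1 * (2 * modelScale n m) ^ 3 := by
          gcongr
          · exact cutoff_le_one hK hL hn hm υ
          · exact mem_modelBall.1 hυ
      _ = _ := by ring
  · rw [cutoff_of_notMem hυ, zero_mul]; positivity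

/-- The quadratic part of the contrast. -/
def quadContrast (n : ℕ) (x υ : Par m m) : ℝ := n * inner ℝ x υ - n * ‖υ‖ ^ 2 / 2

lemma contrast_eq (x υ : Par m m) :
    contrast K L n m x υ = quadContrast n x υ + cutoff K L n m υ * (n * ‖υ‖ ^ 3 / 3) := rfl

lemma quadContrast_eq (x υ : Par m m) :
    quadContrast n x υ = n / 2 * ‖x‖ ^ 2 - n / 2 * ‖υ - x‖ ^ 2 := by
  rw [quadContrast, norm_sub_sq_real, real_inner_comm]
  ring

lemma quadContrast_le_contrast (hK : IsSmoothKernel K) (hL : 0 < L) (hn : 0 < n) (hm : 0 < m)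
    (x υ : Par m m) : quadContrast n x υ ≤ contrast K L n m x υ := by
  rw [contrast_eq]
  have := cutoff_nonneg hK hL hn hm υ
  have : 0 ≤ cutoff K L n m υ * (n * ‖υ‖ ^ 3 / 3) := by positivity
  linarith

lemma contrast_le_quadContrast_add (hK : IsSmoothKernel K) (hL : 0 < L) (hn : 0 < n) (hm : 0 < m)
    (x υ : Par m m) :
    contrast K L n m x υ ≤ quadContrast n x υ + n / 3 * (8 * modelScale n m ^ 3) := by
  rw [contrast_eq]
  have h := cutoff_mul_norm_pow_three_le hK hL hn hm υ
  have h2 : (n : ℝ) / 3 * (cutoff K L n m υ * ‖υ‖ ^ 3) ≤ n / 3 * (8 * modelScale n m ^ 3) := by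
    gcongr
  linarith

lemma contrast_of_notMem {x υ : Par m m} (hυ : υ ∉ modelBall n m) :
    contrast K L n m x υ = quadContrast n x υ := by
  rw [contrast_eq, cutoff_of_notMem hυ]; ring

lemma contrast_of_target_eq_zero (hK : IsSmoothKernel K) (hL : 0 < L) (hn : 0 < n) (hm : 0 < m)
    {x υ : Par m m} (hυ : target υ = 0) : contrast K L n m x υ = quadContrast n x υ := by
  rw [contrast_eq, cutoff_of_target_eq_zero hK hL hn hm hυ]; ring

lemma contrast_of_mem (hK : IsSmoothKernel K) (hL : 0 < L) (hn : 0 < n) (hm : 0 < m)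
    {x υ : Par m m} (hυ : υ ∈ modelBall n m) : contrast K L n m x υ =
      quadContrast n x υ + n / 3 * cubicTerm K (bandwidth L n m) υ := by
  rw [contrast_eq, cutoff_of_mem hK hL hn hm hυ, cubicTerm]; ring

lemma continuousOn_contrast (hK : IsSmoothKernel K) (hL : 0 < L) (hn : 0 < n) (hm : 0 < m)
    (x : Par m m) : ContinuousOn (contrast K L n m x) (modelBall n m) := by
  have h : Continuous fun υ : Par m m =>
      quadContrast n x υ + n / 3 * cubicTerm K (bandwidth L n m) υ := by
    have h1 : Continuous (stepProfile K) := (contDiff_stepProfile hK).continuous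
    have h2 : Continuous (target : Par m m → _) := continuous_target
    simp only [quadContrast, cubicTerm]
    fun_prop
  exact h.continuousOn.congr fun υ hυ => contrast_of_mem hK hL hn hm hυ

/-- On a closed set on which its quadratic part is maximal at some point, the contrast has a
maximizer. -/
lemma exists_contrast_max (hK : IsSmoothKernel K) (hL : 0 < L) (hn : 0 < n) (hm : 0 < m)
    (x : Par m m) {S : Set (Par m m)} (hS : IsClosed S) {y : Par m m} (hy : y ∈ S)
    (hmax : ∀ w ∈ S, quadContrast n x w ≤ quadContrast n x y) :
    ∃ υ ∈ S, ∀ w ∈ S, contrast K L n m x w ≤ contrast K L n m x υ := by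
  -- The contrast may be discontinuous at the boundary of the ball, so compactness is used only
  -- inside. Outside, the contrast equals its quadratic part, and the quadratic maximizer `y` does
  -- at least as well.
  have hout : ∀ w ∈ S, w ∉ modelBall n m → contrast K L n m x w ≤ contrast K L n m x y :=
    fun w hw hwb => by
      rw [contrast_of_notMem hwb]
      exact (hmax w hw).trans (quadContrast_le_contrast hK hL hn hm x y)
  rcases (S ∩ modelBall n m).eq_empty_or_nonempty with he | hne
  · refine ⟨y, hy, fun w hw => hout w hw fun hwb => ?_⟩
    have : w ∈ S ∩ modelBall n m := ⟨hw, hwb⟩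
    rw [he] at this
    exact this
  · have hcomp : IsCompact (S ∩ modelBall n m) := (isCompact_closedBall _ _).inter_left hS
    obtain ⟨υ, hυ, hυmax⟩ := hcomp.exists_isMaxOn hne
      ((continuousOn_contrast hK hL hn hm x).mono inter_subset_right)
    rcases le_total (contrast K L n m x y) (contrast K L n m x υ) with h | h
    · refine ⟨υ, hυ.1, fun w hw => ?_⟩
      by_cases hwb : w ∈ modelBall n m
      · exact hυmax ⟨hw, hwb⟩
      · exact (hout w hw hwb).trans h
    · refine ⟨y, hy, fun w hw => ?_⟩
      by_cases hwb : w ∈ modelBall n m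
      · exact (hυmax ⟨hw, hwb⟩ : contrast K L n m x w ≤ contrast K L n m x υ).trans h
      · exact hout w hw hwb

lemma quadContrast_le_self (x w : Par m m) : quadContrast n x w ≤ quadContrast n x x := by
  rw [quadContrast_eq, quadContrast_eq, sub_self, norm_zero]
  have : 0 ≤ (n : ℝ) / 2 * ‖w - x‖ ^ 2 := by positivity
  linarith

lemma quadContrast_eq_blocks (x w : Par m m) : quadContrast n x w = n / 2 * ‖x‖ ^ 2 -
    n / 2 * ‖target w - target x‖ ^ 2 - n / 2 * ‖nuisance w - nuisance x‖ ^ 2 := by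
  have h2 : nuisance (w - x) = nuisance w - nuisance x := map_sub (nuisanceL m m) w x
  rw [quadContrast_eq, norm_sq_eq_target_add_nuisance (w - x), target_sub, h2]
  ring

lemma quadContrast_le_pair (x w : Par m m) :
    quadContrast n x w ≤ quadContrast n x (pair (target w) (nuisance x)) := by
  rw [quadContrast_eq_blocks, quadContrast_eq_blocks x (pair _ _), target_pair, nuisance_pair,
    sub_self, norm_zero]
  have : 0 ≤ (n : ℝ) / 2 * ‖nuisance w - nuisance x‖ ^ 2 := by positivity
  linarith

lemma exists_fiber_max (hK : IsSmoothKernel K) (hL : 0 < L) (hn : 0 < n) (hm : 0 < m)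
    (x : Par m m) (θ : EuclideanSpace ℝ (Fin m)) :
    ∃ υ, target υ = θ ∧ ∀ w, target w = θ → contrast K L n m x w ≤ contrast K L n m x υ :=
  exists_contrast_max hK hL hn hm x (S := {υ | target υ = θ})
    (isClosed_eq continuous_target continuous_const) (y := pair θ (nuisance x)) rfl
    fun w hw => by
      have h := quadContrast_le_pair (n := n) x w
      rwa [show target w = θ from hw] at h

lemma maximizers_nonempty (hK : IsSmoothKernel K) (hL : 0 < L) (hn : 0 < n) (hm : 0 < m)
    (x : Par m m) : (maximizers (contrast K L n m x)).Nonempty := by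
  obtain ⟨υ, -, hυ⟩ := exists_contrast_max hK hL hn hm x isClosed_univ (mem_univ x)
    fun w _ => quadContrast_le_self x w
  exact ⟨υ, fun w => hυ w (mem_univ w)⟩

lemma maximizersAt_nonempty (hK : IsSmoothKernel K) (hL : 0 < L) (hn : 0 < n) (hm : 0 < m)
    (x : Par m m) (θ : EuclideanSpace ℝ (Fin m)) :
    (maximizersAt (contrast K L n m x) θ).Nonempty :=
  exists_fiber_max hK hL hn hm x θ

/-! ### Profiles, the Wilks gap and the location of maximizers. -/

lemma profile_eq_of_isMax {ℓ : Par m m → ℝ} {υ : Par m m}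
    (hυ : ∀ w, target w = target υ → ℓ w ≤ ℓ υ) : profile ℓ (target υ) = ℓ υ := by
  have : Nonempty {w : Par m m // target w = target υ} := ⟨⟨υ, rfl⟩⟩
  refine le_antisymm (ciSup_le fun w => hυ w w.2) ?_
  exact le_ciSup (f := fun w : {w : Par m m // target w = target υ} => ℓ w)
    ⟨ℓ υ, by rintro _ ⟨w, rfl⟩; exact hυ w w.2⟩ ⟨υ, rfl⟩

lemma profile_le_of_mem_maximizers {ℓ : Par m m → ℝ} {υ : Par m m} (hυ : υ ∈ maximizers ℓ)
    (θ : EuclideanSpace ℝ (Fin m)) : profile ℓ θ ≤ ℓ υ := by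
  have : Nonempty {w : Par m m // target w = θ} := ⟨⟨pair θ 0, rfl⟩⟩
  exact ciSup_le fun w => hυ w

lemma profile_target_of_mem_maximizers {ℓ : Par m m → ℝ} {υ : Par m m} (hυ : υ ∈ maximizers ℓ) :
    profile ℓ (target υ) = ℓ υ := profile_eq_of_isMax fun w _ => hυ w

lemma target_mem_profileEstimators {ℓ : Par m m → ℝ} {υ : Par m m} (hυ : υ ∈ maximizers ℓ) :
    target υ ∈ profileEstimators ℓ := fun θ' => by
  rw [profile_target_of_mem_maximizers hυ]
  exact profile_le_of_mem_maximizers hυ θ'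

/-- The maximum over each fibre is attained, so a maximizer of the profile lifts to a full
maximizer. Estimates for full maximizers therefore cover every profile estimator. -/
lemma exists_maximizer_of_mem_profileEstimators (hK : IsSmoothKernel K) (hL : 0 < L) (hn : 0 < n)
    (hm : 0 < m) {x : Par m m} {θ : EuclideanSpace ℝ (Fin m)}
    (hθ : θ ∈ profileEstimators (contrast K L n m x)) :
    ∃ υ ∈ maximizers (contrast K L n m x), target υ = θ := by
  obtain ⟨υ, rfl, hυ⟩ := exists_fiber_max hK hL hn hm x θ
  obtain ⟨υ', hυ'⟩ := maximizers_nonempty hK hL hn hm x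
  refine ⟨υ, fun w => (hυ' w).trans ?_, rfl⟩
  have := hθ (target υ')
  rwa [profile_target_of_mem_maximizers hυ', profile_eq_of_isMax hυ] at this

lemma excess_eq_of_mem_maximizers {ℓ : Par m m → ℝ} {υ : Par m m} (hυ : υ ∈ maximizers ℓ)
    (θ₀ : EuclideanSpace ℝ (Fin m)) : excess ℓ θ₀ = ℓ υ - profile ℓ θ₀ := by
  rw [excess]
  congr 1
  refine le_antisymm (ciSup_le fun θ => profile_le_of_mem_maximizers hυ θ) ?_
  rw [← profile_target_of_mem_maximizers hυ]
  exact le_ciSup (f := profile ℓ) ⟨ℓ υ, by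
    rintro _ ⟨θ, rfl⟩; exact profile_le_of_mem_maximizers hυ θ⟩ (target υ)

/-- On the fibre over `0` the perturbation vanishes and the contrast is a strictly concave quadratic
in the nuisance. -/
lemma maximizersAt_zero_eq (hK : IsSmoothKernel K) (hL : 0 < L) (hn : 0 < n) (hm : 0 < m)
    (x : Par m m) : maximizersAt (contrast K L n m x) 0 = {pair 0 (nuisance x)} := by
  have hn' : (0 : ℝ) < n := by exact_mod_cast hn
  refine eq_singleton_iff_unique_mem.2 ⟨⟨rfl, fun w hw => ?_⟩, fun υ ⟨h0, hυ⟩ => ?_⟩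
  · rw [contrast_of_target_eq_zero hK hL hn hm hw,
      contrast_of_target_eq_zero hK hL hn hm (target_pair _ _)]
    have h := quadContrast_le_pair (n := n) x w
    rwa [hw] at h
  · have h := hυ (pair 0 (nuisance x)) rfl
    rw [contrast_of_target_eq_zero hK hL hn hm h0,
      contrast_of_target_eq_zero hK hL hn hm (target_pair _ _), quadContrast_eq_blocks,
      quadContrast_eq_blocks x υ, target_pair, nuisance_pair, h0, sub_self, norm_zero] at h
    have h2 : ‖nuisance υ - nuisance x‖ ^ 2 = 0 :=
      le_antisymm (by nlinarith) (sq_nonneg _)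
    have h3 : nuisance υ = nuisance x := by
      rw [pow_eq_zero_iff two_ne_zero, norm_eq_zero, sub_eq_zero] at h2
      exact h2
    ext i
    rcases i with i | i
    · exact congrFun (congrArg WithLp.ofLp h0) i
    · exact congrFun (congrArg WithLp.ofLp h3) i

lemma profile_zero_eq (hK : IsSmoothKernel K) (hL : 0 < L) (hn : 0 < n) (hm : 0 < m)
    (x : Par m m) : profile (contrast K L n m x) 0 = n / 2 * ‖nuisance x‖ ^ 2 := by
  have hmem : pair 0 (nuisance x) ∈ maximizersAt (contrast K L n m x) 0 := by
    rw [maximizersAt_zero_eq hK hL hn hm]; rfl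
  have h := profile_eq_of_isMax (υ := pair 0 (nuisance x)) hmem.2
  rw [target_pair] at h
  rw [h, contrast_of_target_eq_zero hK hL hn hm (target_pair _ _), quadContrast_eq_blocks,
    target_pair, nuisance_pair, sub_self, norm_zero, zero_sub, norm_neg,
    norm_sq_eq_target_add_nuisance x]
  ring

/-- Without the perturbation, twice the excess would be exactly `n ‖target x‖²`. The lower bound
tests the maximum at `υ = x`, the unperturbed maximizer; the upper bound adds the largest possible
perturbation to the quadratic maximum. -/
lemma gap_bounds (hK : IsSmoothKernel K) (hL : 0 < L) (hn : 0 < n) (hm : 0 < m) (x : Par m m) :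
    2 * n / 3 * (cutoff K L n m x * ‖x‖ ^ 3) ≤
        2 * excess (contrast K L n m x) 0 - n * ‖target x‖ ^ 2 ∧
      2 * excess (contrast K L n m x) 0 - n * ‖target x‖ ^ 2 ≤
        16 / 3 * (n * modelScale n m ^ 3) := by
  obtain ⟨υ, hυ⟩ := maximizers_nonempty hK hL hn hm x
  rw [excess_eq_of_mem_maximizers hυ, profile_zero_eq hK hL hn hm]
  have hx := norm_sq_eq_target_add_nuisance x
  have hqx : quadContrast n x x = n / 2 * ‖x‖ ^ 2 := by
    rw [quadContrast_eq, sub_self, norm_zero]; ring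
  constructor
  · have h := hυ x
    rw [contrast_eq, hqx, hx] at h
    linarith
  · have h := contrast_le_quadContrast_add hK hL hn hm x υ
    have h2 := quadContrast_le_self (n := n) x υ
    rw [hqx, hx] at h2
    linarith

/-- Outside the ball only the quadratic part remains, and it is strictly smaller than at `x`, where
the perturbation moreover is nonnegative. -/
lemma mem_modelBall_of_mem_maximizers (hK : IsSmoothKernel K) (hL : 0 < L) (hn : 0 < n)
    (hm : 0 < m) {x υ : Par m m} (hx : x ∈ modelBall n m)
    (hυ : υ ∈ maximizers (contrast K L n m x)) : υ ∈ modelBall n m := by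
  by_contra h
  have hn' : (0 : ℝ) < n := by exact_mod_cast hn
  have h1 := (quadContrast_le_contrast hK hL hn hm x x).trans (hυ x)
  rw [contrast_of_notMem h, quadContrast_eq, quadContrast_eq x υ, sub_self, norm_zero] at h1
  have h2 : ‖υ - x‖ ^ 2 = 0 := le_antisymm (by nlinarith) (sq_nonneg _)
  rw [pow_eq_zero_iff two_ne_zero, norm_eq_zero, sub_eq_zero] at h2
  exact h (h2 ▸ hx)

/-- Optimality against `x` bounds the quadratic loss `n/2 ‖υ - x‖²` by the gain of the cubic term,
at most `n/3 * B * ‖υ - x‖`; one factor `‖υ - x‖` cancels. -/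
lemma norm_sub_le_of_mem_maximizers (hK : IsSmoothKernel K) (hL : 0 < L) (hn : 0 < n)
    (hm : 0 < m) {B : ℝ} (hF : ContDiff ℝ 2 (fun υ : Par m m => cubicTerm K (bandwidth L n m) υ))
    (hB : ∀ x : Par m m, ‖x‖ ≤ 2 * modelScale n m →
      ‖fderiv ℝ (fun υ : Par m m => cubicTerm K (bandwidth L n m) υ) x‖ ≤ B)
    {x υ : Par m m} (hx : x ∈ modelBall n m) (hυ : υ ∈ maximizers (contrast K L n m x)) :
    ‖υ - x‖ ≤ 2 / 3 * B := by
  have hn' : (0 : ℝ) < n := by exact_mod_cast hn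
  have hυb := mem_modelBall_of_mem_maximizers hK hL hn hm hx hυ
  have h1 := hυ x
  rw [contrast_of_mem hK hL hn hm hx, contrast_of_mem hK hL hn hm hυb, quadContrast_eq,
    quadContrast_eq x υ, sub_self, norm_zero] at h1
  have h2 := norm_sub_le_of_fderiv_le (hF.differentiable (by norm_num)) hB
    (mem_modelBall.1 hυb) (mem_modelBall.1 hx)
  have h3 := (le_abs_self _).trans h2
  rcases (norm_nonneg (υ - x)).eq_or_lt with h0 | h0
  · rw [← h0]
    have := (norm_nonneg _).trans (hB x (mem_modelBall.1 hx))
    positivity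
  · have h4 : (n : ℝ) / 2 * ‖υ - x‖ ^ 2 ≤ n / 3 * (B * ‖υ - x‖) := by
      have : (n : ℝ) / 3 * (cubicTerm K (bandwidth L n m) υ - cubicTerm K (bandwidth L n m) x) ≤
        n / 3 * (B * ‖υ - x‖) := by gcongr
      linarith
    have h5 : (n : ℝ) * ‖υ - x‖ * ‖υ - x‖ ≤ n * ‖υ - x‖ * (2 / 3 * B) := by linarith
    exact le_of_mul_le_mul_left h5 (by positivity)

/-- With `ρ = modelScale n m`, a maximizer inside the ball would lose more than `n/2 * 9ρ³` and gain
at most `n/3 * 8ρ³`. So it lies outside, where the contrast is the quadratic part. -/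
lemma eq_of_mem_maximizers_of_lt_norm (hK : IsSmoothKernel K) (hL : 0 < L) (hn : 0 < n)
    (hm : 0 < m) {x υ : Par m m}
    (hx : 2 * modelScale n m + 3 * (modelScale n m * √(modelScale n m)) < ‖x‖)
    (hυ : υ ∈ maximizers (contrast K L n m x)) : υ = x := by
  have hn' : (0 : ℝ) < n := by exact_mod_cast hn
  set ρ := modelScale n m with hρ
  have hρ0 : 0 < ρ := modelScale_pos hn hm
  have h1 := (quadContrast_le_contrast hK hL hn hm x x).trans (hυ x)
  by_cases h : υ ∈ modelBall n m
  · exfalso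
    have h2 := h1.trans (contrast_le_quadContrast_add hK hL hn hm x υ)
    rw [quadContrast_eq, quadContrast_eq x υ, sub_self, norm_zero, ← hρ] at h2
    have h3 : 3 * (ρ * √ρ) < ‖υ - x‖ := by
      have h4 := norm_sub_norm_le x υ
      rw [norm_sub_rev] at h4
      have h5 := mem_modelBall.1 h
      linarith
    have h4 : (3 * (ρ * √ρ)) ^ 2 < ‖υ - x‖ ^ 2 := by gcongr
    have h5 : (3 * (ρ * √ρ)) ^ 2 = 9 * ρ ^ 3 := by
      rw [mul_pow, mul_pow, Real.sq_sqrt hρ0.le]; ring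
    have h6 : 0 < ρ ^ 3 := by positivity
    nlinarith
  · rw [contrast_of_notMem h, quadContrast_eq, quadContrast_eq x υ, sub_self, norm_zero] at h1
    have h2 : ‖υ - x‖ ^ 2 = 0 := le_antisymm (by nlinarith) (sq_nonneg _)
    rwa [pow_eq_zero_iff two_ne_zero, norm_eq_zero, sub_eq_zero] at h2

end Deterministic


/-! ### Regularity of the expected contrast -/

/-- Bounds on the derivatives of the cubic term on the ball of the model. -/
structure CubicBounds (K : ℝ → ℝ) (L : ℝ) (n m : ℕ) (B : ℝ) : Prop where
  contDiff : ContDiff ℝ 2 fun υ : Par m m => cubicTerm K (bandwidth L n m) υ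
  bound_fderiv : ∀ x : Par m m, ‖x‖ ≤ 2 * modelScale n m →
    ‖fderiv ℝ (fun υ : Par m m => cubicTerm K (bandwidth L n m) υ) x‖ ≤ B * modelScale n m ^ 2
  lipschitz : ∀ x y : Par m m, ‖x‖ ≤ 2 * modelScale n m → ‖y‖ ≤ 2 * modelScale n m →
    ‖fderiv ℝ (fderiv ℝ fun υ : Par m m => cubicTerm K (bandwidth L n m) υ) x -
      fderiv ℝ (fderiv ℝ fun υ : Par m m => cubicTerm K (bandwidth L n m) υ) y‖ ≤ B * ‖x - y‖
  zero : fderiv ℝ (fderiv ℝ fun υ : Par m m => cubicTerm K (bandwidth L n m) υ) 0 = 0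

lemma exists_cubicBounds {K : ℝ → ℝ} (hK : IsSmoothKernel K) {L : ℝ} (hL : 0 < L) :
    ∃ B, 0 < B ∧ ∀ n m : ℕ, 0 < n → 0 < m → CubicBounds K L n m B := by
  -- In units of the bandwidth `ρ / L` the ball of radius `2ρ` has radius `2L`, whatever `n` and `m`
  -- are.
  obtain ⟨B, hB, H⟩ := exists_cubicTerm_bounds hK (R := 2 * L) (by positivity)
  refine ⟨max B (B * (1 / L) ^ 2), lt_max_of_lt_left hB, fun n m hn hm => ?_⟩
  obtain ⟨h1, h2, h3, h4⟩ := H m (bandwidth L n m) (bandwidth_pos hL hn hm)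
  have hR : 2 * L * bandwidth L n m = 2 * modelScale n m := by
    rw [bandwidth]; field_simp
  rw [hR] at h2 h3
  refine ⟨h1, fun x hx => (h2 x hx).trans ?_, fun x y hx hy => (h3 x y hx hy).trans ?_, h4⟩
  · rw [bandwidth, mul_pow, ← mul_assoc]
    gcongr
    exact le_max_right _ _
  · gcongr
    exact le_max_left _ _

section Mean

variable {K : ℝ → ℝ} {L : ℝ} {n m : ℕ}

/-- A globally `C²` function which coincides with the expected contrast on the ball. -/
def smoothMean (K : ℝ → ℝ) (L : ℝ) (n m : ℕ) (υ : Par m m) : ℝ :=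
  (-(n / 2 : ℝ)) • ‖υ‖ ^ 2 + (n / 3 : ℝ) • cubicTerm K (bandwidth L n m) υ

lemma CubicBounds.contDiff_smoothMean {B : ℝ} (hB : CubicBounds K L n m B) :
    ContDiff ℝ 2 (smoothMean K L n m) :=
  (ContDiff.const_smul (-(n / 2 : ℝ)) (contDiff_norm_sq ℝ)).add
    (ContDiff.const_smul (n / 3 : ℝ) hB.contDiff)

lemma CubicBounds.fderiv_fderiv_smoothMean {B : ℝ} (hB : CubicBounds K L n m B) (x : Par m m) :
    fderiv ℝ (fderiv ℝ (smoothMean K L n m)) x = (-(n : ℝ)) • innerBilin (Par m m) +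
      (n / 3 : ℝ) •
        fderiv ℝ (fderiv ℝ fun υ : Par m m => cubicTerm K (bandwidth L n m) υ) x := by
  have h1 : Differentiable ℝ fun υ : Par m m => cubicTerm K (bandwidth L n m) υ :=
    hB.contDiff.differentiable (by norm_num)
  have h2 := (contDiff_fderiv hB.contDiff).differentiable (by norm_num)
  have hd : fderiv ℝ (smoothMean K L n m) = fun y => (-(n : ℝ)) • innerBilin (Par m m) y +
      (n / 3 : ℝ) • fderiv ℝ (fun υ : Par m m => cubicTerm K (bandwidth L n m) υ) y := by
    ext1 y
    have h := ((hasStrictFDerivAt_norm_sq y).hasFDerivAt.const_smul (-(n / 2 : ℝ))).add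
      ((h1 y).hasFDerivAt.const_smul (n / 3 : ℝ))
    refine (h.congr_fderiv ?_).fderiv
    ext z
    simp [innerBilin_apply]
    ring
  rw [hd]
  exact (((innerBilin (Par m m)).hasFDerivAt.const_smul (-(n : ℝ))).add
    ((h2 x).hasFDerivAt.const_smul (n / 3 : ℝ))).fderiv

/-- The expected contrast in closed form. -/
def meanFun (K : ℝ → ℝ) (L : ℝ) (n m : ℕ) (υ : Par m m) : ℝ :=
  -(n * ‖υ‖ ^ 2 / 2) + cutoff K L n m υ * (n * ‖υ‖ ^ 3 / 3)

lemma meanFun_of_mem (hK : IsSmoothKernel K) (hL : 0 < L) (hn : 0 < n) (hm : 0 < m)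
    {υ : Par m m} (hυ : υ ∈ modelBall n m) : meanFun K L n m υ = smoothMean K L n m υ := by
  rw [meanFun, cutoff_of_mem hK hL hn hm hυ, smoothMean, cubicTerm, smul_eq_mul, smul_eq_mul]
  ring

lemma modelBall_mem_nhds_zero (hn : 0 < n) (hm : 0 < m) :
    modelBall n m ∈ 𝓝 (0 : Par m m) :=
  Metric.closedBall_mem_nhds _ (mul_pos two_pos (modelScale_pos hn hm))

lemma closedBall_subset_modelBall {r : ℝ} (hr : r ≤ 2 * modelScale n m) :
    Metric.closedBall (0 : Par m m) r ⊆ modelBall n m := Metric.closedBall_subset_closedBall hr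

lemma contDiffOn_meanFun (hK : IsSmoothKernel K) (hL : 0 < L) (hn : 0 < n) (hm : 0 < m) {B : ℝ}
    (hB : CubicBounds K L n m B) : ContDiffOn ℝ 2 (meanFun K L n m) (modelBall n m) :=
  hB.contDiff_smoothMean.contDiffOn.congr fun _ hυ => meanFun_of_mem hK hL hn hm hυ

lemma hessian_meanFun_closedBall (hK : IsSmoothKernel K) (hL : 0 < L) (hn : 0 < n) (hm : 0 < m)
    {B : ℝ} (hB : CubicBounds K L n m B) {r : ℝ} (hr0 : 0 < r) (hr : r ≤ 2 * modelScale n m)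
    {υ : Par m m} (hυ : υ ∈ Metric.closedBall (0 : Par m m) r) :
    hessian (meanFun K L n m) (Metric.closedBall 0 r) υ = -((n : ℝ) • 1) + (n / 3 : ℝ) •
      bilinMatrix (fderiv ℝ (fderiv ℝ fun υ : Par m m => cubicTerm K (bandwidth L n m) υ) υ) := by
  have hS : UniqueDiffOn ℝ (Metric.closedBall (0 : Par m m) r) :=
    uniqueDiffOn_convex (convex_closedBall _ _)
      ⟨0, by rw [interior_closedBall _ hr0.ne']; exact Metric.mem_ball_self hr0⟩
  rw [hessian_eq_bilinMatrix hB.contDiff_smoothMean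
    (fun w hw => meanFun_of_mem hK hL hn hm (closedBall_subset_modelBall hr hw)) hS hυ,
    hB.fderiv_fderiv_smoothMean, bilinMatrix_add, bilinMatrix_smul, bilinMatrix_smul,
    bilinMatrix_innerBilin, neg_smul]

lemma hessian_meanFun_univ_zero (hK : IsSmoothKernel K) (hL : 0 < L) (hn : 0 < n) (hm : 0 < m)
    {B : ℝ} (hB : CubicBounds K L n m B) :
    hessian (meanFun K L n m) univ 0 = -((n : ℝ) • 1) := by
  have h : meanFun K L n m =ᶠ[𝓝 0] smoothMean K L n m := by
    filter_upwards [modelBall_mem_nhds_zero hn hm] with υ hυ using meanFun_of_mem hK hL hn hm hυ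
  rw [hessian_univ_eq_bilinMatrix h, hB.fderiv_fderiv_smoothMean, hB.zero, smul_zero, add_zero,
    bilinMatrix_smul, bilinMatrix_innerBilin, neg_smul]

lemma hessian_meanFun_lipschitz (hK : IsSmoothKernel K) (hL : 0 < L) (hn : 0 < n) (hm : 0 < m)
    {B : ℝ} (hB0 : 0 < B) (hB : CubicBounds K L n m B) {υ υ' : Par m m} (hυ : υ ∈ modelBall n m)
    (hυ' : υ' ∈ modelBall n m) :
    ‖hessian (meanFun K L n m) (modelBall n m) υ - hessian (meanFun K L n m) (modelBall n m) υ'‖ ≤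
      n * B * ‖υ - υ'‖ := by
  have hr : 0 < 2 * modelScale n m := mul_pos two_pos (modelScale_pos hn hm)
  have h1 := hessian_meanFun_closedBall hK hL hn hm hB hr le_rfl (υ := υ) hυ
  have h2 := hessian_meanFun_closedBall hK hL hn hm hB hr le_rfl (υ := υ') hυ'
  change ‖hessian (meanFun K L n m) (Metric.closedBall 0 (2 * modelScale n m)) υ -
    hessian (meanFun K L n m) (Metric.closedBall 0 (2 * modelScale n m)) υ'‖ ≤ _
  rw [h1, h2, add_sub_add_left_eq_sub, ← smul_sub, ← bilinMatrix_sub, norm_smul,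
    Real.norm_of_nonneg (by positivity)]
  have h3 := (norm_bilinMatrix_le _).trans
    (hB.lipschitz υ υ' (mem_modelBall.1 hυ) (mem_modelBall.1 hυ'))
  calc _ ≤ (n / 3 : ℝ) * (B * ‖υ - υ'‖) := by gcongr
    _ ≤ n * (B * ‖υ - υ'‖) := by gcongr; linarith
    _ = _ := by ring

/-- Quadratic drift of the expected contrast. -/
lemma meanFun_le (hK : IsSmoothKernel K) (hL : 0 < L) (hn : 0 < n) (hm : 0 < m)
    (hρ : modelScale n m ≤ 3 / 8) (υ : Par m m) : meanFun K L n m υ ≤ -(n / 4 * ‖υ‖ ^ 2) := by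
  rw [meanFun]
  by_cases h : υ ∈ modelBall n m
  · have h1 : cutoff K L n m υ * (n * ‖υ‖ ^ 3 / 3) ≤ 1 * (n * ‖υ‖ ^ 3 / 3) := by
      gcongr; exact cutoff_le_one hK hL hn hm υ
    -- The threshold `3/8` for the scale is what makes `‖υ‖/3 ≤ 1/4`: the cubic term then uses up at
    -- most half of the quadratic drift.
    have h2 : ‖υ‖ ≤ 3 / 4 := (mem_modelBall.1 h).trans (by linarith)
    have h3 : (n : ℝ) * ‖υ‖ ^ 2 * ‖υ‖ ≤ n * ‖υ‖ ^ 2 * (3 / 4) := by gcongr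
    nlinarith
  · rw [cutoff_of_notMem h]
    have : 0 ≤ (n : ℝ) * ‖υ‖ ^ 2 := by positivity
    linarith

lemma meanFun_zero : meanFun K L n m 0 = 0 := by simp [meanFun]

lemma maximizers_meanFun (hK : IsSmoothKernel K) (hL : 0 < L) (hn : 0 < n) (hm : 0 < m)
    (hρ : modelScale n m ≤ 3 / 8) : maximizers (meanFun K L n m) = {0} := by
  have hn' : (0 : ℝ) < n := by exact_mod_cast hn
  refine eq_singleton_iff_unique_mem.2 ⟨fun w => ?_, fun υ hυ => ?_⟩
  · rw [meanFun_zero]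
    exact (meanFun_le hK hL hn hm hρ w).trans (neg_nonpos.2 (by positivity))
  · have h := hυ 0
    rw [meanFun_zero] at h
    have h1 := h.trans (meanFun_le hK hL hn hm hρ υ)
    have h2 : ‖υ‖ ^ 2 = 0 := le_antisymm (by nlinarith) (sq_nonneg _)
    rwa [pow_eq_zero_iff two_ne_zero, norm_eq_zero] at h2

end Mean

/-! ### The random contrast -/

section Model

variable {K : ℝ → ℝ} {L : ℝ} {n m : ℕ} {Ω : Type*} [MeasurableSpace Ω] {P : Measure Ω}
  {X : Ω → Par m m}

lemma IsModel.isProbabilityMeasure (hX : IsModel P n m X) : IsProbabilityMeasure P :=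
  HasLaw.isProbabilityMeasure hX

lemma IsModel.integrable (hX : IsModel P n m X) : Integrable X P := by
  have h : Integrable id (P.map X) := by
    rw [hX.map_eq]; exact IsGaussian.integrable_id
  exact h.comp_aemeasurable hX.aemeasurable

lemma IsModel.integral_eq_zero (hX : IsModel P n m X) : ∫ ω, X ω ∂P = 0 := by
  rw [HasLaw.integral_eq hX, integral_id_multivariateGaussian]

lemma IsModel.integrable_contrast (hX : IsModel P n m X) (υ : Par m m) :
    Integrable (fun ω => contrast K L n m (X ω) υ) P := by
  have := hX.isProbabilityMeasure
  exact (((hX.integrable.inner_const υ).const_mul (n : ℝ)).sub (integrable_const _)).add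
    (integrable_const _)

lemma IsModel.meanContrast_eq (hX : IsModel P n m X) :
    meanContrast P (fun ω υ => contrast K L n m (X ω) υ) = meanFun K L n m := by
  have := hX.isProbabilityMeasure
  ext υ
  have h1 : ∫ ω, inner ℝ (X ω) υ ∂P = 0 := by
    have h := integral_inner (𝕜 := ℝ) hX.integrable υ
    rw [hX.integral_eq_zero, inner_zero_right] at h
    simpa only [real_inner_comm] using h
  have h2 : ∀ ω, contrast K L n m (X ω) υ = n * inner ℝ (X ω) υ + meanFun K L n m υ := fun ω => by
    rw [contrast, meanFun]; ring
  rw [meanContrast]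
  simp_rw [h2]
  rw [integral_add ((hX.integrable.inner_const υ).const_mul (n : ℝ)) (integrable_const _),
    integral_const_mul, h1]
  simp

lemma IsModel.stoch_eq (hX : IsModel P n m X) (ω : Ω) :
    stoch P (fun ω υ => contrast K L n m (X ω) υ) ω = fun υ => inner ℝ ((n : ℝ) • X ω) υ := by
  ext υ
  rw [stoch, hX.meanContrast_eq, real_inner_smul_left, contrast, meanFun]
  ring

lemma hasGradientAt_inner {E : Type*} [NormedAddCommGroup E] [InnerProductSpace ℝ E]
    [CompleteSpace E] (a x : E) : HasGradientAt (fun y => inner ℝ a y) a x := by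
  rw [hasGradientAt_iff_hasFDerivAt]
  exact (InnerProductSpace.toDual ℝ E a).hasFDerivAt

lemma IsModel.gradient_stoch (hX : IsModel P n m X) (ω : Ω) (υ : Par m m) :
    gradient (stoch P (fun ω υ => contrast K L n m (X ω) υ) ω) υ = (n : ℝ) • X ω := by
  rw [hX.stoch_eq]
  exact (hasGradientAt_inner _ _).gradient

/-- The random part is linear, and the mean is `O(‖υ‖²)` simply because the cutoff takes values in
`[0, 1]`. -/
lemma hasGradientAt_contrast_zero (hK : IsSmoothKernel K) (hL : 0 < L) (hn : 0 < n) (hm : 0 < m)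
    (x : Par m m) : HasGradientAt (contrast K L n m x) ((n : ℝ) • x) 0 := by
  have hmean : HasFDerivAt (meanFun K L n m) (0 : Par m m →L[ℝ] ℝ) 0 := by
    rw [hasFDerivAt_iff_isLittleO_nhds_zero]
    simp only [zero_add, meanFun_zero, sub_zero, zero_apply]
    have hO : meanFun K L n m =O[𝓝 0] fun υ : Par m m => ‖υ‖ ^ 2 := by
      refine Asymptotics.IsBigO.of_bound n ?_
      filter_upwards [Metric.closedBall_mem_nhds (0 : Par m m) one_pos] with υ hυ
      have hυ1 : ‖υ‖ ≤ 1 := by simpa using hυ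
      rw [Real.norm_eq_abs, Real.norm_of_nonneg (by positivity), meanFun]
      have h1 : cutoff K L n m υ * (n * ‖υ‖ ^ 3 / 3) ≤ 1 * (n * ‖υ‖ ^ 3 / 3) := by
        gcongr; exact cutoff_le_one hK hL hn hm υ
      have h0 : 0 ≤ cutoff K L n m υ * (n * ‖υ‖ ^ 3 / 3) :=
        mul_nonneg (cutoff_nonneg hK hL hn hm υ) (by positivity)
      have h3 : (n : ℝ) * ‖υ‖ ^ 2 * ‖υ‖ ≤ n * ‖υ‖ ^ 2 * 1 := by gcongr
      have h4 : 0 ≤ (n : ℝ) * ‖υ‖ ^ 2 := by positivity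
      rw [abs_le]
      constructor <;> nlinarith
    exact hO.trans_isLittleO (Asymptotics.isLittleO_norm_pow_id one_lt_two)
  have heq : contrast K L n m x = fun υ => inner ℝ ((n : ℝ) • x) υ + meanFun K L n m υ := by
    ext υ
    rw [real_inner_smul_left, contrast, meanFun]; ring
  rw [heq, hasGradientAt_iff_hasFDerivAt]
  have h := (hasGradientAt_inner ((n : ℝ) • x) (0 : Par m m)).hasFDerivAt.add hmean
  rwa [add_zero] at h

/-! #### Matrices -/

lemma posDef_sqrt_smul_one (hn : 0 < n) {k : Type*} [Fintype k] [DecidableEq k] :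
    (√(n : ℝ) • (1 : Matrix k k ℝ)).PosDef :=
  Matrix.PosDef.one.smul (Real.sqrt_pos.2 (by exact_mod_cast hn))

lemma sqrt_smul_one_mul_self {k : Type*} [Fintype k] [DecidableEq k] :
    (√(n : ℝ) • (1 : Matrix k k ℝ)) * (√(n : ℝ) • 1) = (n : ℝ) • 1 := by
  rw [smul_mul_smul_comm, mul_one, Real.mul_self_sqrt (Nat.cast_nonneg n)]

lemma sqrt_smul_one_inv (hn : 0 < n) {k : Type*} [Fintype k] [DecidableEq k] :
    (√(n : ℝ) • (1 : Matrix k k ℝ))⁻¹ = (√(n : ℝ))⁻¹ • 1 := by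
  have h : √(n : ℝ) ≠ 0 := (Real.sqrt_pos.2 (by exact_mod_cast hn)).ne'
  refine Matrix.inv_eq_left_inv ?_
  rw [smul_mul_smul_comm, mul_one, inv_mul_cancel₀ h, one_smul]

lemma toEuclideanLin_smul_one {k : Type*} [Fintype k] [DecidableEq k] (c : ℝ)
    (x : EuclideanSpace ℝ k) : Matrix.toEuclideanLin (c • (1 : Matrix k k ℝ)) x = c • x := by
  rw [map_smul]
  simp

lemma sqrt_inv_conj (hn : 0 < n) {k l : Type*} [Fintype k] [DecidableEq k] [Fintype l]
    [DecidableEq l] (A : Matrix k l ℝ) :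
    (√(n : ℝ) • (1 : Matrix k k ℝ))⁻¹ * A * (√(n : ℝ) • (1 : Matrix l l ℝ))⁻¹ =
      (n : ℝ)⁻¹ • A := by
  rw [sqrt_smul_one_inv hn, sqrt_smul_one_inv hn, Matrix.smul_mul, Matrix.one_mul,
    Matrix.mul_smul, Matrix.mul_one, smul_smul, ← mul_inv, Real.mul_self_sqrt (Nat.cast_nonneg n)]

lemma localSet_modelMatrices (hn : 0 < n) (r : ℝ) :
    localSet (modelMatrices n m) 0 r = Metric.closedBall 0 (r / √(n : ℝ)) := by
  have hs : 0 < √(n : ℝ) := Real.sqrt_pos.2 (by exact_mod_cast hn)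
  ext υ
  change ‖Matrix.toEuclideanLin (√(n : ℝ) • 1) (υ - 0)‖ ≤ r ↔ _
  rw [sub_zero, toEuclideanLin_smul_one, norm_smul, Real.norm_of_nonneg hs.le, mem_closedBall_zero_iff,
    le_div_iff₀ hs, mul_comm]

lemma div_sqrt_le_of_le (hn : 0 < n) {r : ℝ} (hr : r ≤ 2 * √(2 * m : ℝ)) :
    r / √(n : ℝ) ≤ 2 * modelScale n m := by
  rw [modelScale, Real.sqrt_div (by positivity), ← mul_div_assoc]
  gcongr

lemma localSet_two_sqrt (hn : 0 < n) :
    localSet (modelMatrices n m) 0 (2 * √(2 * m : ℝ)) = modelBall n m := by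
  rw [localSet_modelMatrices hn, modelBall, Real.sqrt_div (by positivity), ← mul_div_assoc]

lemma IsModel.gradCov_eq (hX : IsModel P n m X) (hK : IsSmoothKernel K) (hL : 0 < L) (hn : 0 < n)
    (hm : 0 < m) : gradCov P (fun ω υ => contrast K L n m (X ω) υ) 0 = (n : ℝ) • 1 := by
  have hn' : (0 : ℝ) < n := by exact_mod_cast hn
  have hpsd : ((n : ℝ)⁻¹ • (1 : Matrix (Fin m ⊕ Fin m) (Fin m ⊕ Fin m) ℝ)).PosSemidef :=
    Matrix.PosSemidef.one.smul (by positivity)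
  ext i j
  have hg : ∀ ω, gradient (contrast K L n m (X ω)) 0 = (n : ℝ) • X ω := fun ω =>
    (hasGradientAt_contrast_zero hK hL hn hm (X ω)).gradient
  change covariance (fun ω => gradient (contrast K L n m (X ω)) 0 i)
    (fun ω => gradient (contrast K L n m (X ω)) 0 j) P = _
  simp_rw [hg, PiLp.smul_apply, smul_eq_mul]
  rw [covariance_const_mul_left, covariance_const_mul_right,
    HasLaw.covariance_fun_comp hX (f := fun x : Par m m => x i) (g := fun x : Par m m => x j)
      (by fun_prop) (by fun_prop), covariance_eval_multivariateGaussian hpsd]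
  simp only [Matrix.smul_apply, smul_eq_mul]
  field_simp

lemma IsModel.matrices (hX : IsModel P n m X) (hK : IsSmoothKernel K) (hL : 0 < L) (hn : 0 < n)
    (hm : 0 < m) {B : ℝ} (hB : CubicBounds K L n m B) :
    (modelMatrices n m).IsOf P (fun ω υ => contrast K L n m (X ω) υ) 0 where
  DD_pos := posDef_sqrt_smul_one hn
  DD_sq := by
    rw [info, hX.meanContrast_eq, hessian_meanFun_univ_zero hK hL hn hm hB, neg_neg]
    exact sqrt_smul_one_mul_self
  VV_pos := posDef_sqrt_smul_one hn
  VV_sq := by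
    rw [hX.gradCov_eq hK hL hn hm]
    exact sqrt_smul_one_mul_self
  D_pos := posDef_sqrt_smul_one hn
  D_sq := by
    change (√(n : ℝ) • 1) * (√(n : ℝ) • 1) = Matrix.toBlocks₁₁ ((√(n : ℝ) • 1) * (√(n : ℝ) • 1))
    rw [sqrt_smul_one_mul_self, sqrt_smul_one_mul_self]
    ext i j
    simp [Matrix.toBlocks₁₁, Matrix.one_apply]
  A_eq := by
    change 0 = Matrix.toBlocks₁₂ ((√(n : ℝ) • 1) * (√(n : ℝ) • 1))
    rw [sqrt_smul_one_mul_self]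
    ext i j
    simp [Matrix.toBlocks₁₂]
  H_pos := posDef_sqrt_smul_one hn
  H_sq := by
    change (√(n : ℝ) • 1) * (√(n : ℝ) • 1) = Matrix.toBlocks₂₂ ((√(n : ℝ) • 1) * (√(n : ℝ) • 1))
    rw [sqrt_smul_one_mul_self, sqrt_smul_one_mul_self]
    ext i j
    simp [Matrix.toBlocks₂₂, Matrix.one_apply]
  Dbr_pos := posDef_sqrt_smul_one hn
  Dbr_sq := by simp [modelMatrices]

/-! #### Exponential moments and the efficient score -/

lemma expBound_of_hasLaw_gaussianReal {Y : Ω → ℝ} (hY : HasLaw Y (gaussianReal 0 1) P) (μ : ℝ) :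
    ExpBound P Y μ 1 := by
  refine ⟨?_, ?_⟩
  · have h := integrable_exp_mul_gaussianReal (μ := 0) (v := 1) μ
    rw [← hY.map_eq] at h
    exact h.comp_aemeasurable hY.aemeasurable
  · rw [cgf_gaussianReal hY.map_eq]
    simp

/-- The normalized score is exactly standard normal, so the exponential moment bounds hold for every
real `μ`, including the arbitrarily negative ones admitted in `CondEr`. -/
lemma IsModel.hasLaw_score (hX : IsModel P n m X) (hn : 0 < n) {γ : Par m m} (hγ : γ ≠ 0) :
    HasLaw (fun ω => inner ℝ ((n : ℝ) • X ω) γ /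
        ‖Matrix.toEuclideanLin (√(n : ℝ) • (1 : Matrix (Fin m ⊕ Fin m) (Fin m ⊕ Fin m) ℝ)) γ‖)
      (gaussianReal 0 1) P := by
  have hn' : (0 : ℝ) < n := by exact_mod_cast hn
  have hs : 0 < √(n : ℝ) := Real.sqrt_pos.2 hn'
  have hg : 0 < ‖γ‖ := norm_pos_iff.2 hγ
  rw [gaussianReal_eq_stdGaussian]
  have h := hasLaw_stdGaussian_of_adjoint (F := ℝ) hn hX
    ((√(n : ℝ) / ‖γ‖) • innerBilin (Par m m) γ) (fun t => (√(n : ℝ) / ‖γ‖ * t) • γ)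
    (fun x t => by
      simp [innerBilin_apply, real_inner_smul_right, real_inner_comm]; ring)
    (fun t => by
      rw [norm_smul, Real.norm_eq_abs, Real.norm_eq_abs, mul_pow, sq_abs, sq_abs, mul_pow, div_pow,
        Real.sq_sqrt hn'.le]
      field_simp)
  refine h.congr (ae_of_all _ fun ω => ?_)
  simp only [smul_apply, innerBilin_apply, smul_eq_mul, toEuclideanLin_smul_one, norm_smul,
    Real.norm_of_nonneg hs.le, real_inner_smul_left]
  rw [real_inner_comm γ]
  field_simp
  rw [Real.sq_sqrt hn'.le]
  ring

lemma IsModel.effScore_eq (hX : IsModel P n m X) (hn : 0 < n) (ω : Ω) :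
    effScore (modelMatrices n m) P (fun ω υ => contrast K L n m (X ω) υ) 0 ω =
      √(n : ℝ) • target (X ω) := by
  have hs : 0 < √(n : ℝ) := Real.sqrt_pos.2 (by exact_mod_cast hn)
  rw [effScore, hX.gradient_stoch]
  simp only [modelMatrices, zero_mul, map_zero, LinearMap.zero_apply, sub_zero,
    sqrt_smul_one_inv hn]
  rw [toEuclideanLin_smul_one, target_smul, smul_smul]
  congr 1
  rw [inv_mul_eq_iff_eq_mul₀ hs.ne', Real.mul_self_sqrt (Nat.cast_nonneg n)]

lemma IsModel.hasLaw_sqrt_smul (hX : IsModel P n m X) (hn : 0 < n) :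
    HasLaw (fun ω => √(n : ℝ) • X ω) (stdGaussian (Par m m)) P :=
  hasLaw_stdGaussian_of_adjoint (F := Par m m) hn hX (√(n : ℝ) • ContinuousLinearMap.id ℝ (Par m m))
    (fun t => √(n : ℝ) • t) (fun x t => by simp [real_inner_smul_left, real_inner_smul_right])
    (fun t => by rw [norm_smul, mul_pow, Real.norm_of_nonneg (Real.sqrt_nonneg _),
      Real.sq_sqrt (Nat.cast_nonneg n)])

lemma inner_target_eq (x : Par m m) (t : EuclideanSpace ℝ (Fin m)) :
    inner ℝ (target x) t = inner ℝ x (pair t 0) := by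
  rw [inner_eq_target_add_nuisance, target_pair, nuisance_pair, inner_zero_right, add_zero]

lemma inner_nuisance_eq (x : Par m m) (t : EuclideanSpace ℝ (Fin m)) :
    inner ℝ (nuisance x) t = inner ℝ x (pair 0 t) := by
  rw [inner_eq_target_add_nuisance, target_pair, nuisance_pair, inner_zero_right, zero_add]

lemma norm_pair_sq (θ η : EuclideanSpace ℝ (Fin m)) : ‖pair θ η‖ ^ 2 = ‖θ‖ ^ 2 + ‖η‖ ^ 2 := by
  rw [norm_sq_eq_target_add_nuisance, target_pair, nuisance_pair]

lemma IsModel.hasLaw_target (hX : IsModel P n m X) (hn : 0 < n) :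
    HasLaw (fun ω => √(n : ℝ) • target (X ω)) (stdGaussian (EuclideanSpace ℝ (Fin m))) P :=
  hasLaw_stdGaussian_of_adjoint (F := EuclideanSpace ℝ (Fin m)) hn hX (√(n : ℝ) • targetL m m)
    (fun t => √(n : ℝ) • pair t 0)
    (fun x t => by
      simp [real_inner_smul_left, real_inner_smul_right, targetL_apply, inner_target_eq])
    (fun t => by rw [norm_smul, mul_pow, Real.norm_of_nonneg (Real.sqrt_nonneg _),
      Real.sq_sqrt (Nat.cast_nonneg n), norm_pair_sq, norm_zero]; ring)

lemma IsModel.hasLaw_nuisance (hX : IsModel P n m X) (hn : 0 < n) :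
    HasLaw (fun ω => √(n : ℝ) • nuisance (X ω)) (stdGaussian (EuclideanSpace ℝ (Fin m))) P :=
  hasLaw_stdGaussian_of_adjoint (F := EuclideanSpace ℝ (Fin m)) hn hX (√(n : ℝ) • nuisanceL m m)
    (fun t => √(n : ℝ) • pair 0 t)
    (fun x t => by
      simp [real_inner_smul_left, real_inner_smul_right, nuisanceL_apply, inner_nuisance_eq])
    (fun t => by rw [norm_smul, mul_pow, Real.norm_of_nonneg (Real.sqrt_nonneg _),
      Real.sq_sqrt (Nat.cast_nonneg n), norm_pair_sq, norm_zero]; ring)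

/-! #### The conditions -/

/-- The cubic term has zero Hessian at the centre, where the information is exactly `n I`. The
Lipschitz bound between `υ` and `0` then controls the deviation, and the full and block smoothness
conditions all rest on it. -/
lemma IsModel.info_sub_le (hX : IsModel P n m X) (hK : IsSmoothKernel K) (hL : 0 < L) (hn : 0 < n)
    (hm : 0 < m) {B : ℝ} (hB0 : 0 < B) (hB : CubicBounds K L n m B) {r₀ : ℝ} (hr₀ : 0 < r₀)
    (hr₀' : r₀ ≤ 2 * √(2 * m : ℝ)) {r : ℝ} (hr : r ≤ r₀) {υ : Par m m}
    (hυ : υ ∈ localSet (modelMatrices n m) 0 r) :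
    (n : ℝ)⁻¹ * ‖info P (fun ω υ => contrast K L n m (X ω) υ)
      (localSet (modelMatrices n m) 0 r₀) υ - (n : ℝ) • 1‖ ≤ B * r / √(n : ℝ) := by
  have hn' : (0 : ℝ) < n := by exact_mod_cast hn
  have hs : 0 < √(n : ℝ) := Real.sqrt_pos.2 hn'
  have hsub := div_sqrt_le_of_le (n := n) hn hr₀'
  rw [localSet_modelMatrices hn] at hυ
  have hυ0 : υ ∈ Metric.closedBall (0 : Par m m) (r₀ / √(n : ℝ)) :=
    Metric.closedBall_subset_closedBall (by gcongr) hυ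
  rw [localSet_modelMatrices hn, info, hX.meanContrast_eq,
    hessian_meanFun_closedBall hK hL hn hm hB (by positivity) hsub hυ0, neg_add, neg_neg,
    add_sub_cancel_left, norm_neg, norm_smul, Real.norm_of_nonneg (by positivity)]
  have h1 := hB.lipschitz υ 0 (mem_modelBall.1 (closedBall_subset_modelBall hsub hυ0))
    (mem_modelBall.1 zero_mem_modelBall)
  rw [hB.zero, sub_zero, sub_zero] at h1
  have h2 : ‖υ‖ ≤ r / √(n : ℝ) := by simpa using hυ
  have h3 := (norm_bilinMatrix_le _).trans h1
  calc (n : ℝ)⁻¹ * (n / 3 * _) ≤ (n : ℝ)⁻¹ * (n / 3 * (B * (r / √(n : ℝ)))) := by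
        gcongr
        exact h3.trans (by gcongr)
    _ = B * r / √(n : ℝ) / 3 := by field_simp
    _ ≤ B * r / √(n : ℝ) := by
      have : 0 ≤ B * r / √(n : ℝ) := by
        rw [mul_div_assoc]; exact mul_nonneg hB0.le ((norm_nonneg _).trans h2)
      linarith

lemma IsModel.conditions (hX : IsModel P n m X) (hK : IsSmoothKernel K) (hL : 0 < L)
    (hn4 : 4 ≤ n) (hm : 0 < m) (hρ : modelScale n m ≤ 3 / 8) {B : ℝ} (hB0 : 0 < B)
    (hB : CubicBounds K L n m B) {r₀ : ℝ} (hr₀ : r₀ ∈ Ioc (0 : ℝ) (2 * √(2 * m : ℝ))) :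
    Conditions (modelMatrices n m) P (fun ω υ => contrast K L n m (X ω) υ) 0 r₀
        0 1 1 (√(n : ℝ)) (1 / √(n : ℝ)) (fun r => B * r / √(n : ℝ))
        (fun _ => 1 / 4) (fun _ => 1) (fun _ => √(n : ℝ)) := by
  have hn : 0 < n := by omega
  have hn' : (0 : ℝ) < n := by exact_mod_cast hn
  have hs : 0 < √(n : ℝ) := Real.sqrt_pos.2 hn'
  have hprob := hX.isProbabilityMeasure
  have hcd : ContDiffOn ℝ 2 (meanContrast P fun ω υ => contrast K L n m (X ω) υ)
      (localSet (modelMatrices n m) 0 r₀) := by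
    rw [hX.meanContrast_eq, localSet_modelMatrices hn]
    exact (contDiffOn_meanFun hK hL hn hm hB).mono
      (closedBall_subset_modelBall (div_sqrt_le_of_le hn hr₀.2))
  have hδ : ∀ r, 0 < r → 0 ≤ B * r / √(n : ℝ) := fun r hr => by positivity
  refine
  { integrable := hX.integrable_contrast
    differentiable := fun ω υ => by
      rw [hX.stoch_eq]
      exact (hasGradientAt_inner _ _).differentiableAt
    differentiableAt := fun ω => (hasGradientAt_contrast_zero hK hL hn hm (X ω)).differentiableAt
    central := by rw [hX.meanContrast_eq, maximizers_meanFun hK hL hn hm hρ]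
    matrices := hX.matrices hK hL hn hm hB
    exists_max := fun ω => maximizers_nonempty hK hL hn hm (X ω)
    exists_maxAt := fun ω => maximizersAt_nonempty hK hL hn hm (X ω) _
    exists_profile := fun ω => ?_
    condI := ⟨zero_lt_one, by simp [modelMatrices]⟩
    condL0 := ⟨hcd, fun r hr hrr υ hυ => ?_⟩
    condL0Block := ⟨hcd, fun r hr hrr υ hυ => ⟨?_, ?_, ?_⟩⟩
    condED0 := ⟨one_pos, hs, fun μ _ γ hγ => ?_⟩
    condED1 := ⟨hs, by positivity, ?_, fun μ _ r _ _ υ _ υ' _ _ γ _ => ?_⟩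
    condLr := fun r hr => ⟨by norm_num, fun υ _ hυ0 => ?_⟩
    condEr := fun r _ => ⟨hs, fun υ _ μ _ γ hγ => ?_⟩ }
  · obtain ⟨υ, hυ⟩ := maximizers_nonempty hK hL hn hm (X ω)
    exact ⟨_, target_mem_profileEstimators hυ⟩
  · have h := hX.info_sub_le hK hL hn hm hB0 hB hr₀.1 hr₀.2 hrr hυ
    refine le_of_eq_of_le ?_ h
    change ‖(√(n : ℝ) • 1)⁻¹ * _ * (√(n : ℝ) • 1)⁻¹ - 1‖ = _
    rw [sqrt_inv_conj hn]
    conv_rhs => rw [← Real.norm_of_nonneg (inv_pos.2 hn').le, ← norm_smul, smul_sub,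
      inv_smul_smul₀ hn'.ne']
  · have h := hX.info_sub_le hK hL hn hm hB0 hB hr₀.1 hr₀.2 hrr hυ
    refine le_trans ?_ h
    change ‖(√(n : ℝ) • 1)⁻¹ * _ * (√(n : ℝ) • 1)⁻¹ - 1‖ ≤ _
    set I := info P (fun ω υ => contrast K L n m (X ω) υ) (localSet (modelMatrices n m) 0 r₀) υ
    have h1 : (I - (n : ℝ) • 1).toBlocks₁₁ = I.toBlocks₁₁ - (n : ℝ) • 1 := by
      ext i j; simp [Matrix.toBlocks₁₁, Matrix.one_apply]
    rw [sqrt_inv_conj hn]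
    have h2 : (n : ℝ)⁻¹ • I.toBlocks₁₁ - 1 = (n : ℝ)⁻¹ • (I - (n : ℝ) • 1).toBlocks₁₁ := by
      rw [h1, smul_sub, inv_smul_smul₀ hn'.ne']
    rw [h2, norm_smul, Real.norm_of_nonneg (inv_pos.2 hn').le]
    gcongr
    exact l2_opNorm_toBlocks₁₁_le _
  · have h := hX.info_sub_le hK hL hn hm hB0 hB hr₀.1 hr₀.2 hrr hυ
    refine le_trans ?_ h
    change ‖(√(n : ℝ) • 1)⁻¹ * (_ - 0) * (√(n : ℝ) • 1)⁻¹‖ ≤ _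
    set I := info P (fun ω υ => contrast K L n m (X ω) υ) (localSet (modelMatrices n m) 0 r₀) υ
    have h1 : (I - (n : ℝ) • 1).toBlocks₁₂ = I.toBlocks₁₂ := by
      ext i j; simp [Matrix.toBlocks₁₂]
    rw [sqrt_inv_conj hn, sub_zero, ← h1, norm_smul, Real.norm_of_nonneg (inv_pos.2 hn').le]
    gcongr
    exact l2_opNorm_toBlocks₁₂_le _
  · refine le_of_eq_of_le ?_ (hδ r hr)
    simp [modelMatrices]
  · simp_rw [hX.gradient_stoch]
    exact expBound_of_hasLaw_gaussianReal (hX.hasLaw_score hn hγ) μ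
  · rw [div_le_div_iff₀ hs two_pos, one_mul, one_mul]
    refine Real.le_sqrt_of_sq_le ?_
    norm_num
    exact_mod_cast hn4
  -- The gradient of `ζ` is constant in the parameter, so the increment is identically zero.
  · simp_rw [hX.gradient_stoch]
    simp only [sub_self, map_zero, inner_zero_right, zero_div]
    refine ⟨by simp, ?_⟩
    have h : cgf (fun _ : Ω => (0 : ℝ)) P μ = 0 := by simp [cgf, mgf]
    rw [h]
    positivity
  · rw [hX.meanContrast_eq, meanFun_zero, sub_zero, sub_zero]
    change _ ≤ _ / ‖Matrix.toEuclideanLin (√(n : ℝ) • 1) υ‖ ^ 2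
    have hpos : 0 < ‖υ‖ := norm_pos_iff.2 hυ0
    rw [toEuclideanLin_smul_one, norm_smul, mul_pow, Real.norm_of_nonneg hs.le,
      Real.sq_sqrt hn'.le, le_div_iff₀ (by positivity)]
    have := meanFun_le hK hL hn hm hρ υ
    linarith
  · simp_rw [hX.gradient_stoch]
    exact expBound_of_hasLaw_gaussianReal (hX.hasLaw_score hn hγ) μ

end Model


/-! ### Localization and the spread -/

section Localization

variable {K : ℝ → ℝ} {L : ℝ} {n m : ℕ} {Ω : Type*} [MeasurableSpace Ω] {P : Measure Ω}
  {X : Ω → Par m m}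

lemma sqrt_mul_modelScale (hn : 0 < n) : √(n : ℝ) * modelScale n m = √(2 * m : ℝ) := by
  have hn' : (0 : ℝ) < n := by exact_mod_cast hn
  rw [modelScale, ← Real.sqrt_mul hn'.le]
  congr 1
  field_simp

lemma norm_sqrt_smul {E : Type*} [NormedAddCommGroup E] [NormedSpace ℝ E] (x : E) :
    ‖√(n : ℝ) • x‖ = √(n : ℝ) * ‖x‖ := by
  rw [norm_smul, Real.norm_of_nonneg (Real.sqrt_nonneg _)]

lemma mem_modelBall_iff_sqrt (hn : 0 < n) {x : Par m m} :
    x ∈ modelBall n m ↔ ‖√(n : ℝ) • x‖ ≤ 2 * √(2 * m : ℝ) := by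
  have hs : 0 < √(n : ℝ) := Real.sqrt_pos.2 (by exact_mod_cast hn)
  rw [mem_modelBall, norm_sqrt_smul, ← sqrt_mul_modelScale hn, ← mul_le_mul_iff_right₀ hs]
  ring_nf

/-- The dimension is `2m`, so the tail bound reads `exp(-m) = exp(-p/2)`; this is the origin of the
range `x ≤ p/2`. -/
lemma IsModel.measure_notMem_modelBall_le (hX : IsModel P n m X) (hn : 0 < n) :
    P {ω | X ω ∉ modelBall n m} ≤ ENNReal.ofReal (Real.exp (-(m : ℝ))) := by
  have h : {ω | X ω ∉ modelBall n m} = {ω | ¬ ‖√(n : ℝ) • X ω‖ ≤ 2 * √(2 * m : ℝ)} := by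
    ext ω
    exact not_congr (mem_modelBall_iff_sqrt hn)
  have hm : MeasurableSet {z : Par m m | ¬ ‖z‖ ≤ 2 * √(2 * m : ℝ)} :=
    (measurableSet_le measurable_norm measurable_const).compl
  rw [h, (hX.hasLaw_sqrt_smul hn).measure_eq hm]
  have h1 := stdGaussian_norm_sq_ge_le (ι := Fin m ⊕ Fin m) (2 * m) (by simp; ring)
  rw [← ENNReal.ofReal_toReal (measure_ne_top _ _)]
  refine ENNReal.ofReal_le_ofReal ((measureReal_mono fun z hz => ?_).trans (h1.trans_eq ?_))
  · simp only [mem_ofPred_eq, not_le] at hz ⊢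
    have h2 : (2 * √(2 * m : ℝ)) ^ 2 ≤ ‖z‖ ^ 2 := by gcongr
    rw [mul_pow, Real.sq_sqrt (by positivity)] at h2
    push_cast
    linarith
  · push_cast
    congr 1
    ring

lemma IsModel.one_sub_le_measure_mem_modelBall (hX : IsModel P n m X) (hn : 0 < n) :
    ENNReal.ofReal (1 - Real.exp (-(m : ℝ))) ≤ P {ω | X ω ∈ modelBall n m} := by
  have := hX.isProbabilityMeasure
  have hmeas : NullMeasurableSet {ω | X ω ∉ modelBall n m} P :=
    hX.aemeasurable.nullMeasurableSet_preimage (Metric.isClosed_closedBall.measurableSet.compl)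
  have h : {ω | X ω ∈ modelBall n m} = {ω | X ω ∉ modelBall n m}ᶜ := by
    ext ω; exact not_not.symm
  rw [h, prob_compl_eq_one_sub₀ hmeas, ENNReal.ofReal_sub _ (Real.exp_pos _).le, ENNReal.ofReal_one]
  exact tsub_le_tsub_left (hX.measure_notMem_modelBall_le hn) 1

lemma pair_zero_nuisance_mem_modelBall {x : Par m m} (hx : x ∈ modelBall n m) :
    pair 0 (nuisance x) ∈ modelBall n m := by
  refine mem_modelBall.2 (le_trans ?_ (mem_modelBall.1 hx))
  refine le_of_sq_le_sq ?_ (norm_nonneg _)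
  rw [norm_pair_sq, norm_zero, norm_sq_eq_target_add_nuisance x]
  nlinarith [sq_nonneg ‖target x‖]

lemma IsModel.two_sqrt_mem_goodRadii (hX : IsModel P n m X) (hK : IsSmoothKernel K) (hL : 0 < L)
    (hn : 0 < n) (hm : 0 < m) {x : ℝ} (hx : x ≤ m) :
    2 * √(2 * m : ℝ) ∈
      goodRadii (modelMatrices n m) P (fun ω υ => contrast K L n m (X ω) υ) 0 x := by
  refine ⟨mul_pos two_pos (Real.sqrt_pos.2 (by positivity)), ?_⟩
  refine (ENNReal.ofReal_le_ofReal ?_).trans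
    ((hX.one_sub_le_measure_mem_modelBall hn).trans (measure_mono fun ω hω => ?_))
  · have : Real.exp (-(m : ℝ)) ≤ Real.exp (-x) := Real.exp_le_exp.2 (by linarith)
    linarith
  · change maximizers (contrast K L n m (X ω)) ⊆ localSet (modelMatrices n m) 0 _ ∧
      maximizersAt (contrast K L n m (X ω)) _ ⊆ localSet (modelMatrices n m) 0 _
    rw [localSet_two_sqrt hn, target_zero, maximizersAt_zero_eq hK hL hn hm]
    exact ⟨fun υ hυ => mem_modelBall_of_mem_maximizers hK hL hn hm hω hυ,
      singleton_subset_iff.2 (pair_zero_nuisance_mem_modelBall hω)⟩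

lemma stdGaussian_singleton_zero (hm : 0 < m) :
    stdGaussian (EuclideanSpace ℝ (Fin m)) {0} = 0 := by
  have h := measurePreserving_eval_multivariateGaussian (μ := (0 : EuclideanSpace ℝ (Fin m)))
    (S := (1 : Matrix (Fin m) (Fin m) ℝ)) Matrix.PosSemidef.one (i := ⟨0, hm⟩)
  rw [multivariateGaussian_zero_one] at h
  have := nullSingletonClass_gaussianReal (μ := (0 : EuclideanSpace ℝ (Fin m)) ⟨0, hm⟩)
    (v := ((1 : Matrix (Fin m) (Fin m) ℝ) ⟨0, hm⟩ ⟨0, hm⟩).toNNReal) (by simp)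
  have h2 := h.measure_preimage (measurableSet_singleton (0 : ℝ)).nullMeasurableSet
  rw [measure_singleton] at h2
  refine measure_mono_null (fun z hz => ?_) h2
  rw [mem_singleton_iff] at hz
  rw [hz]; rfl

lemma exists_stdGaussian_ball_lt (hm : 0 < m) {η : ENNReal} (hη : 0 < η) :
    ∃ r, 0 < r ∧ stdGaussian (EuclideanSpace ℝ (Fin m)) {z | ‖z‖ ≤ r} < η := by
  set A : ℕ → Set (EuclideanSpace ℝ (Fin m)) := fun k => {z | ‖z‖ ≤ 1 / ((k : ℝ) + 1)}
  have hmeas : ∀ k, MeasurableSet (A k) := fun k =>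
    measurableSet_le measurable_norm measurable_const
  have hanti : Antitone A := fun j k hjk z hz => (show ‖z‖ ≤ _ from hz).trans
    (one_div_le_one_div_of_le (by positivity) (by exact_mod_cast Nat.succ_le_succ hjk))
  have hInter : ⋂ k, A k = {0} := by
    ext z
    simp only [mem_iInter, mem_singleton_iff]
    refine ⟨fun h => ?_, fun h k => ?_⟩
    · by_contra hz
      obtain ⟨k, hk⟩ := exists_nat_one_div_lt (norm_pos_iff.2 hz)
      exact absurd (h k) (not_le.2 hk)
    · change ‖z‖ ≤ _
      rw [h, norm_zero]; positivity
  have ht := tendsto_measure_iInter_atTop (μ := stdGaussian (EuclideanSpace ℝ (Fin m)))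
    (fun k => (hmeas k).nullMeasurableSet) hanti ⟨0, measure_ne_top _ _⟩
  rw [hInter, stdGaussian_singleton_zero hm] at ht
  obtain ⟨k, hk⟩ := (ht.eventually (eventually_lt_nhds hη)).exists
  exact ⟨1 / ((k : ℝ) + 1), by positivity, hk⟩

/-- The maximizer under zero target is the nuisance part of `X`, whose law has no atom at `0`. A
small enough ball therefore has mass below `1 - exp(-x)`, which keeps the infimum of good radii
positive. -/
lemma IsModel.exists_le_goodRadii (hX : IsModel P n m X) (hK : IsSmoothKernel K) (hL : 0 < L)
    (hn : 0 < n) (hm : 0 < m) {x : ℝ} (hx : 0 < x) :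
    ∃ r₁, 0 < r₁ ∧ ∀ r ∈ goodRadii (modelMatrices n m) P
      (fun ω υ => contrast K L n m (X ω) υ) 0 x, r₁ ≤ r := by
  have hη : 0 < ENNReal.ofReal (1 - Real.exp (-x)) :=
    ENNReal.ofReal_pos.2 (sub_pos.2 (by simpa using hx))
  obtain ⟨r₁, hr₁, hlt⟩ := exists_stdGaussian_ball_lt hm hη
  refine ⟨r₁, hr₁, fun r hr => ?_⟩
  by_contra! hrr
  have hs : 0 < √(n : ℝ) := Real.sqrt_pos.2 (by exact_mod_cast hn)
  have h1 : P {ω | ‖√(n : ℝ) • nuisance (X ω)‖ ≤ r₁} < ENNReal.ofReal (1 - Real.exp (-x)) := by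
    rwa [(hX.hasLaw_nuisance hn).measure_eq (measurableSet_le measurable_norm measurable_const)]
  refine absurd (hr.2.trans (measure_mono fun ω hω => ?_)) (not_le.2 h1)
  have h2 : maximizersAt (contrast K L n m (X ω)) (target 0) ⊆ _ := hω.2
  rw [target_zero, maximizersAt_zero_eq hK hL hn hm, singleton_subset_iff,
    localSet_modelMatrices hn, mem_closedBall_zero_iff, le_div_iff₀ hs] at h2
  have h3 : ‖nuisance (X ω)‖ ≤ ‖pair (0 : EuclideanSpace ℝ (Fin m)) (nuisance (X ω))‖ :=
    norm_nuisance_le (pair 0 (nuisance (X ω)))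
  change ‖√(n : ℝ) • nuisance (X ω)‖ ≤ r₁
  rw [norm_sqrt_smul]
  nlinarith

lemma IsModel.radius_mem (hX : IsModel P n m X) (hK : IsSmoothKernel K) (hL : 0 < L)
    (hn : 0 < n) (hm : 0 < m) {x : ℝ} (hx0 : 0 < x) (hx : x ≤ m) :
    radius (modelMatrices n m) P (fun ω υ => contrast K L n m (X ω) υ) 0 x ∈
      Ioc (0 : ℝ) (2 * √(2 * m : ℝ)) := by
  have hmem := hX.two_sqrt_mem_goodRadii hK hL hn hm hx
  obtain ⟨r₁, hr₁, h⟩ := hX.exists_le_goodRadii hK hL hn hm hx0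
  exact ⟨hr₁.trans_le (le_csInf ⟨_, hmem⟩ h), csInf_le ⟨r₁, h⟩ hmem⟩

lemma spread_le {B r x : ℝ} (hn : 0 < n) (hB : 0 < B) (hmn : 14 * (m : ℝ) ≤ n) (hr0 : 0 < r)
    (hr : r ≤ 2 * √(2 * m : ℝ)) (hx0 : 0 < x) (hx : x ≤ m) :
    spread 0 1 (√(n : ℝ)) (1 / √(n : ℝ)) (fun r => B * r / √(n : ℝ)) (2 * m) m r x ≤
      (32 * B + 36) * (2 * m : ℝ) / √(n : ℝ) := by
  have hs : 0 < √(n : ℝ) := Real.sqrt_pos.2 (by exact_mod_cast hn)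
  set s := √(2 * m : ℝ) with hsdef
  have hss : s * s = 2 * m := Real.mul_self_sqrt (by positivity)
  have hs0 : 0 ≤ s := Real.sqrt_nonneg _
  -- As `x ≤ m`, the radicand `2(x + 6m)` is at most `14m`. This is at most `n`, which selects the
  -- first branch of `zfun`, and at most `9s² = 18m`.
  have hz : zfun (√(n : ℝ)) x (2 * (2 * m) + 2 * m) ≤ 3 * s := by
    have h1 : √(2 * (x + (2 * (2 * m) + 2 * m))) ≤ √(n : ℝ) := Real.sqrt_le_sqrt (by linarith)
    rw [zfun, if_pos h1]
    refine Real.sqrt_le_iff.2 ⟨by positivity, ?_⟩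
    rw [mul_pow, pow_two s, hss]
    linarith
  rw [spread]
  calc (8 / (1 - (0 : ℝ) ^ 2) ^ 2 * (B * r / √(n : ℝ)) +
        6 * 1 * (1 / √(n : ℝ)) * zfun (√(n : ℝ)) x (2 * (2 * m) + 2 * m)) * r
      ≤ (8 / (1 - (0 : ℝ) ^ 2) ^ 2 * (B * (2 * s) / √(n : ℝ)) +
        6 * 1 * (1 / √(n : ℝ)) * (3 * s)) * (2 * s) := by gcongr
    _ = (32 * B + 36) * (s * s) / √(n : ℝ) := by field_simp; ring
    _ = _ := by rw [hss]

end Localization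

/-! ### The Fisher expansion and the Wilks phenomenon -/

section Expansions

variable {K : ℝ → ℝ} {L : ℝ} {n m : ℕ} {Ω : Type*} [MeasurableSpace Ω] {P : Measure Ω}
  {X : Ω → Par m m}

lemma IsModel.fisher_diff (hX : IsModel P n m X) (hn : 0 < n) (ω : Ω)
    (θ : EuclideanSpace ℝ (Fin m)) :
    Matrix.toEuclideanLin (modelMatrices n m).Dbr (θ - 0) -
      effScore (modelMatrices n m) P (fun ω υ => contrast K L n m (X ω) υ) 0 ω =
      √(n : ℝ) • (θ - target (X ω)) := by
  rw [hX.effScore_eq hn, sub_zero, smul_sub]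
  congr 1
  exact toEuclideanLin_smul_one _ _

/-- Inside the ball the error is at most `2/3 * B * p/√n`, and beyond the shell it is zero, so a
violation forces `√n X` into the shell. Monotonicity of the measure suffices; the event itself need
not be measurable. -/
lemma IsModel.measure_fisher_le (hX : IsModel P n m X) (hK : IsSmoothKernel K) (hL : 0 < L)
    (hn : 0 < n) (hm : 0 < m) {B C : ℝ} (hB0 : 0 < B) (hBC : B ≤ C) (hB : CubicBounds K L n m B)
    {ε : ℝ} (hε : 3 * √(modelScale n m) ≤ ε) :
    P {ω | ∃ θ ∈ profileEstimators (contrast K L n m (X ω)), C * (2 * m : ℝ) / √(n : ℝ) <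
      ‖Matrix.toEuclideanLin (modelMatrices n m).Dbr (θ - 0) -
        effScore (modelMatrices n m) P (fun ω υ => contrast K L n m (X ω) υ) 0 ω‖} ≤
    stdGaussian (Par m m)
      {z | 2 * √(2 * m : ℝ) < ‖z‖ ∧ ‖z‖ ≤ 2 * √(2 * m : ℝ) + ε * √(2 * m : ℝ)} := by
  have hn' : (0 : ℝ) < n := by exact_mod_cast hn
  have hs : 0 < √(n : ℝ) := Real.sqrt_pos.2 hn'
  have hmeas : MeasurableSet
      {z : Par m m | 2 * √(2 * m : ℝ) < ‖z‖ ∧ ‖z‖ ≤ 2 * √(2 * m : ℝ) + ε * √(2 * m : ℝ)} :=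
    (measurableSet_lt measurable_const measurable_norm).inter
      (measurableSet_le measurable_norm measurable_const)
  rw [← (hX.hasLaw_sqrt_smul hn).measure_eq hmeas]
  refine measure_mono fun ω hω => ?_
  obtain ⟨θ, hθ, hlt⟩ := hω
  rw [hX.fisher_diff hn, norm_sqrt_smul] at hlt
  obtain ⟨υ, hυ, rfl⟩ := exists_maximizer_of_mem_profileEstimators hK hL hn hm hθ
  rw [← target_sub] at hlt
  have hC : 0 < C := hB0.trans_le hBC
  refine ⟨?_, ?_⟩
  · by_contra h
    have hx : X ω ∈ modelBall n m := (mem_modelBall_iff_sqrt hn).2 (not_lt.1 h)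
    have h1 := norm_sub_le_of_mem_maximizers hK hL hn hm hB.contDiff hB.bound_fderiv hx hυ
    have h2 := (norm_target_le _).trans h1
    refine absurd hlt (not_lt.2 ?_)
    calc √(n : ℝ) * ‖target (υ - X ω)‖ ≤ √(n : ℝ) * (2 / 3 * (B * modelScale n m ^ 2)) := by gcongr
      _ = 2 / 3 * B * (2 * m) * (√(n : ℝ) / n) := by rw [modelScale_sq]; ring
      _ = 2 / 3 * (B * (2 * m) / √(n : ℝ)) := by
        rw [Real.sqrt_div_self']; ring
      _ ≤ 1 * (B * (2 * m) / √(n : ℝ)) := by gcongr; norm_num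
      _ ≤ C * (2 * m) / √(n : ℝ) := by rw [one_mul]; gcongr
  · by_contra h
    have hx : 2 * modelScale n m + 3 * (modelScale n m * √(modelScale n m)) < ‖X ω‖ := by
      rw [not_le, norm_sqrt_smul, ← sqrt_mul_modelScale hn] at h
      have h2 : √(n : ℝ) * (2 * modelScale n m + ε * modelScale n m) < √(n : ℝ) * ‖X ω‖ := by
        linarith
      have h3 := lt_of_mul_lt_mul_left h2 hs.le
      have h4 := mul_le_mul_of_nonneg_right hε (modelScale_pos hn hm).le
      linarith
    rw [eq_of_mem_maximizers_of_lt_norm hK hL hn hm hx hυ, sub_self, target_zero, norm_zero,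
      mul_zero] at hlt
    have : 0 ≤ C * (2 * m : ℝ) / √(n : ℝ) := by positivity
    linarith

lemma mul_modelScale_pow_three (hn : 0 < n) :
    n * modelScale n m ^ 3 = √((2 * m : ℝ) ^ 3 / n) := by
  have hn' : (0 : ℝ) < n := by exact_mod_cast hn
  have h0 : 0 ≤ n * modelScale n m ^ 3 :=
    mul_nonneg hn'.le (pow_nonneg (Real.sqrt_nonneg _) 3)
  rw [eq_comm, Real.sqrt_eq_iff_mul_self_eq (by positivity) h0]
  have h : (n * modelScale n m ^ 3) * (n * modelScale n m ^ 3) =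
      (n : ℝ) ^ 2 * (modelScale n m ^ 2) ^ 3 := by ring
  rw [h, modelScale_sq]
  field_simp

lemma IsModel.wilks_eq (hX : IsModel P n m X) (hn : 0 < n) (ω : Ω) :
    ‖effScore (modelMatrices n m) P (fun ω υ => contrast K L n m (X ω) υ) 0 ω‖ ^ 2 =
      n * ‖target (X ω)‖ ^ 2 := by
  rw [hX.effScore_eq hn, norm_sqrt_smul, mul_pow, Real.sq_sqrt (Nat.cast_nonneg n)]

lemma IsModel.abs_wilks_le (hX : IsModel P n m X) (hK : IsSmoothKernel K) (hL : 0 < L)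
    (hn : 0 < n) (hm : 0 < m) (ω : Ω) :
    |2 * excess (contrast K L n m (X ω)) 0 -
      ‖effScore (modelMatrices n m) P (fun ω υ => contrast K L n m (X ω) υ) 0 ω‖ ^ 2| ≤
      16 / 3 * √((2 * m : ℝ) ^ 3 / n) := by
  obtain ⟨h1, h2⟩ := gap_bounds hK hL hn hm (X ω)
  rw [hX.wilks_eq hn, ← mul_modelScale_pow_three hn, abs_of_nonneg]
  · exact h2
  · refine le_trans ?_ h1
    have := cutoff_nonneg hK hL hn hm (X ω)
    positivity

/-- The step is monotone, so on this event the cutoff at `X` is at least `stepProfile K σ`, while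
`‖X‖ ≥ (σ/L) ρ` with `ρ = modelScale n m`. -/
lemma IsModel.le_abs_wilks (hX : IsModel P n m X) (hK : IsSmoothKernel K) (hL : 0 < L)
    (hn : 0 < n) (hm : 0 < m) {σ : ℝ} (hσ : 0 < σ) {ω : Ω} (hω : X ω ∈ modelBall n m)
    (hσω : σ * bandwidth L n m ≤ ‖target (X ω)‖) :
    2 / 3 * (stepProfile K σ * (σ / L) ^ 3) * √((2 * m : ℝ) ^ 3 / n) ≤
      |2 * excess (contrast K L n m (X ω)) 0 -
        ‖effScore (modelMatrices n m) P (fun ω υ => contrast K L n m (X ω) υ) 0 ω‖ ^ 2| := by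
  obtain ⟨h1, -⟩ := gap_bounds hK hL hn hm (X ω)
  have hb := bandwidth_pos hL hn hm
  rw [hX.wilks_eq hn, ← mul_modelScale_pow_three hn]
  refine le_trans ?_ (h1.trans (le_abs_self _))
  have h2 : stepProfile K σ ≤ cutoff K L n m (X ω) := by
    rw [cutoff_of_mem hK hL hn hm hω]
    exact stepProfile_mono hK ((le_div_iff₀ hb).2 hσω)
  have h3 : σ / L * modelScale n m ≤ ‖X ω‖ := by
    refine le_trans (le_of_eq ?_) (hσω.trans (norm_target_le _))
    rw [bandwidth]; ring
  have hρ := modelScale_pos hn hm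
  have h0 := stepProfile_nonneg hK σ
  calc _ = 2 * n / 3 * (stepProfile K σ * (σ / L * modelScale n m) ^ 3) := by ring
    _ ≤ _ := by
      gcongr
      exact h0.trans h2

lemma IsModel.measureReal_target_le (hX : IsModel P n m X) (hL : 0 < L) (hn : 0 < n)
    {σ τ : ℝ}
    (hτ : (stdGaussian (EuclideanSpace ℝ (Fin m))).real
      {z | ‖z‖ ^ 2 ≤ 2 * (σ / L) ^ 2 * m} ≤ τ ^ m) :
    P.real {ω | ‖target (X ω)‖ < σ * bandwidth L n m} ≤ τ ^ m := by
  have hn' : (0 : ℝ) < n := by exact_mod_cast hn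
  have := hX.isProbabilityMeasure
  have hmeas : MeasurableSet
      {z : EuclideanSpace ℝ (Fin m) | ‖z‖ ^ 2 ≤ 2 * (σ / L) ^ 2 * m} :=
    measurableSet_le (measurable_norm.pow_const 2) measurable_const
  rw [← (hX.hasLaw_target hn).measureReal_eq hmeas] at hτ
  refine (measureReal_mono fun ω hω => ?_).trans hτ
  have h1 : ‖target (X ω)‖ ^ 2 ≤ (σ * bandwidth L n m) ^ 2 := by
    have : ‖target (X ω)‖ < σ * bandwidth L n m := hω
    gcongr
  change ‖√(n : ℝ) • target (X ω)‖ ^ 2 ≤ _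
  rw [norm_sqrt_smul, mul_pow, Real.sq_sqrt hn'.le]
  calc (n : ℝ) * ‖target (X ω)‖ ^ 2 ≤ n * (σ * bandwidth L n m) ^ 2 := by gcongr
    _ = (σ / L) ^ 2 * (n * modelScale n m ^ 2) := by rw [bandwidth]; ring
    _ = 2 * (σ / L) ^ 2 * m := by rw [modelScale_sq]; field_simp

end Expansions

section Sequences

variable {K : ℝ → ℝ} {L : ℝ} {m : ℕ → ℕ}
  {Ω : ℕ → Type*} [∀ n, MeasurableSpace (Ω n)] {P : ∀ n, Measure (Ω n)}
  {X : ∀ n, Ω n → Par (m n) (m n)}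

lemma eventually_model_small (hm : ∀ n, 0 < m n)
    (hmn : Tendsto (fun n : ℕ => (2 * m n : ℝ) ^ 2 / (n : ℝ)) atTop (𝓝 0)) {ε : ℝ} (hε : 0 < ε) :
    ∀ᶠ n : ℕ in atTop, modelScale n (m n) ≤ ε ∧ 14 * (m n : ℝ) ≤ n ∧ 4 ≤ n := by
  filter_upwards [hmn.eventually (eventually_le_nhds (show 0 < min (ε ^ 2) (1 / 7) by positivity)),
    eventually_ge_atTop 4] with n hn h4
  have hn' : (0 : ℝ) < n := by exact_mod_cast (by omega : 0 < n)
  have hm1 : (1 : ℝ) ≤ m n := by exact_mod_cast hm n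
  -- Since `p ≥ 1`, `p²/n → 0` already forces `p/n → 0`.
  have h1 : (2 * m n : ℝ) / n ≤ (2 * m n : ℝ) ^ 2 / n := by gcongr; nlinarith
  refine ⟨?_, ?_, h4⟩
  · exact Real.sqrt_le_iff.2 ⟨hε.le, h1.trans (hn.trans (min_le_left _ _))⟩
  · have h2 := h1.trans (hn.trans (min_le_right _ _))
    rw [div_le_iff₀ hn'] at h2
    linarith

lemma fisherRate (hK : IsSmoothKernel K) (hL : 0 < L) (hm : ∀ n, 0 < m n)
    (hmn : Tendsto (fun n : ℕ => (2 * m n : ℝ) ^ 2 / (n : ℝ)) atTop (𝓝 0))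
    (hX : ∀ n, 0 < n → IsModel (P n) n (m n) (X n)) {B C : ℝ} (hB0 : 0 < B) (hBC : B ≤ C)
    (hB : ∀ n m : ℕ, 0 < n → 0 < m → CubicBounds K L n m B) :
    FisherRate C m P (fun n => modelMatrices n (m n)) (modelContrast K L m X) := by
  rw [FisherRate, ENNReal.tendsto_nhds_zero]
  intro η hη
  obtain ⟨ε, hε, hshell⟩ := exists_stdGaussian_shell_le hη
  filter_upwards [eventually_model_small hm hmn (show 0 < (ε / 3) ^ 2 by positivity)] with n hn
  have hn0 : 0 < n := by omega
  refine ((hX n hn0).measure_fisher_le hK hL hn0 (hm n) hB0 hBC (hB n (m n) hn0 (hm n)) ?_).trans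
    (hshell (m n) (hm n))
  have h : √(modelScale n (m n)) ≤ ε / 3 := Real.sqrt_le_iff.2 ⟨by positivity, hn.1⟩
  linarith

lemma fisherExpansion_of_fisherRate
    (hmn : Tendsto (fun n : ℕ => (2 * m n : ℝ) ^ 2 / (n : ℝ)) atTop (𝓝 0)) {C : ℝ}
    {M : ∀ n, Matrices (m n) (m n)} {ℒ : ∀ n, Ω n → Par (m n) (m n) → ℝ}
    (h : FisherRate C m P M ℒ) : FisherExpansion m P M ℒ := by
  intro ε hε
  have h0 : Tendsto (fun n : ℕ => C * (2 * m n : ℝ) / √(n : ℝ)) atTop (𝓝 0) := by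
    have h1 := (hmn.sqrt).const_mul C
    rw [Real.sqrt_zero, mul_zero] at h1
    refine h1.congr fun n => ?_
    rw [Real.sqrt_div (by positivity), Real.sqrt_sq (by positivity), ← mul_div_assoc]
  refine tendsto_of_tendsto_of_tendsto_of_le_of_le' tendsto_const_nhds h
    (Eventually.of_forall fun n => zero_le) ?_
  filter_upwards [h0.eventually (eventually_lt_nhds hε)] with n hn
  exact measure_mono fun ω ⟨θ, hθ, hle⟩ => ⟨θ, hθ, hn.trans_le hle⟩

/-- The upper bound on the gap holds for every outcome, so the exceptional event is eventually
empty. -/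
lemma wilksPhenomenon_of_tendsto (hK : IsSmoothKernel K) (hL : 0 < L) (hm : ∀ n, 0 < m n)
    (hX : ∀ n, 0 < n → IsModel (P n) n (m n) (X n))
    (h3 : Tendsto (fun n : ℕ => (2 * m n : ℝ) ^ 3 / (n : ℝ)) atTop (𝓝 0)) :
    WilksPhenomenon m P (fun n => modelMatrices n (m n)) (modelContrast K L m X) := by
  intro ε hε
  have h1 := (h3.sqrt).const_mul (16 / 3)
  rw [Real.sqrt_zero, mul_zero] at h1
  refine tendsto_const_nhds.congr' ?_
  filter_upwards [h1.eventually (eventually_lt_nhds hε), eventually_gt_atTop 0] with n hn hn0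
  refine Eq.symm (measure_mono_null (fun ω hω => ?_) (measure_empty (μ := P n)))
  exact absurd ((hX n hn0).abs_wilks_le hK hL hn0 (hm n) ω) (not_le.2 (hn.trans_le hω))

/-- If `p³/n ≥ c` for some large `n`, the gap exceeds the fixed level `c₁ √c` unless `X` leaves the
ball or its target is short. Those two events have probability at most `1/2` and `1/4`, which
contradicts convergence in probability. -/
lemma tendsto_of_wilksPhenomenon (hK : IsSmoothKernel K) (hL : 0 < L) (hm : ∀ n, 0 < m n)
    (hX : ∀ n, 0 < n → IsModel (P n) n (m n) (X n))
    (hcase : tsupport K = Icc (-1) 1 ∨ 2 * √2 ≤ L)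
    (hW : WilksPhenomenon m P (fun n => modelMatrices n (m n)) (modelContrast K L m X)) :
    Tendsto (fun n : ℕ => (2 * m n : ℝ) ^ 3 / (n : ℝ)) atTop (𝓝 0) := by
  obtain ⟨σ, hσ0, hσ, hpos⟩ := exists_stepProfile_pos hK hL hcase
  -- After scaling by `√n`, a target shorter than `σh` has squared norm below `2(σ/L)² m`, whereas
  -- the mean is `m`. The restriction `σ < L/√2` makes this a genuine lower deviation.
  have hκ1 : 2 * (σ / L) ^ 2 < 1 := by
    have h1 : σ / L < 1 / √2 := by
      rw [div_lt_div_iff₀ hL (by positivity), one_mul]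
      rwa [lt_div_iff₀ (by positivity)] at hσ
    have h2 : (σ / L) ^ 2 < (1 / √2) ^ 2 := by gcongr
    rw [div_pow 1, Real.sq_sqrt zero_le_two] at h2
    linarith
  obtain ⟨τ, hτ0, hτ1, hτ⟩ := exists_stdGaussian_norm_sq_le_le (by positivity) hκ1
  obtain ⟨M, hM⟩ := eventually_atTop.1
    ((tendsto_pow_atTop_nhds_zero_of_lt_one hτ0 hτ1).eventually
      (eventually_le_nhds (show (0 : ℝ) < 1 / 4 by norm_num)))
  set c₁ := 2 / 3 * (stepProfile K σ * (σ / L) ^ 3) with hc₁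
  have hc₁0 : 0 < c₁ := by positivity
  refine tendsto_order.2 ⟨fun a ha => Eventually.of_forall fun n => ha.trans_le (by positivity),
    fun c hc => ?_⟩
  have hev := (hW (c₁ * √c) (by positivity)).eventually
    (eventually_lt_nhds (show (0 : ENNReal) < ENNReal.ofReal (1 / 4) by simp))
  have hbig : ∀ᶠ n : ℕ in atTop, (2 * M : ℝ) ^ 3 ≤ c * n :=
    (tendsto_natCast_atTop_atTop.const_mul_atTop hc).eventually_ge_atTop _
  filter_upwards [hev, hbig, eventually_gt_atTop 0] with n hn hbn hn0
  by_contra! hcn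
  have hn' : (0 : ℝ) < n := by exact_mod_cast hn0
  have hXn := hX n hn0
  have := hXn.isProbabilityMeasure
  -- The tail `τ^m` is small only in high dimension; `p³ ≥ c n` with `n` large guarantees it.
  have hMm : M ≤ m n := by
    rw [le_div_iff₀ hn'] at hcn
    have h1 : (2 * M : ℝ) ≤ 2 * m n := le_of_pow_le_pow_left₀ three_ne_zero (by positivity)
      (hbn.trans hcn)
    exact_mod_cast (by linarith : (M : ℝ) ≤ m n)
  set E := {ω | c₁ * √c ≤ |2 * excess (modelContrast K L m X n ω) 0 -
    ‖effScore (modelMatrices n (m n)) (P n) (modelContrast K L m X n) 0 ω‖ ^ 2|}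
  have hE : (P n).real E < 1 / 4 := by
    rw [← ENNReal.ofReal_lt_ofReal_iff (by norm_num), ofReal_measureReal]
    exact hn
  have hball : (P n).real {ω | X n ω ∉ modelBall n (m n)} ≤ 1 / 2 := by
    refine ENNReal.toReal_le_of_le_ofReal (by norm_num)
      ((hXn.measure_notMem_modelBall_le hn0).trans (ENNReal.ofReal_le_ofReal ?_))
    have h1 : (1 : ℝ) ≤ m n := by exact_mod_cast hm n
    have h2 := Real.add_one_le_exp (m n : ℝ)
    rw [Real.exp_neg, one_div]
    exact inv_anti₀ two_pos (by linarith)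
  have htar : (P n).real {ω | ‖target (X n ω)‖ < σ * bandwidth L n (m n)} ≤ 1 / 4 :=
    (hXn.measureReal_target_le hL hn0 (hτ (m n))).trans (hM _ hMm)
  have hcover : (univ : Set (Ω n)) ⊆ E ∪ ({ω | X n ω ∉ modelBall n (m n)} ∪
      {ω | ‖target (X n ω)‖ < σ * bandwidth L n (m n)}) := fun ω _ => by
    by_cases h1 : X n ω ∈ modelBall n (m n)
    · by_cases h2 : σ * bandwidth L n (m n) ≤ ‖target (X n ω)‖
      · left
        refine le_trans ?_ (hXn.le_abs_wilks hK hL hn0 (hm n) hσ0 h1 h2)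
        gcongr
      · exact Or.inr (Or.inr (not_le.1 h2))
    · exact Or.inr (Or.inl h1)
  have h1 := measureReal_mono (μ := P n) hcover
  rw [probReal_univ] at h1
  have h2 := measureReal_union_le (μ := P n) E ({ω | X n ω ∉ modelBall n (m n)} ∪
      {ω | ‖target (X n ω)‖ < σ * bandwidth L n (m n)})
  have h3 := measureReal_union_le (μ := P n) {ω | X n ω ∉ modelBall n (m n)}
      {ω | ‖target (X n ω)‖ < σ * bandwidth L n (m n)}
  linarith

end Sequences

end ProfileEst

end

/-! ### The main theorem. -/

theorem theorem3 (K : ℝ → ℝ) (hK : IsSmoothKernel K) (L : ℝ) (hL : 0 < L) :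
    -- constants depending only on the kernel and on `L`
    ∃ Lt C : ℝ, 0 < Lt ∧ 0 < C ∧
    ∀ (m : ℕ → ℕ), (∀ n, 0 < m n) →
      Tendsto (fun n : ℕ => (2 * m n : ℝ) ^ 2 / (n : ℝ)) atTop (𝓝 0) →
    ∀ (Ω : ℕ → Type*) [∀ n, MeasurableSpace (Ω n)] (P : ∀ n, Measure (Ω n))
      (X : ∀ n, Ω n → Par (m n) (m n)),
      (∀ n, 0 < n → IsModel (P n) n (m n) (X n)) →
    -- the cutoff
    (∀ n, 0 < n → ∀ υ : Par (m n) (m n),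
      0 ≤ cutoff K L n (m n) υ ∧ cutoff K L n (m n) υ ≤ 1 ∧
      (target υ = 0 → cutoff K L n (m n) υ = 0) ∧
      (2 / L * √((2 * m n : ℝ) / n) ≤ ‖target υ‖ →
        ‖υ‖ ≤ 2 * √((2 * m n : ℝ) / n) → cutoff K L n (m n) υ = 1)) ∧
    -- the Hessian of the expected contrast is Lipschitz on the ball, with constant `n * Lt`
    (∀ᶠ n : ℕ in atTop,
      ContDiffOn ℝ 2 (meanContrast (P n) (modelContrast K L m X n)) (modelBall n (m n)) ∧
      ∀ υ ∈ modelBall n (m n), ∀ υ' ∈ modelBall n (m n),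
        ‖hessian (meanContrast (P n) (modelContrast K L m X n)) (modelBall n (m n)) υ -
          hessian (meanContrast (P n) (modelContrast K L m X n)) (modelBall n (m n)) υ'‖ ≤
        n * Lt * ‖υ - υ'‖) ∧
    -- all conditions hold, at every local radius up to `2 * √p_n`
    (∀ᶠ n : ℕ in atTop, ∀ r₀ ∈ Ioc (0 : ℝ) (2 * √(2 * m n : ℝ)),
      Conditions (modelMatrices n (m n)) (P n) (modelContrast K L m X n) 0 r₀
        0 1 1 (√(n : ℝ)) (1 / √(n : ℝ)) (fun r => Lt * r / √(n : ℝ))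
        (fun _ => 1 / 4) (fun _ => 1) (fun _ => √(n : ℝ))) ∧
    -- the radius `r₀(x)` and the order of the spread
    (∀ᶠ n : ℕ in atTop, ∀ x : ℝ, 0 < x → x ≤ (2 * m n : ℝ) / 2 →
      2 * √(2 * m n : ℝ) ∈
        goodRadii (modelMatrices n (m n)) (P n) (modelContrast K L m X n) 0 x ∧
      radius (modelMatrices n (m n)) (P n) (modelContrast K L m X n) 0 x ∈
        Ioc (0 : ℝ) (2 * √(2 * m n : ℝ)) ∧
      spread 0 1 (√(n : ℝ)) (1 / √(n : ℝ)) (fun r => Lt * r / √(n : ℝ)) (2 * m n) (m n)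
        (radius (modelMatrices n (m n)) (P n) (modelContrast K L m X n) 0 x) x ≤
        C * (2 * m n : ℝ) / √(n : ℝ)) ∧
    -- the efficient score is standard normal, so that its squared norm is chi-squared
    -- with `m n` degrees of freedom
    (∀ n, 0 < n → HasLaw (effScore (modelMatrices n (m n)) (P n) (modelContrast K L m X n) 0)
      (stdGaussian (EuclideanSpace ℝ (Fin (m n)))) (P n)) ∧
    -- the Fisher expansion, with its rate
    FisherRate C m P (fun n => modelMatrices n (m n)) (modelContrast K L m X) ∧
    FisherExpansion m P (fun n => modelMatrices n (m n)) (modelContrast K L m X) ∧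
    -- the Wilks phenomenon
    (Tendsto (fun n : ℕ => (2 * m n : ℝ) ^ 3 / (n : ℝ)) atTop (𝓝 0) →
      WilksPhenomenon m P (fun n => modelMatrices n (m n)) (modelContrast K L m X)) ∧
    (tsupport K = Icc (-1) 1 ∨ 2 * √2 ≤ L →
      WilksPhenomenon m P (fun n => modelMatrices n (m n)) (modelContrast K L m X) →
      Tendsto (fun n : ℕ => (2 * m n : ℝ) ^ 3 / (n : ℝ)) atTop (𝓝 0)) := by
  obtain ⟨B, hB0, hB⟩ := exists_cubicBounds hK hL
  -- The second constant is dictated by the spread; it exceeds `B`, so it also serves as the Fisher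
  -- rate.
  refine ⟨B, 32 * B + 36, hB0, by positivity, fun m hm hmn Ω _ P X hX => ?_⟩
  have hsmall := eventually_model_small hm hmn (show (0 : ℝ) < 3 / 8 by norm_num)
  have hrate := fisherRate (C := 32 * B + 36) hK hL hm hmn hX hB0 (by linarith) hB
  refine ⟨fun n hn υ => ⟨cutoff_nonneg hK hL hn (hm n) υ, cutoff_le_one hK hL hn (hm n) υ,
    cutoff_of_target_eq_zero hK hL hn (hm n), fun h1 h2 =>
      cutoff_eq_one hK hL hn (hm n) h1 (mem_modelBall.2 h2)⟩, ?_, ?_, ?_, fun n hn => ?_, hrate,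
    fisherExpansion_of_fisherRate hmn hrate, wilksPhenomenon_of_tendsto hK hL hm hX,
    tendsto_of_wilksPhenomenon hK hL hm hX⟩
  · filter_upwards [eventually_gt_atTop 0] with n hn
    have hmean : meanContrast (P n) (modelContrast K L m X n) = meanFun K L n (m n) :=
      (hX n hn).meanContrast_eq
    rw [hmean]
    exact ⟨contDiffOn_meanFun hK hL hn (hm n) (hB n (m n) hn (hm n)), fun υ hυ υ' hυ' =>
      hessian_meanFun_lipschitz hK hL hn (hm n) hB0 (hB n (m n) hn (hm n)) hυ hυ'⟩
  · filter_upwards [hsmall] with n hn r₀ hr₀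
    have hn0 : 0 < n := by omega
    exact (hX n hn0).conditions hK hL hn.2.2 (hm n) hn.1 hB0 (hB n (m n) hn0 (hm n)) hr₀
  · filter_upwards [hsmall] with n hn x hx0 hx
    have hn0 : 0 < n := by omega
    have hxm : x ≤ m n := by linarith
    have hr := (hX n hn0).radius_mem hK hL hn0 (hm n) hx0 hxm
    exact ⟨(hX n hn0).two_sqrt_mem_goodRadii hK hL hn0 (hm n) hxm, hr,
      spread_le hn0 hB0 hn.2.1 hr.1 hr.2 hx0 hxm⟩
  · exact ((hX n hn).hasLaw_target hn).congr
      (ae_of_all _ fun ω => (hX n hn).effScore_eq hn ω)
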